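/- Let $N,m\in\mathbb N$ with $N,m\ge 2$, let $1<p<\infty$, and for $b^-<b^+$ let $\Omega=\{x=(x',x_N)\in\mathbb R^{N-1}\times\mathbb R : b^-<x_N<b^+\}$. Let $\dot W^{m,p}(\Omega)$ be the space of all $u\in L^1_{\rm loc}(\Omega)$ whose distributional derivatives of order $m$ belong to $L^p(\Omega)$. Write $\nabla^k v=(\partial^\alpha v)_{|\alpha|=k}$, $\alpha\in\mathbb N_0^N$, and $\nabla_\shortparallel^k v=(\partial^{\alpha}v)_{|\alpha|=k}$ with $\alpha=(\alpha',0)$, $\alpha'\in\mathbb N_0^{N-1}$ ($\nabla^0v=\nabla_\shortparallel^0v=v$), with Euclidean norms of these vectors. For a function $v$ on $\Omega$ such that $v$ and its weak first order derivatives are integrable on bounded subsets of $\Omega$, the trace of $v$ is the pair of functions $\operatorname{Tr}(v)(\cdot,b^\pm)\in L^p_{\rm loc}(\mathbb R^{N-1})$, unique up to null sets if it exists, such that for all $\psi\in C^1_c(\mathbb R^N)$ and $i=1,\dots,N$ $$\int_\Omega v\,\partial_i\psi\,dx=-\int_\Omega\psi\,\partial_i v\,dx+\delta_{iN}\int_{\mathbb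 R^{N-1}}\big(\psi(x',b^+)\operatorname{Tr}(v)(x',b^+)-\psi(x',b^-)\operatorname{Tr}(v)(x',b^-)\big)\,dx'.$$ **Theorem.** There is a constant $c=c(m,N,p)>0$ such that for all $b^-<b^+$ and all $u\in\dot W^{m,p}(\Omega)$ the following hold. (0) The weak derivatives $\partial^\alpha u$, $|\alpha|\le m$, exist in $L^1_{\rm loc}(\Omega)$; $\partial^\alpha u$ has a trace for $|\alpha|\le m-1$; and for $\alpha'\in\mathbb N_0^{N-1}$, $k\in\mathbb N_0$ with $|\alpha'|+k\le m-1$ the weak derivative $\partial^{\alpha'}\operatorname{Tr}(\partial_N^ku)(\cdot,b^\pm)$ on $\mathbb R^{N-1}$ exists and equals $\operatorname{Tr}(\partial^{(\alpha',k)}u)(\cdot,b^\pm)$. (1) For all $i,l\in\mathbb N_0$ with $0\le i+l\le m-1$, $$\int_{\mathbb R^{N-1}}\Big|\sum_{k=0}^{m-l-i-1}\frac{(-1)^k}{k!}\big(\nabla_\shortparallel^i\operatorname{Tr}(\partial_N^{k+l}u)(x',b^+)+(-1)^{k+1}\nabla_\shortparallel^i\operatorname{Tr}(\partial_N^{k+l}u)(x',b^-)\big)\Big(\frac{b^+-b^-}2\Big)^k\Big|^p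 dx'\le(b^+-b^-)^{(m-i-l)p-1}\int_\Omega|\nabla^mu|^p\,dx.$$ (2) For both choices of the sign $\pm$, $$\int_{\mathbb R^{N-1}}\int_{B'(0,b^+-b^-)}\frac{|\operatorname{Tr}(\nabla^{m-1}u)(x'+h',b^\pm)-\operatorname{Tr}(\nabla^{m-1}u)(x',b^\pm)|^p}{|h'|^{p+N-2}}\,dh'\,dx'\le c\int_\Omega|\nabla^mu|^p\,dx,$$ where $B'(0,r)$ is the open ball of radius $r$ in $\mathbb R^{N-1}$. (3) If $m=2$, then moreover, for every $i=1,\dots,N$, $$\int_{\mathbb R^{N-1}}|\operatorname{Tr}(\partial_iu)(x',b^+)-\operatorname{Tr}(\partial_iu)(x',b^-)|^p\,dx'\le(b^+-b^-)^{p-1}\int_\Omega|\partial^2_{i,N}u|^p\,dx,$$ $$\int_{\mathbb R^{N-1}}\Big|\operatorname{Tr}(u)(x',b^+)-\operatorname{Tr}(u)(x',b^-)-\big(\operatorname{Tr}(\partial_Nu)(x',b^+)+\operatorname{Tr}(\partial_Nu)(x',b^-)\big)\frac{b^+-b^-}2\Big|^p dx'\le(b^+-b^-)^{2p-1}\int_\Omega|\partial_N^2u|^p\,dx,$$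 and, for both choices of the sign $\pm$, $$\int_{\mathbb R^{N-1}}\int_{B'(0,b^+-b^-)}\frac{|\operatorname{Tr}(\partial_iu)(x'+h',b^\pm)-\operatorname{Tr}(\partial_iu)(x',b^\pm)|^p}{|h'|^{p+N-2}}\,dh'\,dx'\le c\int_\Omega|\nabla^2u|^p\,dx.$$ -/

import Mathlib

open MeasureTheory Set
open scoped ContDiff ENNReal

namespace TraceStrip

noncomputable section

/-! Weak derivatives with respect to a finite family of coordinate directions. -/

section WeakDerivatives

variable {V : Type*} [NormedAddCommGroup V] [NormedSpace ℝ V] [MeasureSpace V]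

/-- The classical partial derivative `∂^α φ = ∂_1^{α_1} ⋯ ∂_n^{α_n} φ`, where `∂_i` is the derivative
in the coordinate direction `e i`. -/
def partialDeriv {n : ℕ} (e : Fin n → V) (α : Fin n → ℕ) (φ : V → ℝ) : V → ℝ :=
  (List.ofFn fun i => (fun (g : V → ℝ) (x : V) => fderiv ℝ g x (e i))^[α i]).foldr
    (fun T g => T g) φ

/-- `g ∈ L¹_loc(U)` is the weak (distributional) derivative `∂^α u` of `u ∈ L¹_loc(U)` in `U`. -/
structure IsWeakDeriv {n : ℕ} (e : Fin n → V) (U : Set V) (α : Fin n → ℕ) (u g : V → ℝ) :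
    Prop where
  locallyIntegrable_left : LocallyIntegrableOn u U
  locallyIntegrable_right : LocallyIntegrableOn g U
  integral_eq : ∀ φ : V → ℝ, ContDiff ℝ ∞ φ → HasCompactSupport φ → tsupport φ ⊆ U →
    ∫ x in U, u x * partialDeriv e α φ x = (-1) ^ (∑ i, α i) * ∫ x in U, g x * φ x

open scoped Classical in
/-- A representative of the weak derivative `∂^α u` in `U` (the zero function if there is none). -/
def weakDeriv {n : ℕ} (e : Fin n → V) (U : Set V) (α : Fin n → ℕ) (u : V → ℝ) : V → ℝ :=
  if h : ∃ g, IsWeakDeriv e U α u g then h.choose else 0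

/-- Membership in the homogeneous Sobolev space `Ẇ^{m,p}(U)`: `u ∈ L¹_loc(U)` and all its
distributional derivatives of order `m` are functions in `L^p(U)`. -/
def MemHomSobolev {n : ℕ} (e : Fin n → V) (U : Set V) (m : ℕ) (p : ℝ) (u : V → ℝ) : Prop :=
  LocallyIntegrableOn u U ∧
    ∀ α : Fin n → ℕ, ∑ i, α i = m →
      ∃ g, IsWeakDeriv e U α u g ∧ MemLp g (ENNReal.ofReal p) (volume.restrict U)

end WeakDerivatives

/-- The Euclidean norm of a vector `(F α)_{|α| = k}` indexed by the multi-indices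
`α ∈ ℕ₀ⁿ` of order `k`. -/
def multiNorm {n : ℕ} (k : ℕ) (F : (Fin n → ℕ) → ℝ) : ℝ :=
  √(∑ α ∈ Finset.piAntidiag (Finset.univ : Finset (Fin n)) k, F α ^ 2)

/-! Coordinates. With `N = d + 1`, a point of `ℝ^N` is a pair `x = (x', x_N)` in `ℝ^{N-1} × ℝ`. -/

/-- The horizontal space `ℝ^{N-1}`, with its Euclidean norm and Lebesgue measure. -/
abbrev Hor (d : ℕ) : Type := EuclideanSpace ℝ (Fin d)

/-- The space `ℝ^N = ℝ^{N-1} × ℝ`, with (product) Lebesgue measure. -/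
abbrev Full (d : ℕ) : Type := Hor d × ℝ

/-- The standard basis of `ℝ^{N-1}`. -/
def horDir (d : ℕ) : Fin d → Hor d := fun j => EuclideanSpace.single j (1 : ℝ)

/-- The standard basis of `ℝ^N = ℝ^{N-1} × ℝ`; the last vector is the normal direction `e_N`. -/
def fullDir (d : ℕ) : Fin (d + 1) → Full d :=
  Fin.snoc (α := fun _ => Full d) (fun j => (horDir d j, (0 : ℝ))) ((0 : Hor d), (1 : ℝ))

/-- The multi-index `(α', k) ∈ ℕ₀^{N-1} × ℕ₀`. -/
def multi {d : ℕ} (α' : Fin d → ℕ) (k : ℕ) : Fin (d + 1) → ℕ := Fin.snoc (α := fun _ => ℕ) α' k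

/-- The strip `Ω = {x ∈ ℝ^N : b⁻ < x_N < b⁺}`. -/
def strip (d : ℕ) (bm bp : ℝ) : Set (Full d) := {x | bm < x.2 ∧ x.2 < bp}

/-- The weak derivative `∂^α u` in the strip. -/
def stripDeriv {d : ℕ} (bm bp : ℝ) (α : Fin (d + 1) → ℕ) (u : Full d → ℝ) : Full d → ℝ :=
  weakDeriv (fullDir d) (strip d bm bp) α u

/-- The weak derivative `∂^{α'} f` in `ℝ^{N-1}`. -/
def horDeriv {d : ℕ} (α' : Fin d → ℕ) (f : Hor d → ℝ) : Hor d → ℝ :=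
  weakDeriv (horDir d) univ α' f

/-- `∫_Ω |∇^m u|^p dx` as an extended nonnegative number. -/
def energy {d : ℕ} (bm bp : ℝ) (m : ℕ) (p : ℝ) (u : Full d → ℝ) : ℝ≥0∞ :=
  ∫⁻ x in strip d bm bp,
    ENNReal.ofReal (multiNorm m (fun α => stripDeriv bm bp α u x) ^ p)

/-! The trace operator on the boundary of the strip. -/

/-- `f ∈ L^p_loc(ℝ^{N-1})`. -/
def MemLpLoc {d : ℕ} (p : ℝ) (f : Hor d → ℝ) : Prop :=
  ∀ K : Set (Hor d), IsCompact K → MemLp f (ENNReal.ofReal p) (volume.restrict K)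

/-- The pair `f = (f⁻, f⁺)` of functions in `L^p_loc(ℝ^{N-1})` is the trace on
`∂Ω = {x_N = b⁻} ∪ {x_N = b⁺}` of the function `v`: here `v` has weak first order derivatives in
`Ω`, `v` and these derivatives are locally integrable up to the boundary, and
`∫_Ω v ∂_i ψ = -∫_Ω ψ ∂_i v + ∫_{∂Ω} ψ f ν_i` for all `ψ ∈ C_c^1(ℝ^N)` and all `i`, the outer normal
being `ν = ± e_N` on `{x_N = b^±}`. -/
structure IsStripTrace {d : ℕ} (bm bp p : ℝ) (v : Full d → ℝ)
    (f : (Hor d → ℝ) × (Hor d → ℝ)) : Prop where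
  hasWeakDeriv : ∀ i : Fin (d + 1), IsWeakDeriv (fullDir d) (strip d bm bp) (Pi.single i 1) v
    (stripDeriv bm bp (Pi.single i 1) v)
  locallyIntegrable : LocallyIntegrableOn v (closure (strip d bm bp))
  locallyIntegrable_deriv : ∀ i : Fin (d + 1),
    LocallyIntegrableOn (stripDeriv bm bp (Pi.single i 1) v) (closure (strip d bm bp))
  memLpLoc_lower : MemLpLoc p f.1
  memLpLoc_upper : MemLpLoc p f.2
  integral_eq : ∀ (i : Fin (d + 1)) (ψ : Full d → ℝ), ContDiff ℝ 1 ψ → HasCompactSupport ψ →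
    ∫ x in strip d bm bp, v x * fderiv ℝ ψ x (fullDir d i) =
      -(∫ x in strip d bm bp, ψ x * stripDeriv bm bp (Pi.single i 1) v x) +
        (if i = Fin.last d then
          (∫ x' : Hor d, ψ (x', bp) * f.2 x') - ∫ x' : Hor d, ψ (x', bm) * f.1 x'
        else 0)

open scoped Classical in
/-- A representative of the trace of `v` on the two components of `∂Ω` (zero if there is none). -/
def trace {d : ℕ} (bm bp p : ℝ) (v : Full d → ℝ) : (Hor d → ℝ) × (Hor d → ℝ) :=
  if h : ∃ f, IsStripTrace bm bp p v f then h.choose else (0, 0)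

/-- `Tr(v)(·, b⁻)`. -/
def trLower {d : ℕ} (bm bp p : ℝ) (v : Full d → ℝ) : Hor d → ℝ := (trace bm bp p v).1

/-- `Tr(v)(·, b⁺)`. -/
def trUpper {d : ℕ} (bm bp p : ℝ) (v : Full d → ℝ) : Hor d → ℝ := (trace bm bp p v).2

/-- The component with index `α'` of the vector
`∑_{k=0}^{M-1} (-1)^k/k! (∇_∥^i Tr(∂_N^{k+l} u)(x', b⁺) + (-1)^{k+1} ∇_∥^i Tr(∂_N^{k+l} u)(x', b⁻))
((b⁺ - b⁻)/2)^k`. -/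
def jump {d : ℕ} (bm bp p : ℝ) (u : Full d → ℝ) (M l : ℕ) (α' : Fin d → ℕ) (x' : Hor d) : ℝ :=
  ∑ k ∈ Finset.range M, (-1 : ℝ) ^ k / (k.factorial : ℝ) *
    (horDeriv α' (trUpper bm bp p (stripDeriv bm bp (multi 0 (k + l)) u)) x' +
      (-1 : ℝ) ^ (k + 1) *
        horDeriv α' (trLower bm bp p (stripDeriv bm bp (multi 0 (k + l)) u)) x') *
    ((bp - bm) / 2) ^ k

/-- The `p`-th power of the screened seminorm `|F|_{W̃_{(a)}^{1-1/p,p}(ℝ^{N-1})}` with constant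
screening function `a` of the vector valued function `F = (F α)_{|α| = k}`; note `p + N - 2 = p + d - 1`. -/
def screenedSeminorm {d n : ℕ} (a p : ℝ) (k : ℕ) (F : (Fin n → ℕ) → Hor d → ℝ) : ℝ≥0∞ :=
  ∫⁻ x' : Hor d, ∫⁻ h' in Metric.ball (0 : Hor d) a,
    ENNReal.ofReal (multiNorm k (fun α => F α (x' + h') - F α x') ^ p / ‖h'‖ ^ (p + d - 1))

/-- The same for a scalar function. -/
def screenedSeminormScalar {d : ℕ} (a p : ℝ) (f : Hor d → ℝ) : ℝ≥0∞ :=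
  ∫⁻ x' : Hor d, ∫⁻ h' in Metric.ball (0 : Hor d) a,
    ENNReal.ofReal (|f (x' + h') - f x'| ^ p / ‖h'‖ ^ (p + d - 1))

end

end TraceStrip

/-! Write `L = bp - bm`. The hypothesis only says that derivatives of order `m` are functions, so
the lower order derivatives have to be constructed. The principle (`BoxCoords.exists_represents`) is
that a distribution `T` whose first derivatives are given by functions `g i` in `L^p_loc` is itself
such a function. Along a coordinate line a test function splits into a weighted average plus the
derivative of a compactly supported primitive. On the derivative `T` is integration against `g i`,
and by Fubini the primitive operator moves onto `g i` without leaving `L^p_loc`. Averaging in all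
directions leaves a multiple of one fixed bump, which contributes a constant. The strip is a box in
this sense, and with all functions extended by zero the argument descends from order `m` to order
`0` (`exists_isWeakDeriv`), with `L^p` control on bounded sets up to the boundary.

For a smooth step `Θ` from `b⁻` to `b⁺` the upper trace of `v` is `∫ (v Θ' + ∂_N v Θ) dt`, and the
lower trace is this minus `∫ ∂_N v dt`. After subtraction of an explicit extension of its boundary
values, a test function vanishes on both hyperplanes, and for these integration by parts has no
boundary term (`IsWeakDeriv.integral_strip_eq`, `exists_isStripTrace`). Tangential derivatives
commute with the trace because the same integrals over the strip can be integrated by parts in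
either order (`IsStripTrace.isWeakDeriv_tangential`).

Estimate (1) is Taylor's formula with both ends expanded at the midpoint. With `K_k(t) = (c - t)^k /
k!`, `c = (b⁻ + b⁺)/2`, one has `K_{k+1}' = -K_k`, so the boundary terms telescope and the
combination of traces equals `∫ K_M ∂_N^{M+1} f dt` (`jumpSum_ae_eq`). Since `|K_M| ≤ L^M`, Hölder
on fibres of length `L` gives `L^{Mp} L^{p-1}`. Euclidean norms stay inside the integral, so no
dimensional constant appears.

Estimate (2) is Gagliardo's trace theorem. Two paths start at `(x', b)` and `(x' + h, b)` and meet
at a depth comparable to `|h|`; the difference of traces is an integral of the gradient along them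
(`trace_sub_ae_eq`). Paths that move horizontally depend on the depth only, so they become measure
preserving shears. Hölder with the weight `s^{-1/(2q)}` in the depth `s`, followed by integration
over `|h| > s`, lets the powers of `s` cancel, as in the proof of Hardy's inequality
(`exists_screenedSeminormScalar_le`). The restriction `|h| < L` is what keeps the paths inside the
strip. -/

namespace TraceStrip

/-! ### Calculus of classical and weak partial derivatives -/

section WeakDerivativeCalculus

variable {V : Type*} [NormedAddCommGroup V] [NormedSpace ℝ V]

/-- The derivative of `g` in the direction `v`. -/
noncomputable def dirDeriv (v : V) (g : V → ℝ) : V → ℝ := fun x => fderiv ℝ g x v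

/-- Smooth functions with compact support in `U`. -/
structure IsTest (U : Set V) (φ : V → ℝ) : Prop where
  contDiff : ContDiff ℝ ∞ φ
  hasCompactSupport : HasCompactSupport φ
  tsupport_subset : tsupport φ ⊆ U

theorem contDiff_dirDeriv {g : V → ℝ} (hg : ContDiff ℝ ∞ g) (v : V) :
    ContDiff ℝ ∞ (dirDeriv v g) :=
  (hg.fderiv_right (m := ∞) (by simp)).clm_apply contDiff_const

theorem support_dirDeriv_subset (g : V → ℝ) (v : V) :
    Function.support (dirDeriv v g) ⊆ tsupport g := by
  intro x hx
  apply support_fderiv_subset ℝ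
  intro h
  apply hx
  simp [dirDeriv, h]

theorem tsupport_dirDeriv_subset (g : V → ℝ) (v : V) : tsupport (dirDeriv v g) ⊆ tsupport g :=
  closure_minimal (support_dirDeriv_subset g v) isClosed_closure

theorem IsTest.dirDeriv {U : Set V} {φ : V → ℝ} (h : IsTest U φ) (v : V) :
    IsTest U (dirDeriv v φ) :=
  ⟨contDiff_dirDeriv h.contDiff v,
    h.hasCompactSupport.of_isClosed_subset isClosed_closure (tsupport_dirDeriv_subset φ v),
    (tsupport_dirDeriv_subset φ v).trans h.tsupport_subset⟩

theorem dirDeriv_comm {g : V → ℝ} (hg : ContDiff ℝ ∞ g) (v w : V) :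
    dirDeriv v (dirDeriv w g) = dirDeriv w (dirDeriv v g) := by
  have hd : Differentiable ℝ (fderiv ℝ g) :=
    (hg.fderiv_right (m := ∞) (by simp)).differentiable (by simp)
  have key : ∀ (a b : V) (x : V), dirDeriv a (dirDeriv b g) x = fderiv ℝ (fderiv ℝ g) x a b := by
    intro a b x
    have := (hd x).hasFDerivAt.clm_apply (hasFDerivAt_const b x)
    unfold dirDeriv
    rw [this.fderiv]
    simp
  funext x
  rw [key, key]
  exact (hg.contDiffAt.isSymmSndFDerivAt
    (by simpa using (WithTop.coe_le_coe.2 (le_top : (2 : ℕ∞) ≤ ⊤)))) v w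

theorem partialDeriv_succ {n : ℕ} (e : Fin (n + 1) → V) (α : Fin (n + 1) → ℕ) (φ : V → ℝ) :
    partialDeriv e α φ =
      (dirDeriv (e 0))^[α 0] (partialDeriv (fun i => e i.succ) (fun i => α i.succ) φ) := by
  simp only [partialDeriv, List.ofFn_succ, List.foldr_cons]
  rfl

theorem partialDeriv_nil (e : Fin 0 → V) (α : Fin 0 → ℕ) (φ : V → ℝ) :
    partialDeriv e α φ = φ := by
  simp [partialDeriv]

theorem contDiff_iterate_dirDeriv {g : V → ℝ} (hg : ContDiff ℝ ∞ g) (v : V) (k : ℕ) :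
    ContDiff ℝ ∞ ((dirDeriv v)^[k] g) := by
  induction k generalizing g with
  | zero => exact hg
  | succ k ih => exact ih (contDiff_dirDeriv hg v)

theorem contDiff_partialDeriv {n : ℕ} (e : Fin n → V) (α : Fin n → ℕ) {φ : V → ℝ}
    (hφ : ContDiff ℝ ∞ φ) : ContDiff ℝ ∞ (partialDeriv e α φ) := by
  induction n with
  | zero => rwa [partialDeriv_nil]
  | succ n ih =>
    rw [partialDeriv_succ]
    exact contDiff_iterate_dirDeriv (ih _ _) _ _

theorem IsTest.partialDeriv {n : ℕ} (e : Fin n → V) (α : Fin n → ℕ) {U : Set V} {φ : V → ℝ}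
    (hφ : IsTest U φ) : IsTest U (partialDeriv e α φ) := by
  induction n with
  | zero => rwa [partialDeriv_nil]
  | succ n ih =>
    rw [partialDeriv_succ]
    have := ih (fun i => e i.succ) (fun i => α i.succ)
    generalize TraceStrip.partialDeriv (fun i => e i.succ) (fun i => α i.succ) φ = g at this
    generalize α 0 = k
    induction k generalizing g with
    | zero => exact this
    | succ k ih' => exact ih' _ (this.dirDeriv _)

theorem dirDeriv_iterate_comm {g : V → ℝ} (hg : ContDiff ℝ ∞ g) (v w : V) (k : ℕ) :
    (dirDeriv v)^[k] (dirDeriv w g) = dirDeriv w ((dirDeriv v)^[k] g) := by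
  induction k generalizing g with
  | zero => rfl
  | succ k ih =>
    rw [Function.iterate_succ_apply, Function.iterate_succ_apply, dirDeriv_comm hg,
      ih (contDiff_dirDeriv hg v)]

theorem partialDeriv_dirDeriv {n : ℕ} (e : Fin n → V) (α : Fin n → ℕ) {φ : V → ℝ}
    (hφ : ContDiff ℝ ∞ φ) (v : V) :
    partialDeriv e α (dirDeriv v φ) = dirDeriv v (partialDeriv e α φ) := by
  induction n with
  | zero => simp [partialDeriv_nil]
  | succ n ih =>
    rw [partialDeriv_succ, partialDeriv_succ, ih,
      dirDeriv_iterate_comm (contDiff_partialDeriv _ _ hφ)]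

/-- The additional derivative appears in the middle of the ordered composition; commutation brings
it to the outside. -/
theorem partialDeriv_add_single {n : ℕ} (e : Fin n → V) (α : Fin n → ℕ) (i : Fin n) {φ : V → ℝ}
    (hφ : ContDiff ℝ ∞ φ) :
    partialDeriv e (α + Pi.single i 1) φ = dirDeriv (e i) (partialDeriv e α φ) := by
  induction n with
  | zero => exact i.elim0
  | succ n ih =>
    rw [partialDeriv_succ, partialDeriv_succ]
    refine Fin.cases ?_ (fun j => ?_) i
    · have h1 : (fun k : Fin n => (α + Pi.single (0 : Fin (n + 1)) 1 : Fin (n + 1) → ℕ) k.succ) =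
          fun k => α k.succ := by
        funext k; simp [Fin.succ_ne_zero]
      rw [h1]
      simp only [Pi.add_apply, Pi.single_eq_same]
      rw [Function.iterate_succ_apply']
    · have h1 : (fun k : Fin n => (α + Pi.single j.succ 1 : Fin (n + 1) → ℕ) k.succ) =
          (fun k => α k.succ) + Pi.single j 1 := by
        funext k; simp [Pi.single_apply, Fin.succ_inj]
      rw [h1, ih]
      have h2 : (α + Pi.single j.succ 1 : Fin (n + 1) → ℕ) 0 = α 0 := by
        simp [(Fin.succ_ne_zero j).symm]
      rw [h2, dirDeriv_iterate_comm (contDiff_partialDeriv _ _ hφ)]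

theorem partialDeriv_zero {n : ℕ} (e : Fin n → V) (φ : V → ℝ) :
    partialDeriv e 0 φ = φ := by
  induction n with
  | zero => exact partialDeriv_nil _ _ _
  | succ n ih => rw [partialDeriv_succ]; exact ih _

theorem partialDeriv_single {n : ℕ} (e : Fin n → V) (i : Fin n) {φ : V → ℝ}
    (hφ : ContDiff ℝ ∞ φ) : partialDeriv e (Pi.single i 1) φ = dirDeriv (e i) φ := by
  have := partialDeriv_add_single e 0 i hφ
  rwa [zero_add, partialDeriv_zero] at this

theorem sum_add_single {n : ℕ} (α : Fin n → ℕ) (i : Fin n) :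
    ∑ j, (α + Pi.single i 1 : Fin n → ℕ) j = ∑ j, α j + 1 := by
  simp [Finset.sum_add_distrib]

theorem exists_eq_add_single {n k : ℕ} {α : Fin n → ℕ} (h : ∑ i, α i = k + 1) :
    ∃ (β : Fin n → ℕ) (i : Fin n), α = β + Pi.single i 1 ∧ ∑ i, β i = k := by
  obtain ⟨i, -, hi⟩ : ∃ i ∈ Finset.univ, α i ≠ 0 := by
    by_contra! hc
    rw [Finset.sum_eq_zero hc] at h
    omega
  have hβ : α = (α - Pi.single i 1) + Pi.single i 1 := by
    funext j
    by_cases hj : j = i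
    · subst hj; simp; omega
    · simp [hj]
  refine ⟨α - Pi.single i 1, i, hβ, ?_⟩
  rw [hβ, sum_add_single] at h
  omega

variable [MeasureSpace V] {n : ℕ} {e : Fin n → V} {U : Set V} {α : Fin n → ℕ} {u g h : V → ℝ}

theorem IsWeakDeriv.weakDeriv (hg : IsWeakDeriv e U α u g) :
    IsWeakDeriv e U α u (weakDeriv e U α u) := by
  have hex : ∃ g, IsWeakDeriv e U α u g := ⟨g, hg⟩
  rw [TraceStrip.weakDeriv, dif_pos hex]
  exact hex.choose_spec

theorem IsWeakDeriv.integral_eq_of_isTest (hg : IsWeakDeriv e U α u g) {φ : V → ℝ}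
    (hφ : IsTest U φ) : ∫ x in U, u x * partialDeriv e α φ x =
      (-1) ^ (∑ i, α i) * ∫ x in U, g x * φ x :=
  hg.integral_eq φ hφ.contDiff hφ.hasCompactSupport hφ.tsupport_subset

theorem IsWeakDeriv.integral_single_eq {i : Fin n} (hg : IsWeakDeriv e U (Pi.single i 1) u g)
    {φ : V → ℝ} (hφ : IsTest U φ) :
    ∫ x in U, u x * dirDeriv (e i) φ x = - ∫ x in U, g x * φ x := by
  have := hg.integral_eq_of_isTest hφ
  rw [partialDeriv_single _ _ hφ.contDiff] at this
  rw [this]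
  simp

theorem isWeakDeriv_zero (hu : LocallyIntegrableOn u U) : IsWeakDeriv e U 0 u u :=
  ⟨hu, hu, fun φ _ _ _ => by simp [partialDeriv_zero]⟩

theorem IsWeakDeriv.add_single {i : Fin n} (hg : IsWeakDeriv e U α u g)
    (hh : IsWeakDeriv e U (Pi.single i 1) g h) :
    IsWeakDeriv e U (α + Pi.single i 1) u h := by
  refine ⟨hg.1, hh.2, fun φ h1 h2 h3 => ?_⟩
  have hφ : IsTest U φ := ⟨h1, h2, h3⟩
  rw [partialDeriv_add_single e α i h1, ← partialDeriv_dirDeriv e α h1,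
    hg.integral_eq_of_isTest (hφ.dirDeriv (e i)), hh.integral_single_eq hφ, sum_add_single]
  ring

/-- Testing the identity for `g` with `∂_i φ` and cancelling the common sign. This turns derivatives
of `u` of consecutive orders into first order derivatives of each other, the form in which traces
and integration by parts use them. -/
theorem IsWeakDeriv.of_add_single {i : Fin n} (hg : IsWeakDeriv e U α u g)
    (hh : IsWeakDeriv e U (α + Pi.single i 1) u h) :
    IsWeakDeriv e U (Pi.single i 1) g h := by
  refine ⟨hg.2, hh.2, fun φ h1 h2 h3 => ?_⟩
  have hφ : IsTest U φ := ⟨h1, h2, h3⟩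
  have e1 := hg.integral_eq_of_isTest (hφ.dirDeriv (e i))
  have e2 := hh.integral_eq_of_isTest hφ
  rw [partialDeriv_add_single e α i h1, ← partialDeriv_dirDeriv e α h1, e1, sum_add_single,
    pow_succ] at e2
  have hne : ((-1 : ℝ) ^ (∑ i, α i)) ≠ 0 := pow_ne_zero _ (by norm_num)
  rw [partialDeriv_single _ _ h1]
  have : ∫ x in U, g x * TraceStrip.dirDeriv (e i) φ x = - ∫ x in U, h x * φ x := by
    apply mul_left_cancel₀ hne
    rw [e2]; ring
  rw [this]
  simp

theorem IsWeakDeriv.congr {u' g' : V → ℝ} (hg : IsWeakDeriv e U α u g)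
    (hu' : u =ᵐ[volume.restrict U] u') (hg' : g =ᵐ[volume.restrict U] g') :
    IsWeakDeriv e U α u' g' := by
  refine ⟨?_, ?_, fun φ h1 h2 h3 => ?_⟩
  · exact hg.1.congr hu'
  · exact hg.2.congr hg'
  · have e1 : ∫ x in U, u' x * TraceStrip.partialDeriv e α φ x =
        ∫ x in U, u x * TraceStrip.partialDeriv e α φ x := by
      apply integral_congr_ae
      filter_upwards [hu'] with x hx
      rw [hx]
    have e2 : ∫ x in U, g' x * φ x = ∫ x in U, g x * φ x := by
      apply integral_congr_ae
      filter_upwards [hg'] with x hx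
      rw [hx]
    rw [e1, e2, hg.integral_eq φ h1 h2 h3]

variable [BorelSpace V]

theorem integrable_mul_of_tsupport_subset (hu : LocallyIntegrableOn u U) {φ : V → ℝ}
    (hc : Continuous φ) (hs : HasCompactSupport φ) (ht : tsupport φ ⊆ U) :
    Integrable (fun x => u x * φ x) := by
  have : IntegrableOn u (tsupport φ) := hu.integrableOn_compact_subset ht hs
  rw [← integrableOn_iff_integrable_of_support_subset (s := tsupport φ)]
  · exact this.mul_continuousOn hc.continuousOn hs
  · intro x hx
    apply subset_tsupport
    intro h
    apply hx
    simp [h]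

variable [FiniteDimensional ℝ V]

theorem ae_eq_of_integral_isTest_eq (hU : IsOpen U) (hg : LocallyIntegrableOn g U)
    (hh : LocallyIntegrableOn h U)
    (H : ∀ φ, IsTest U φ → ∫ x in U, g x * φ x = ∫ x in U, h x * φ x) :
    g =ᵐ[volume.restrict U] h := by
  have key : ∀ᵐ x ∂(volume : Measure V), x ∈ U → (g - h) x = 0 := by
    apply hU.ae_eq_zero_of_integral_contDiff_smul_eq_zero (hg.sub hh)
    intro φ h1 h2 h3
    have i1 := integrable_mul_of_tsupport_subset hg h1.continuous h2 h3
    have i2 := integrable_mul_of_tsupport_subset hh h1.continuous h2 h3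
    have hz : ∀ f : V → ℝ, ∫ x in U, f x * φ x = ∫ x, f x * φ x := by
      intro f
      apply setIntegral_eq_integral_of_forall_compl_eq_zero
      intro x hx
      rw [image_eq_zero_of_notMem_tsupport (fun hh => hx (h3 hh)), mul_zero]
    have := H φ ⟨h1, h2, h3⟩
    rw [hz, hz] at this
    calc ∫ x, φ x • (g - h) x = ∫ x, (g x * φ x - h x * φ x) := by
          congr 1; funext x; simp; ring
      _ = 0 := by rw [integral_sub i1 i2, this, sub_self]
  rw [Filter.EventuallyEq, ae_restrict_iff' hU.measurableSet]
  filter_upwards [key] with x hx hxU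
  have := hx hxU
  simpa [sub_eq_zero] using this

theorem IsWeakDeriv.ae_eq (hU : IsOpen U) (hg : IsWeakDeriv e U α u g)
    (hh : IsWeakDeriv e U α u h) : g =ᵐ[volume.restrict U] h := by
  apply ae_eq_of_integral_isTest_eq hU hg.2 hh.2
  intro φ hφ
  have := (hg.integral_eq_of_isTest hφ).symm.trans (hh.integral_eq_of_isTest hφ)
  exact mul_left_cancel₀ (pow_ne_zero _ (by norm_num)) this

theorem IsWeakDeriv.weakDeriv_ae_eq (hU : IsOpen U) (hg : IsWeakDeriv e U α u g) :
    TraceStrip.weakDeriv e U α u =ᵐ[volume.restrict U] g :=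
  hg.weakDeriv.ae_eq hU hg

end WeakDerivativeCalculus

/-! ### Hölder's inequality with the exponent cleared -/

section Hoelder

variable {X Y : Type*} [MeasurableSpace X] [MeasurableSpace Y]

theorem lintegral_mul_rpow_le {ν : Measure Y} {p q : ℝ} (hpq : p.HolderConjugate q)
    {w f : Y → ℝ≥0∞} (hw : AEMeasurable w ν) (hf : AEMeasurable f ν) :
    (∫⁻ y, w y * f y ∂ν) ^ p ≤ (∫⁻ y, w y ^ q ∂ν) ^ (p / q) * ∫⁻ y, f y ^ p ∂ν := by
  have h := ENNReal.lintegral_mul_le_Lp_mul_Lq ν hpq.symm hw hf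
  calc (∫⁻ y, w y * f y ∂ν) ^ p
      ≤ ((∫⁻ y, w y ^ q ∂ν) ^ (1 / q) * (∫⁻ y, f y ^ p ∂ν) ^ (1 / p)) ^ p :=
        ENNReal.rpow_le_rpow h hpq.nonneg
    _ = _ := by
        rw [ENNReal.mul_rpow_of_nonneg _ _ hpq.nonneg, ← ENNReal.rpow_mul, ← ENNReal.rpow_mul]
        congr 2
        · field_simp
        · rw [one_div_mul_cancel hpq.ne_zero, ENNReal.rpow_one]

/-- Hölder against the constant `1` on each fibre; the factor `ν univ ^ (p / q)` is finite. -/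
theorem memLp_integral_right {μ : Measure X} {ν : Measure Y} [SFinite μ] [IsFiniteMeasure ν]
    {p q : ℝ} (hpq : p.HolderConjugate q) {F : X × Y → ℝ}
    (hF : MemLp F (ENNReal.ofReal p) (μ.prod ν)) :
    MemLp (fun x => ∫ y, F (x, y) ∂ν) (ENNReal.ofReal p) μ := by
  have hp0 : ENNReal.ofReal p ≠ 0 := by simpa using hpq.pos
  have hpt : ENNReal.ofReal p ≠ ⊤ := ENNReal.ofReal_ne_top
  refine ⟨hF.1.integral_prod_right', ?_⟩
  have h2 := hF.2
  rw [eLpNorm_lt_top_iff_lintegral_rpow_enorm_lt_top hp0 hpt,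
    ENNReal.toReal_ofReal hpq.nonneg] at h2 ⊢
  rw [lintegral_prod _ (hF.1.enorm.pow_const p)] at h2
  have hb : ∀ᵐ x ∂μ, ‖∫ y, F (x, y) ∂ν‖ₑ ^ p ≤ (ν univ) ^ (p / q) * ∫⁻ y, ‖F (x, y)‖ₑ ^ p ∂ν := by
    filter_upwards [hF.1.prodMk_left] with x hx
    calc ‖∫ y, F (x, y) ∂ν‖ₑ ^ p ≤ (∫⁻ y, 1 * ‖F (x, y)‖ₑ ∂ν) ^ p := by
          apply ENNReal.rpow_le_rpow _ hpq.nonneg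
          simpa using enorm_integral_le_lintegral_enorm _
      _ ≤ _ := by
          have := lintegral_mul_rpow_le hpq (ν := ν) (w := fun _ => 1) aemeasurable_const hx.enorm
          simpa using this
  refine (lintegral_mono_ae hb).trans_lt ?_
  have hc : (ν univ) ^ (p / q) ≠ ⊤ :=
    ENNReal.rpow_ne_top_of_nonneg (div_nonneg hpq.nonneg hpq.symm.nonneg) (measure_ne_top _ _)
  rw [lintegral_const_mul' _ _ hc]
  exact ENNReal.mul_lt_top hc.lt_top h2

end Hoelder

/-! ### Functions locally in `L^p` -/

section LpLoc

/-- Local membership in `L^p`. -/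
def LpLoc {X : Type*} [TopologicalSpace X] [MeasureSpace X] (p : ℝ≥0∞) (h : X → ℝ) : Prop :=
  ∀ K : Set X, IsCompact K → MemLp h p (volume.restrict K)

theorem LpLoc.add {X : Type*} [TopologicalSpace X] [MeasureSpace X] {p : ℝ≥0∞} {f g : X → ℝ}
    (hf : LpLoc p f) (hg : LpLoc p g) : LpLoc p (fun x => f x + g x) :=
  fun K hK => (hf K hK).add (hg K hK)

theorem LpLoc.sub {X : Type*} [TopologicalSpace X] [MeasureSpace X] {p : ℝ≥0∞} {f g : X → ℝ}
    (hf : LpLoc p f) (hg : LpLoc p g) : LpLoc p (fun x => f x - g x) :=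
  fun K hK => (hf K hK).sub (hg K hK)

variable {V : Type*} [NormedAddCommGroup V] [MeasureSpace V] [BorelSpace V]
  [ProperSpace V] [IsFiniteMeasureOnCompacts (volume : Measure V)]

theorem LpLoc.const {p : ℝ≥0∞} (c : ℝ) : LpLoc p (fun _ : V => c) := by
  intro K hK
  have : IsFiniteMeasure ((volume : Measure V).restrict K) :=
    ⟨by rw [Measure.restrict_apply_univ]; exact hK.measure_lt_top⟩
  exact memLp_const c

theorem LpLoc.locallyIntegrable {p : ℝ≥0∞} (hp : 1 ≤ p) {h : V → ℝ} (hh : LpLoc p h) :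
    LocallyIntegrable h := by
  rw [locallyIntegrable_iff]
  intro K hK
  have : IsFiniteMeasure ((volume : Measure V).restrict K) :=
    ⟨by rw [Measure.restrict_apply_univ]; exact hK.measure_lt_top⟩
  exact (hh K hK).integrable hp

end LpLoc

/-! ### Integral operators along lines and their adjoints -/

section Kernels

variable {V : Type*} [NormedAddCommGroup V] [NormedSpace ℝ V] [MeasureSpace V] [BorelSpace V]
  [ProperSpace V] [(volume : Measure V).IsAddHaarMeasure]

/-- Averages along the direction `e` with kernel `κ`. -/
noncomputable def lineOp (e : V) (l : V →L[ℝ] ℝ) (κ : ℝ → ℝ → ℝ) (φ : V → ℝ) (x : V) : ℝ :=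
  ∫ s, κ s (l x) * φ (x + s • e)

/-- The formal adjoint of `lineOp`. -/
noncomputable def lineDual (e : V) (l : V →L[ℝ] ℝ) (κ : ℝ → ℝ → ℝ) (h : V → ℝ) (y : V) : ℝ :=
  ∫ s, κ s (l y - s) * h (y - s • e)

/-- A bounded kernel `κ (s, t)` which, for bounded `s + t`, vanishes outside of a bounded set. -/
structure IsLineKernel (κ : ℝ → ℝ → ℝ) (C R : ℝ) : Prop where
  measurable : Measurable (fun z : ℝ × ℝ => κ z.1 z.2)
  bound : ∀ s t, |κ s t| ≤ C
  range : ∀ s t, κ s t ≠ 0 → |s| ≤ |s + t| + R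

theorem measurePreserving_shear (e : V) :
    MeasurePreserving (fun z : ℝ × V => (z.1, z.2 - z.1 • e))
      ((volume : Measure ℝ).prod (volume : Measure V)) (volume.prod volume) := by
  have : SecondCountableTopology V := inferInstance
  refine (MeasurePreserving.id volume).skew_product (g := fun s y => y - s • e) ?_ ?_
  · exact (measurable_snd.sub (measurable_fst.smul_const e))
  · exact ae_of_all _ fun s => (measurePreserving_sub_right volume (s • e)).map_eq

variable {e : V} {l : V →L[ℝ] ℝ} {κ : ℝ → ℝ → ℝ} {C R : ℝ}

theorem LpLoc.shear {p : ℝ≥0∞} {h : V → ℝ} (hh : LpLoc p h) (e : V) {K : Set V} (hK : IsCompact K)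
    (r : ℝ) : MemLp (fun z : ℝ × V => h (z.2 - z.1 • e)) p
      ((volume.restrict (Icc (-r) r)).prod (volume.restrict K)) := by
  set I : Set ℝ := Icc (-r) r
  set K' : Set V := (fun z : ℝ × V => z.2 - z.1 • e) '' (I ×ˢ K)
  have hK' : IsCompact K' :=
    ((isCompact_Icc).prod hK).image (by fun_prop)
  have h1 : MemLp (fun z : ℝ × V => h z.2) p ((volume.restrict I).prod (volume.restrict K')) := by
    have : IsFiniteMeasure ((volume : Measure ℝ).restrict I) :=
      ⟨by rw [Measure.restrict_apply_univ]; exact isCompact_Icc.measure_lt_top⟩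
    exact (hh K' hK').comp_snd _
  rw [Measure.prod_restrict] at h1 ⊢
  have hm' : MeasurableSet (I ×ˢ K') := measurableSet_Icc.prod hK'.measurableSet
  have hm : MeasurableSet (I ×ˢ K) := measurableSet_Icc.prod hK.measurableSet
  rw [← memLp_indicator_iff_restrict hm'] at h1
  have h2 := (h1.comp_measurePreserving (measurePreserving_shear e)).restrict (I ×ˢ K)
  refine h2.ae_eq ?_
  filter_upwards [ae_restrict_mem hm] with z hz
  simp only [Function.comp]
  rw [indicator_of_mem]
  exact ⟨hz.1, ⟨z, hz, rfl⟩⟩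

theorem exists_forall_abs_le (l : V →L[ℝ] ℝ) {K : Set V} (hK : IsCompact K) :
    ∃ r, ∀ y ∈ K, |l y| ≤ r := by
  obtain ⟨r, hr⟩ := (hK.image l.continuous).isBounded.exists_norm_le
  exact ⟨r, fun y hy => hr _ ⟨y, hy, rfl⟩⟩

theorem IsLineKernel.memLp_shear (hκ : IsLineKernel κ C R) {p : ℝ≥0∞} {h : V → ℝ}
    (hh : LpLoc p h) (e : V) (l : V →L[ℝ] ℝ) {K : Set V} (hK : IsCompact K) (r : ℝ) :
    MemLp (fun z : ℝ × V => κ z.1 (l z.2 - z.1) * h (z.2 - z.1 • e)) p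
      ((volume.restrict (Icc (-r) r)).prod (volume.restrict K)) := by
  have h0 := hh.shear e hK r
  have hm : Measurable fun z : ℝ × V => κ z.1 (l z.2 - z.1) :=
    hκ.measurable.comp (measurable_fst.prodMk ((l.measurable.comp measurable_snd).sub measurable_fst))
  refine MemLp.of_le_mul (c := C) h0 (hm.aestronglyMeasurable.mul h0.1) (ae_of_all _ fun z => ?_)
  rw [norm_mul]
  exact mul_le_mul_of_nonneg_right (hκ.bound _ _) (norm_nonneg _)

theorem IsLineKernel.range_shear (hκ : IsLineKernel κ C R) {K : Set V} {r : ℝ}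
    (hr : ∀ y ∈ K, |l y| ≤ r) {y : V} (hy : y ∈ K) {s : ℝ} (hs : s ∉ Icc (-(r + R)) (r + R)) :
    κ s (l y - s) = 0 := by
  by_contra hne
  apply hs
  rw [mem_Icc, ← abs_le]
  have := hκ.range _ _ hne
  have h2 := hr y hy
  rw [show s + (l y - s) = l y by ring] at this
  linarith

/-- On a compact set `l` is bounded, so the condition `range` confines `s` to one compact interval.
What remains is a bounded multiple of a shear of `h`, integrated over a finite measure. -/
theorem IsLineKernel.lpLoc_lineDual (hκ : IsLineKernel κ C R) {p q : ℝ} (hpq : p.HolderConjugate q)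
    {h : V → ℝ} (hh : LpLoc (ENNReal.ofReal p) h) (e : V) (l : V →L[ℝ] ℝ) :
    LpLoc (ENNReal.ofReal p) (lineDual e l κ h) := by
  intro K hK
  obtain ⟨r, hr⟩ := exists_forall_abs_le l hK
  have h1 := (hκ.memLp_shear hh e l hK (r + R)).comp_measurePreserving
    (Measure.measurePreserving_swap (μ := volume.restrict K)
      (ν := volume.restrict (Icc (-(r + R)) (r + R))))
  have : IsFiniteMeasure ((volume : Measure ℝ).restrict (Icc (-(r + R)) (r + R))) :=
      ⟨by rw [Measure.restrict_apply_univ]; exact isCompact_Icc.measure_lt_top⟩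
  refine (memLp_integral_right hpq h1).ae_eq ?_
  filter_upwards [ae_restrict_mem hK.measurableSet] with y hy
  simp only [Function.comp, Prod.swap]
  apply setIntegral_eq_integral_of_forall_compl_eq_zero
  intro s hs
  rw [hκ.range_shear hr hy hs, zero_mul]

/-- Fubini together with the shear `y = x + s e`. Because `l e = 1`, the argument `l x` of the
kernel becomes `l y - s`, whence the form of `lineDual`. -/
theorem IsLineKernel.integral_mul_lineOp (hκ : IsLineKernel κ C R) (hle : l e = 1) {p : ℝ≥0∞}
    (hp : 1 ≤ p) {h : V → ℝ} (hh : LpLoc p h) {φ : V → ℝ} (hφ : Continuous φ)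
    (hφc : HasCompactSupport φ) :
    ∫ x, h x * lineOp e l κ φ x = ∫ y, lineDual e l κ h y * φ y := by
  have hK : IsCompact (tsupport φ) := hφc
  obtain ⟨r, hr⟩ := exists_forall_abs_le l hK
  set I : Set ℝ := Icc (-(r + R)) (r + R)
  have h1 := hκ.memLp_shear hh e l hK (r + R)
  have hfin : IsFiniteMeasure ((volume.restrict I).prod ((volume : Measure V).restrict (tsupport φ))) := by
    rw [Measure.prod_restrict]
    refine ⟨?_⟩
    rw [Measure.restrict_apply_univ, Measure.prod_prod]
    exact ENNReal.mul_lt_top isCompact_Icc.measure_lt_top hK.measure_lt_top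
  obtain ⟨B, hB⟩ := hφc.exists_bound_of_continuous hφ
  have h2 : Integrable (fun z : ℝ × V => (κ z.1 (l z.2 - z.1) * h (z.2 - z.1 • e)) * φ z.2)
      ((volume.restrict I).prod (volume.restrict (tsupport φ))) :=
    (h1.integrable hp).mul_bdd (c := B) (hφ.comp continuous_snd).aestronglyMeasurable
      (ae_of_all _ fun z => hB z.2)
  set G : ℝ × V → ℝ := fun z => (κ z.1 (l z.2 - z.1) * h (z.2 - z.1 • e)) * φ z.2
  have h3 : Integrable G (volume.prod volume) := by
    rw [Measure.prod_restrict] at h2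
    rw [← integrableOn_iff_integrable_of_support_subset (s := I ×ˢ tsupport φ)]
    · exact h2
    · intro z hz
      have hz2 : z.2 ∈ tsupport φ := by
        by_contra hc
        apply hz
        simp [G, image_eq_zero_of_notMem_tsupport hc]
      refine ⟨?_, hz2⟩
      by_contra hc
      apply hz
      simp [G, hκ.range_shear hr hz2 hc]
  set F : ℝ × V → ℝ := fun z => κ z.1 (l z.2) * h z.2 * φ (z.2 + z.1 • e)
  have hinv : MeasurePreserving (fun z : ℝ × V => (z.1, z.2 + z.1 • e))
      ((volume : Measure ℝ).prod (volume : Measure V)) (volume.prod volume) := by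
    have := measurePreserving_shear (-e)
    simpa using this
  have hFG : F = G ∘ fun z : ℝ × V => (z.1, z.2 + z.1 • e) := by
    funext z
    simp [F, G, hle]
  have h4 : Integrable F (volume.prod volume) := by
    rw [hFG]
    exact (hinv.integrable_comp h3.1).2 h3
  have h5 : ∫ z, F z ∂(volume.prod volume) = ∫ z, G z ∂(volume.prod volume) := by
    rw [hFG]
    have hme : MeasurableEmbedding (fun z : ℝ × V => (z.1, z.2 + z.1 • e)) := by
      let E : ℝ × V ≃ₜ ℝ × V :=
        { toFun := fun z => (z.1, z.2 + z.1 • e)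
          invFun := fun z => (z.1, z.2 - z.1 • e)
          left_inv := fun z => by simp
          right_inv := fun z => by simp
          continuous_toFun := by fun_prop
          continuous_invFun := by fun_prop }
      exact E.measurableEmbedding
    exact hinv.integral_comp hme G
  calc ∫ x, h x * lineOp e l κ φ x = ∫ x, ∫ s, F (s, x) := by
        congr 1; funext x
        rw [lineOp, ← integral_const_mul]
        congr 1; funext s
        simp only [F]; ring
    _ = ∫ z, F z ∂(volume.prod volume) := (integral_prod_symm F h4).symm
    _ = ∫ z, G z ∂(volume.prod volume) := h5
    _ = ∫ y, ∫ s, G (s, y) := integral_prod_symm G h3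
    _ = ∫ y, lineDual e l κ h y * φ y := by
        congr 1; funext y
        rw [lineDual, ← integral_mul_const]

end Kernels

/-! ### Smoothness of line integrals -/

section Smoothness

variable {V : Type*} [NormedAddCommGroup V] [NormedSpace ℝ V]

theorem contDiff_integral_mul_line {f : ℝ → ℝ} (hf : LocallyIntegrable f) {φ : V → ℝ}
    (hφ : ContDiff ℝ ∞ φ) (hφc : HasCompactSupport φ) {e : V} {l : V →L[ℝ] ℝ} (hle : l e = 1) :
    ContDiff ℝ ∞ (fun x => ∫ s, f s * φ (x + s • e)) := by
  have hcs : IsCompact (l '' tsupport φ) := IsCompact.image hφc l.continuous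
  obtain ⟨r, hr⟩ := hcs.isBounded.exists_norm_le
  rw [contDiff_iff_contDiffAt]
  intro x₀
  let s : Set V := {x | |l x| < |l x₀| + 1}
  have hs : IsOpen s := isOpen_lt (by fun_prop) continuous_const
  have hx₀ : x₀ ∈ s := by simp [s]
  let k : Set ℝ := Icc (-(r + |l x₀| + 1)) (r + |l x₀| + 1)
  -- The line integral is a convolution in `t` evaluated at `0`, with `x` as a parameter. Near `x₀`
  -- the interval `k` contains all `t` at which the integrand can be nonzero.
  have key : ContDiffOn ℝ ∞
      (fun x => (MeasureTheory.convolution f (fun t => φ (x + (-t) • e))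
        (ContinuousLinearMap.mul ℝ ℝ) volume) ((fun _ => (0 : ℝ)) x)) s := by
    refine contDiffOn_convolution_right_with_param_comp (n := ⊤) (ContinuousLinearMap.mul ℝ ℝ)
      (g := fun x t => φ (x + (-t) • e)) (k := k) contDiffOn_const hs isCompact_Icc ?_ hf ?_
    · intro x t hx ht
      by_contra hne
      apply ht
      have h1 : x + (-t) • e ∈ tsupport φ := by
        by_contra hc
        exact hne (image_eq_zero_of_notMem_tsupport hc)
      have h2 := hr _ ⟨_, h1, rfl⟩
      simp only [map_add, map_smul, hle, smul_eq_mul, mul_one, Real.norm_eq_abs] at h2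
      have h3 : |l x| < |l x₀| + 1 := hx
      rw [mem_Icc, ← abs_le]
      have h4 : |t| ≤ |l x| + |l x + -t| := by
        calc |t| = |l x - (l x + -t)| := by congr 1; ring
          _ ≤ _ := abs_sub _ _
      linarith
    · apply ContDiff.contDiffOn
      have : ContDiff ℝ ∞ fun z : V × ℝ => φ (z.1 + (-z.2) • e) := hφ.comp (by fun_prop)
      exact this
  refine (key.contDiffAt (hs.mem_nhds hx₀)).congr_of_eventuallyEq ?_
  refine Filter.Eventually.of_forall fun x => ?_
  simp [MeasureTheory.convolution]

end Smoothness

/-! ### Smooth steps and the kernels built from them -/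

section Steps

/-- A smooth step from `0` on `(-∞, a]` to `1` on `[c, ∞)`. -/
structure IsStep (Θ : ℝ → ℝ) (a c : ℝ) : Prop where
  contDiff : ContDiff ℝ ∞ Θ
  eq_zero : ∀ t ≤ a, Θ t = 0
  eq_one : ∀ t, c ≤ t → Θ t = 1
  nonneg : ∀ t, 0 ≤ Θ t
  le_one : ∀ t, Θ t ≤ 1

theorem exists_isStep {a c : ℝ} (hac : a < c) : ∃ Θ, IsStep Θ a c := by
  refine ⟨fun t => Real.smoothTransition ((t - a) / (c - a)), ?_, ?_, ?_, ?_, ?_⟩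
  · exact Real.smoothTransition.contDiff.comp (by fun_prop)
  · intro t ht
    exact Real.smoothTransition.zero_of_nonpos
      (div_nonpos_of_nonpos_of_nonneg (by linarith) (by linarith))
  · intro t ht
    refine Real.smoothTransition.one_of_one_le ?_
    rw [le_div_iff₀ (by linarith)]
    linarith
  · intro t; exact Real.smoothTransition.nonneg _
  · intro t; exact Real.smoothTransition.le_one _

variable {Θ : ℝ → ℝ} {a c : ℝ}

theorem IsStep.contDiff_deriv (h : IsStep Θ a c) : ContDiff ℝ ∞ (deriv Θ) :=
  (contDiff_infty_iff_deriv.1 h.contDiff).2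

theorem IsStep.deriv_eq_zero_of_lt (h : IsStep Θ a c) {t : ℝ} (ht : t < a) : deriv Θ t = 0 := by
  have : Θ =ᶠ[nhds t] fun _ => 0 := by
    filter_upwards [Iio_mem_nhds ht] with s hs using h.eq_zero s (le_of_lt hs)
  rw [this.deriv_eq]; simp

theorem IsStep.deriv_eq_zero_of_gt (h : IsStep Θ a c) {t : ℝ} (ht : c < t) : deriv Θ t = 0 := by
  have : Θ =ᶠ[nhds t] fun _ => 1 := by
    filter_upwards [Ioi_mem_nhds ht] with s hs using h.eq_one s (le_of_lt hs)
  rw [this.deriv_eq]; simp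

theorem IsStep.exists_deriv_bound (h : IsStep Θ a c) : ∃ C, ∀ t, |deriv Θ t| ≤ C := by
  have hs : HasCompactSupport (deriv Θ) := by
    apply HasCompactSupport.intro (isCompact_Icc (a := a) (b := c))
    intro t ht
    rw [mem_Icc, not_and_or, not_le, not_le] at ht
    exact ht.elim h.deriv_eq_zero_of_lt h.deriv_eq_zero_of_gt
  exact hs.exists_bound_of_continuous h.contDiff_deriv.continuous

/-- The kernel of the weighted average. -/
noncomputable def avgKer (Θ : ℝ → ℝ) : ℝ → ℝ → ℝ := fun _ t => deriv Θ t

/-- The kernel of the compactly supported primitive. -/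
noncomputable def primKer (Θ : ℝ → ℝ) : ℝ → ℝ → ℝ := fun s t => (Iio (0 : ℝ)).indicator 1 s - Θ t

theorem IsStep.isLineKernel_avgKer (h : IsStep Θ a c) :
    ∃ C, IsLineKernel (avgKer Θ) C (|a| + |c|) := by
  obtain ⟨C, hC⟩ := h.exists_deriv_bound
  refine ⟨C, ?_, fun s t => hC t, fun s t hne => ?_⟩
  · exact h.contDiff_deriv.continuous.measurable.comp measurable_snd
  · have h1 : a ≤ t := by
      by_contra! hc; exact hne (h.deriv_eq_zero_of_lt hc)
    have h2 : t ≤ c := by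
      by_contra! hc; exact hne (h.deriv_eq_zero_of_gt hc)
    have h3 : |s| ≤ |s + t| + |t| := by
      calc |s| = |(s + t) - t| := by congr 1; ring
        _ ≤ _ := abs_sub _ _
    have h4 : |t| ≤ |a| + |c| := by
      rw [abs_le]
      constructor
      · linarith [neg_abs_le a, abs_nonneg c]
      · linarith [le_abs_self c, abs_nonneg a]
    linarith

/-- The two terms cancel when `s < 0` and `t ≥ c`, and both vanish when `s ≥ 0` and `t ≤ a`. In the
remaining cases `|s|` exceeds `|s + t|` by at most `|a|` or `|c|`. -/
theorem IsStep.isLineKernel_primKer (h : IsStep Θ a c) :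
    IsLineKernel (primKer Θ) 1 (|a| + |c|) := by
  refine ⟨?_, fun s t => ?_, fun s t hne => ?_⟩
  · exact ((measurable_one.indicator measurableSet_Iio).comp measurable_fst).sub
      (h.contDiff.continuous.measurable.comp measurable_snd)
  · unfold primKer
    have h1 := h.nonneg t
    have h2 := h.le_one t
    by_cases hs : s < 0
    · simp [hs, abs_le]; constructor <;> linarith
    · simp [hs, abs_le]; constructor <;> linarith
  · unfold primKer at hne
    have b1 := neg_abs_le a
    have b2 := le_abs_self c
    have b3 := abs_nonneg a
    have b4 := abs_nonneg c
    have b5 := neg_abs_le (s + t)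
    have b6 := le_abs_self (s + t)
    by_cases hs : s < 0
    · have : t < c := by
        by_contra! hc
        apply hne
        simp [hs, h.eq_one t hc]
      rw [abs_of_neg hs]
      linarith
    · have : a < t := by
        by_contra! hc
        apply hne
        simp [hs, h.eq_zero t hc]
      rw [abs_of_nonneg (not_lt.1 hs)]
      linarith

end Steps

/-! ### Splitting a test function into an average and a derivative -/

section Decomposition

variable {V : Type*} [NormedAddCommGroup V] [NormedSpace ℝ V]
  {e : V} {l : V →L[ℝ] ℝ} {Θ : ℝ → ℝ} {a c : ℝ} {φ : V → ℝ}

theorem integrable_mul_line {f : ℝ → ℝ} (hf : LocallyIntegrable f)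
    (hφ : Continuous φ) (hφc : HasCompactSupport φ) (hle : l e = 1) (x : V) :
    Integrable (fun s => f s * φ (x + s • e)) := by
  have hcs : IsCompact (l '' tsupport φ) := IsCompact.image hφc l.continuous
  obtain ⟨r, hr⟩ := hcs.isBounded.exists_norm_le
  have hc : Continuous fun s : ℝ => φ (x + s • e) := by fun_prop
  have hs : HasCompactSupport fun s : ℝ => φ (x + s • e) := by
    apply HasCompactSupport.intro (isCompact_Icc (a := - (r + |l x|)) (b := r + |l x|))
    intro s hs
    by_contra hne
    apply hs
    have h1 : x + s • e ∈ tsupport φ := by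
      by_contra hc
      exact hne (image_eq_zero_of_notMem_tsupport hc)
    have h2 := hr _ ⟨_, h1, rfl⟩
    simp only [map_add, map_smul, hle, smul_eq_mul, mul_one, Real.norm_eq_abs] at h2
    rw [mem_Icc, ← abs_le]
    calc |s| = |(l x + s) - l x| := by congr 1; ring
      _ ≤ |l x + s| + |l x| := abs_sub _ _
      _ ≤ _ := by linarith
  have := hf.integrable_smul_right_of_hasCompactSupport hc hs
  simpa using this

theorem locallyIntegrable_indicator_Iio : LocallyIntegrable ((Iio (0 : ℝ)).indicator (1 : ℝ → ℝ)) := by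
  intro x
  obtain ⟨s, hs, hi⟩ := (locallyIntegrable_const (1 : ℝ) : LocallyIntegrable (fun _ : ℝ => (1 : ℝ))) x
  exact ⟨s, hs, IntegrableOn.indicator hi measurableSet_Iio⟩

theorem lineOp_avgKer (x : V) :
    lineOp e l (avgKer Θ) φ x = deriv Θ (l x) * ∫ s : ℝ, φ (x + s • e) := by
  simp only [lineOp, avgKer]
  rw [integral_const_mul]

theorem lineOp_primKer (hφ : Continuous φ) (hφc : HasCompactSupport φ) (hle : l e = 1) (x : V) :
    lineOp e l (primKer Θ) φ x =
      (∫ s, (Iio (0 : ℝ)).indicator 1 s * φ (x + s • e)) - Θ (l x) * ∫ s : ℝ, φ (x + s • e) := by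
  simp only [lineOp, primKer, sub_mul]
  rw [integral_sub, integral_const_mul]
  · exact integrable_mul_line locallyIntegrable_indicator_Iio hφ hφc hle x
  · exact integrable_mul_line (f := fun _ => Θ (l x)) (locallyIntegrable_const _) hφ hφc hle x

theorem contDiff_integral_line (hφ : ContDiff ℝ ∞ φ) (hφc : HasCompactSupport φ) (hle : l e = 1) :
    ContDiff ℝ ∞ (fun x => ∫ s : ℝ, φ (x + s • e)) := by
  simpa using contDiff_integral_mul_line (f := fun _ => 1) (locallyIntegrable_const _) hφ hφc hle

theorem contDiff_lineOp_avgKer (h : IsStep Θ a c) (hφ : ContDiff ℝ ∞ φ) (hφc : HasCompactSupport φ)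
    (hle : l e = 1) : ContDiff ℝ ∞ (lineOp e l (avgKer Θ) φ) := by
  have : lineOp e l (avgKer Θ) φ = fun x => deriv Θ (l x) * ∫ s : ℝ, φ (x + s • e) := by
    funext x; exact lineOp_avgKer x
  rw [this]
  exact (h.contDiff_deriv.comp l.contDiff).mul (contDiff_integral_line hφ hφc hle)

theorem contDiff_lineOp_primKer (h : IsStep Θ a c) (hφ : ContDiff ℝ ∞ φ)
    (hφc : HasCompactSupport φ) (hle : l e = 1) : ContDiff ℝ ∞ (lineOp e l (primKer Θ) φ) := by
  have : lineOp e l (primKer Θ) φ = fun x =>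
      (∫ s, (Iio (0 : ℝ)).indicator 1 s * φ (x + s • e)) - Θ (l x) * ∫ s : ℝ, φ (x + s • e) := by
    funext x; exact lineOp_primKer hφ.continuous hφc hle x
  rw [this]
  exact (contDiff_integral_mul_line locallyIntegrable_indicator_Iio hφ hφc hle).sub
    ((h.contDiff.comp l.contDiff).mul (contDiff_integral_line hφ hφc hle))

theorem integral_line_add (φ : V → ℝ) (x e : V) (t : ℝ) :
    ∫ s : ℝ, φ (x + t • e + s • e) = ∫ s : ℝ, φ (x + s • e) := by
  rw [← integral_add_left_eq_self (fun s : ℝ => φ (x + s • e)) t]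
  congr 1; funext s
  rw [add_smul, add_assoc]

/-- Translation by `t e` turns the half line integral into `∫_{-∞}^t φ(x + s e) ds`, so this is the
fundamental theorem of calculus. -/
theorem hasDerivAt_integral_line (hφ : Continuous φ) (hφc : HasCompactSupport φ) (hle : l e = 1)
    (x : V) : HasDerivAt (fun t : ℝ => ∫ s, (Iio (0 : ℝ)).indicator 1 s * φ (x + t • e + s • e))
      (φ x) 0 := by
  have hi : Integrable fun s : ℝ => φ (x + s • e) := by
    simpa using integrable_mul_line (f := fun _ => 1) (locallyIntegrable_const _) hφ hφc hle x
  have h1 : ∀ t : ℝ, (∫ s, (Iio (0 : ℝ)).indicator 1 s * φ (x + t • e + s • e)) =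
      (∫ s in Iic (0 : ℝ), φ (x + s • e)) + ∫ s in (0 : ℝ)..t, φ (x + s • e) := by
    intro t
    rw [← intervalIntegral.integral_Iic_sub_Iic hi.integrableOn hi.integrableOn,
      add_sub_cancel, integral_Iic_eq_integral_Iio, ← integral_indicator measurableSet_Iio]
    refine Eq.trans ?_ (integral_add_right_eq_self
      (fun r => (Iio t).indicator (fun s : ℝ => φ (x + s • e)) r) t)
    congr 1; funext s
    by_cases hs : s < 0
    · rw [indicator_of_mem (by exact hs), indicator_of_mem (by simpa using hs)]
      simp [add_smul, add_assoc, add_comm (s • e)]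
    · rw [indicator_of_notMem (by exact hs), indicator_of_notMem (by simpa using hs)]
      simp
  simp_rw [h1]
  have hc : Continuous fun s : ℝ => φ (x + s • e) := by fun_prop
  have := (intervalIntegral.integral_hasDerivAt_right (hc.intervalIntegrable 0 0)
    (hc.stronglyMeasurableAtFilter _ _) hc.continuousAt)
  simpa using this.const_add (∫ s in Iic (0 : ℝ), φ (x + s • e))

/-- The integral over the whole line is constant in the direction `e`. Hence only the half line
integral, with derivative `φ`, and the factor `Θ (l x)` are differentiated. -/
theorem dirDeriv_lineOp_primKer (h : IsStep Θ a c) (hφ : ContDiff ℝ ∞ φ)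
    (hφc : HasCompactSupport φ) (hle : l e = 1) (x : V) :
    dirDeriv e (lineOp e l (primKer Θ) φ) x = φ x - lineOp e l (avgKer Θ) φ x := by
  have hd : Differentiable ℝ (lineOp e l (primKer Θ) φ) :=
    (contDiff_lineOp_primKer h hφ hφc hle).differentiable (by simp)
  have h1 : HasDerivAt (fun t : ℝ => lineOp e l (primKer Θ) φ (x + t • e))
      (dirDeriv e (lineOp e l (primKer Θ) φ) x) 0 := by
    have h2 : HasDerivAt (fun t : ℝ => x + t • e) e 0 := by
      simpa using ((hasDerivAt_id (0 : ℝ)).smul_const e).const_add x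
    have h3 := (hd (x + (0 : ℝ) • e)).hasFDerivAt.comp_hasDerivAt (0 : ℝ) h2
    simpa [dirDeriv, Function.comp_def] using h3
  refine h1.unique ?_
  have h4 : (fun t : ℝ => lineOp e l (primKer Θ) φ (x + t • e)) = fun t =>
      (∫ s, (Iio (0 : ℝ)).indicator 1 s * φ (x + t • e + s • e)) -
        Θ (l x + t) * ∫ s : ℝ, φ (x + s • e) := by
    funext t
    rw [lineOp_primKer hφ.continuous hφc hle, integral_line_add]
    simp [hle]
  rw [h4, lineOp_avgKer]
  have h5 : HasDerivAt (fun t : ℝ => Θ (l x + t)) (deriv Θ (l x)) 0 := by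
    have h6 : HasDerivAt Θ (deriv Θ (l x)) (l x + 0) := by
      rw [add_zero]; exact (h.contDiff.differentiable (by simp) (l x)).hasDerivAt
    exact h6.comp_const_add (l x) 0
  exact (hasDerivAt_integral_line hφ.continuous hφc hle x).sub (h5.mul_const _)

end Decomposition

/-! ### Boxes, and stability of their test functions under the line operators -/

section BoxCoordinates

variable {V : Type*} [NormedAddCommGroup V] [NormedSpace ℝ V] {n : ℕ}

/-- Linear coordinates `l i`, dual to the directions `e i`, in which `U` is the box `∏ I i`;
the intervals `[a i, c i]` are auxiliary nondegenerate subintervals of the `I i`. -/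
structure BoxCoords (e : Fin n → V) (l : Fin n → V →L[ℝ] ℝ) (I : Fin n → Set ℝ) (a c : Fin n → ℝ)
    (U : Set V) : Prop where
  dual : ∀ i j, l i (e j) = if i = j then 1 else 0
  expand : ∀ x, x = ∑ i, l i x • e i
  isCompact_box : ∀ A C : Fin n → ℝ, IsCompact {x | ∀ i, l i x ∈ Icc (A i) (C i)}
  mem_iff : ∀ x, x ∈ U ↔ ∀ i, l i x ∈ I i
  isOpen : IsOpen U
  ordConnected : ∀ i, (I i).OrdConnected
  lt : ∀ i, a i < c i
  left_mem : ∀ i, a i ∈ I i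
  right_mem : ∀ i, c i ∈ I i

variable {e : Fin n → V} {l : Fin n → V →L[ℝ] ℝ} {I : Fin n → Set ℝ} {a c : Fin n → ℝ}
  {U : Set V} {φ : V → ℝ}

/-- The function `φ` vanishes outside of the box `∏ [A i, C i]`, an admissible compact box in `U`. -/
structure VanishesOff (l : Fin n → V →L[ℝ] ℝ) (I : Fin n → Set ℝ) (a c A C : Fin n → ℝ)
    (φ : V → ℝ) : Prop where
  left_le : ∀ i, A i ≤ a i
  right_le : ∀ i, c i ≤ C i
  left_mem : ∀ i, A i ∈ I i
  right_mem : ∀ i, C i ∈ I i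
  mem_of_ne : ∀ x, φ x ≠ 0 → ∀ i, l i x ∈ Icc (A i) (C i)

theorem BoxCoords.exists_vanishesOff (h : BoxCoords e l I a c U) (hφ : IsTest U φ) :
    ∃ A C, VanishesOff l I a c A C φ := by
  have key : ∀ i, ∃ A C, A ≤ a i ∧ c i ≤ C ∧ A ∈ I i ∧ C ∈ I i ∧
      ∀ x, φ x ≠ 0 → l i x ∈ Icc A C := by
    intro i
    set S : Set ℝ := l i '' tsupport φ ∪ {a i, c i}
    have hS : IsCompact S :=
      (IsCompact.image hφ.hasCompactSupport (l i).continuous).union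
        (Finite.isCompact (by simp))
    have hne : S.Nonempty := ⟨a i, Or.inr (by simp)⟩
    have hSI : S ⊆ I i := by
      rintro t (⟨x, hx, rfl⟩ | ht)
      · exact (h.mem_iff x).1 (hφ.tsupport_subset hx) i
      · rcases ht with rfl | rfl
        exacts [h.left_mem i, h.right_mem i]
    refine ⟨sInf S, sSup S, ?_, ?_, hSI (hS.sInf_mem hne), hSI (hS.sSup_mem hne), ?_⟩
    · exact csInf_le hS.bddBelow (Or.inr (by simp))
    · exact le_csSup hS.bddAbove (Or.inr (by simp))
    · intro x hx
      have : l i x ∈ S := Or.inl ⟨x, subset_tsupport _ hx, rfl⟩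
      exact ⟨csInf_le hS.bddBelow this, le_csSup hS.bddAbove this⟩
  choose A C h1 h2 h3 h4 h5 using key
  exact ⟨A, C, h1, h2, h3, h4, fun x hx i => h5 i x hx⟩

theorem BoxCoords.isTest (h : BoxCoords e l I a c U) {A C : Fin n → ℝ}
    (hv : VanishesOff l I a c A C φ) (hφ : ContDiff ℝ ∞ φ) : IsTest U φ := by
  have hc := h.isCompact_box A C
  have hsub : tsupport φ ⊆ {x | ∀ i, l i x ∈ Icc (A i) (C i)} :=
    closure_minimal (fun x hx => hv.mem_of_ne x hx) hc.isClosed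
  refine ⟨hφ, hc.of_isClosed_subset isClosed_closure hsub, hsub.trans fun x hx => ?_⟩
  rw [h.mem_iff]
  exact fun i => (h.ordConnected i).out (hv.left_mem i) (hv.right_mem i) (hx i)

theorem BoxCoords.eq_zero_of_line (h : BoxCoords e l I a c U) {A C : Fin n → ℝ}
    (hv : VanishesOff l I a c A C φ) {i j : Fin n} (hij : j ≠ i) {x : V}
    (hx : l j x ∉ Icc (A j) (C j)) (s : ℝ) : φ (x + s • e i) = 0 := by
  by_contra hne
  have := hv.mem_of_ne _ hne j
  simp only [map_add, map_smul, h.dual j i, if_neg hij, smul_zero, add_zero] at this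
  exact hx this

/-- In a coordinate `j ≠ i` the line in direction `e i` misses the box. In the coordinate `i` the
factor `Θ'` lives in `[a i, c i]`, which every admissible box contains. -/
theorem BoxCoords.vanishesOff_avg (h : BoxCoords e l I a c U) {A C : Fin n → ℝ}
    (hv : VanishesOff l I a c A C φ) {i : Fin n} {Θ : ℝ → ℝ} (hΘ : IsStep Θ (a i) (c i)) :
    VanishesOff l I a c A C (lineOp (e i) (l i) (avgKer Θ) φ) := by
  refine ⟨hv.1, hv.2, hv.3, hv.4, fun x hx j => ?_⟩
  by_contra hj
  apply hx
  rw [lineOp_avgKer]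
  by_cases hij : j = i
  · subst hij
    rw [mem_Icc, not_and_or, not_le, not_le] at hj
    rcases hj with hj | hj
    · rw [hΘ.deriv_eq_zero_of_lt (hj.trans_le (hv.left_le j)), zero_mul]
    · rw [hΘ.deriv_eq_zero_of_gt ((hv.right_le j).trans_lt hj), zero_mul]
  · simp [h.eq_zero_of_line hv hij hj]

/-- To the left of the box `Θ` is `0` and the half line `s < 0` misses the support of `φ`. To the
right `Θ` is `1` and the half line integral is the integral over the whole line, so the difference
is `0`. This is why `Θ` times the total integral is subtracted. -/
theorem BoxCoords.vanishesOff_prim (h : BoxCoords e l I a c U) {A C : Fin n → ℝ}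
    (hv : VanishesOff l I a c A C φ) {i : Fin n} {Θ : ℝ → ℝ} (hΘ : IsStep Θ (a i) (c i)) :
    VanishesOff l I a c A C (lineOp (e i) (l i) (primKer Θ) φ) := by
  refine ⟨hv.1, hv.2, hv.3, hv.4, fun x hx j => ?_⟩
  by_contra hj
  apply hx
  have hz : ∀ s, primKer Θ s (l i x) * φ (x + s • e i) = 0 := by
    intro s
    by_cases hij : j = i
    · subst hij
      by_contra hne
      have hφ : φ (x + s • e j) ≠ 0 := fun h0 => hne (by rw [h0, mul_zero])
      have hk : primKer Θ s (l j x) ≠ 0 := fun h0 => hne (by rw [h0, zero_mul])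
      have hm := hv.mem_of_ne _ hφ j
      simp only [map_add, map_smul, h.dual j j, if_true, smul_eq_mul, mul_one, mem_Icc] at hm
      rw [mem_Icc, not_and_or, not_le, not_le] at hj
      rcases hj with hj | hj
      · apply hk
        have hs : ¬ s < 0 := by linarith
        simp [primKer, hs, hΘ.eq_zero _ (hj.le.trans (hv.left_le j))]
      · apply hk
        have hs : s < 0 := by linarith
        simp [primKer, hs, hΘ.eq_one _ ((hv.right_le j).trans hj.le)]
    · rw [h.eq_zero_of_line hv hij hj, mul_zero]
  simp [lineOp, hz]

theorem BoxCoords.isTest_avg (h : BoxCoords e l I a c U) (hφ : IsTest U φ) {i : Fin n} {Θ : ℝ → ℝ}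
    (hΘ : IsStep Θ (a i) (c i)) : IsTest U (lineOp (e i) (l i) (avgKer Θ) φ) := by
  obtain ⟨A, C, hv⟩ := h.exists_vanishesOff hφ
  exact h.isTest (h.vanishesOff_avg hv hΘ)
    (contDiff_lineOp_avgKer hΘ hφ.contDiff hφ.hasCompactSupport (by simp [h.dual]))

theorem BoxCoords.isTest_prim (h : BoxCoords e l I a c U) (hφ : IsTest U φ) {i : Fin n}
    {Θ : ℝ → ℝ} (hΘ : IsStep Θ (a i) (c i)) :
    IsTest U (lineOp (e i) (l i) (primKer Θ) φ) := by
  obtain ⟨A, C, hv⟩ := h.exists_vanishesOff hφ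
  exact h.isTest (h.vanishesOff_prim hv hΘ)
    (contDiff_lineOp_primKer hΘ hφ.contDiff hφ.hasCompactSupport (by simp [h.dual]))

theorem BoxCoords.eq_of_invariant (h : BoxCoords e l I a c U) {R : V → ℝ}
    (hR : ∀ i x (t : ℝ), R (x + t • e i) = R x) (x : V) : R x = R 0 := by
  have key : ∀ (s : Finset (Fin n)) (t : Fin n → ℝ), R (∑ i ∈ s, t i • e i) = R 0 := by
    intro s t
    induction s using Finset.induction_on with
    | empty => simp
    | insert i s hi ih => rw [Finset.sum_insert hi, add_comm, hR, ih]
  conv_lhs => rw [h.expand x]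
  exact key _ _

end BoxCoordinates

/-! ### Distributions whose first derivatives are locally in `L^p` -/

section Primitive

variable {V : Type*} [NormedAddCommGroup V] [NormedSpace ℝ V] [MeasureSpace V] [BorelSpace V]
  [FiniteDimensional ℝ V] [(volume : Measure V).IsAddHaarMeasure] {n : ℕ}
  {e : Fin n → V} {l : Fin n → V →L[ℝ] ℝ} {I : Fin n → Set ℝ} {a c : Fin n → ℝ}
  {U : Set V}

theorem integral_dirDeriv_eq_zero {φ : V → ℝ} (hφ : IsTest U φ) (v : V) :
    ∫ x, dirDeriv v φ x = 0 := by
  have h1 : Integrable φ := hφ.contDiff.continuous.integrable_of_hasCompactSupport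
    hφ.hasCompactSupport
  have h2 : Integrable (dirDeriv v φ) :=
    (hφ.dirDeriv v).contDiff.continuous.integrable_of_hasCompactSupport
      (hφ.dirDeriv v).hasCompactSupport
  have h2' : Integrable fun x => fderiv ℝ φ x v := h2
  have := integral_mul_fderiv_eq_neg_fderiv_mul_of_integrable (μ := (volume : Measure V))
    (f := fun _ => (1 : ℝ)) (g := φ) (v := v) (by simp)
    (by simpa using h2') (by simpa using h1)
    (fun _ _ => by fun_prop) (fun x _ => hφ.contDiff.differentiable (by simp) x)
  simpa [dirDeriv] using this

/-- The averaging of test functions in the first `k` coordinate directions, as a map with the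
properties needed to represent functionals. -/
theorem BoxCoords.exists_averaging (h : BoxCoords e l I a c U) {p q : ℝ}
    (hpq : p.HolderConjugate q) {T : (V → ℝ) → ℝ}
    (hadd : ∀ φ ψ, IsTest U φ → IsTest U ψ → T (φ + ψ) = T φ + T ψ)
    {g : Fin n → V → ℝ} (hg : ∀ i, LpLoc (ENNReal.ofReal p) (g i))
    (hT : ∀ i φ, IsTest U φ → T (dirDeriv (e i) φ) = - ∫ x, g i x * φ x)
    {Θ : Fin n → ℝ → ℝ} (hΘ : ∀ i, IsStep (Θ i) (a i) (c i)) (k : ℕ) (hk : k ≤ n) :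
    ∃ Q : (V → ℝ) → V → ℝ, (∀ φ, IsTest U φ → IsTest U (Q φ)) ∧
      (∀ φ, IsTest U φ → ∫ x, Q φ x = ∫ x, φ x) ∧
      (∀ h : V → ℝ, LpLoc (ENNReal.ofReal p) h → ∃ h', LpLoc (ENNReal.ofReal p) h' ∧
        ∀ φ, IsTest U φ → ∫ x, h x * Q φ x = ∫ x, h' x * φ x) ∧
      (∃ w, LpLoc (ENNReal.ofReal p) w ∧ ∀ φ, IsTest U φ → T φ = T (Q φ) + ∫ x, w x * φ x) ∧
      (∀ φ, IsTest U φ → ∃ R : V → ℝ,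
        (∀ i : Fin n, i.1 < k → ∀ x (t : ℝ), R (x + t • e i) = R x) ∧
        ∀ x, Q φ x = (∏ i : Fin n with i.1 < k, deriv (Θ i) (l i x)) * R x) := by
  have : ProperSpace V := FiniteDimensional.proper ℝ V
  have hp1 : 1 ≤ ENNReal.ofReal p := by simpa using hpq.lt.le
  induction k with
  | zero =>
    refine ⟨id, fun _ h => h, fun _ _ => rfl, fun h hh => ⟨h, hh, fun _ _ => rfl⟩,
      ⟨fun _ => 0, LpLoc.const 0, by simp⟩, fun φ _ => ⟨φ, by simp, by simp⟩⟩
  | succ k ih =>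
    obtain ⟨Q, hQ, hQi, hQd, ⟨w, hw, hTw⟩, hQR⟩ := ih (by omega)
    let i : Fin n := ⟨k, by omega⟩
    have hle : l i (e i) = 1 := by simp [h.dual]
    obtain ⟨C, hav⟩ := (hΘ i).isLineKernel_avgKer
    have hpr := (hΘ i).isLineKernel_primKer
    -- Both terms are built from test functions in `U`, so `T` may be applied to each of them.
    have hdec : ∀ ψ, IsTest U ψ → ψ = lineOp (e i) (l i) (avgKer (Θ i)) ψ +
        dirDeriv (e i) (lineOp (e i) (l i) (primKer (Θ i)) ψ) := by
      intro ψ hψ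
      funext x
      rw [Pi.add_apply, dirDeriv_lineOp_primKer (hΘ i) hψ.contDiff hψ.hasCompactSupport hle]
      ring
    refine ⟨fun φ => lineOp (e i) (l i) (avgKer (Θ i)) (Q φ),
      fun φ hφ => h.isTest_avg (hQ φ hφ) (hΘ i), fun φ hφ => ?_, fun f hf => ?_, ?_, fun φ hφ => ?_⟩
    · rw [← hQi φ hφ]
      conv_rhs => rw [hdec _ (hQ φ hφ)]
      have t1 := h.isTest_avg (hQ φ hφ) (hΘ i)
      have t2 := h.isTest_prim (hQ φ hφ) (hΘ i)
      simp only [Pi.add_apply]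
      rw [integral_add, integral_dirDeriv_eq_zero t2, add_zero]
      · exact t1.contDiff.continuous.integrable_of_hasCompactSupport t1.hasCompactSupport
      · exact (t2.dirDeriv _).contDiff.continuous.integrable_of_hasCompactSupport
          (t2.dirDeriv _).hasCompactSupport
    · obtain ⟨f', hf', hff⟩ := hQd _ (hav.lpLoc_lineDual hpq hf (e i) (l i))
      refine ⟨f', hf', fun φ hφ => ?_⟩
      rw [← hff φ hφ]
      exact hav.integral_mul_lineOp hle hp1 hf (hQ φ hφ).contDiff.continuous
        (hQ φ hφ).hasCompactSupport
    -- `T` of the derivative is `-∫ g i · prim (Q φ)`. Duality moves first the primitive operator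
    -- and then `Q` onto `g i`, and the result is subtracted from `w`.
    · obtain ⟨w', hw', hww⟩ := hQd _ (hpr.lpLoc_lineDual hpq (hg i) (e i) (l i))
      refine ⟨fun x => w x - w' x, hw.sub hw', fun φ hφ => ?_⟩
      have t1 := h.isTest_avg (hQ φ hφ) (hΘ i)
      have t2 := h.isTest_prim (hQ φ hφ) (hΘ i)
      have i1 := integrable_mul_of_tsupport_subset (hw.locallyIntegrable hp1 |>.locallyIntegrableOn U)
        hφ.contDiff.continuous hφ.hasCompactSupport hφ.tsupport_subset
      have i2 := integrable_mul_of_tsupport_subset (hw'.locallyIntegrable hp1 |>.locallyIntegrableOn U)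
        hφ.contDiff.continuous hφ.hasCompactSupport hφ.tsupport_subset
      rw [hTw φ hφ]
      conv_lhs => rw [hdec _ (hQ φ hφ)]
      rw [hadd _ _ t1 (t2.dirDeriv _), hT i _ t2,
        hpr.integral_mul_lineOp hle hp1 (hg i) (hQ φ hφ).contDiff.continuous
          (hQ φ hφ).hasCompactSupport, hww φ hφ]
      simp only [sub_mul]
      rw [integral_sub i1 i2]
      ring
    · obtain ⟨R, hR1, hR2⟩ := hQR φ hφ
      -- Integrating over the line in direction `e i` makes `R` invariant in this direction too; the
      -- earlier factors do not depend on the coordinate `i` and leave the integral.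
      refine ⟨fun x => ∫ s : ℝ, R (x + s • e i), fun j hj x t => ?_, fun x => ?_⟩
      · by_cases hji : j = i
        · rw [hji]
          exact integral_line_add R x (e i) t
        · have hjk : j.1 < k := by
            have : j.1 ≠ k := fun hc => hji (Fin.ext hc)
            omega
          refine integral_congr_ae (Filter.Eventually.of_forall fun s => ?_)
          simp only
          rw [add_right_comm, hR1 j hjk]
      · have hprod : ∀ s : ℝ, ∏ j : Fin n with j.1 < k, deriv (Θ j) (l j (x + s • e i)) =
            ∏ j : Fin n with j.1 < k, deriv (Θ j) (l j x) := by
          intro s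
          apply Finset.prod_congr rfl
          intro j hj
          have hji : j ≠ i := by
            rintro rfl
            simp [i] at hj
          simp [h.dual, hji]
        have hset : (Finset.univ.filter fun j : Fin n => j.1 < k + 1) =
            insert i (Finset.univ.filter fun j : Fin n => j.1 < k) := by
          ext j
          simp only [Finset.mem_filter, Finset.mem_univ, true_and, Finset.mem_insert, Fin.ext_iff, i]
          omega
        simp only
        rw [lineOp_avgKer, hset, Finset.prod_insert (by simp [i])]
        simp_rw [hR2, hprod]
        rw [integral_const_mul]
        ring

/-- A functional on test functions whose distributional derivatives are locally in `L^p` is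
represented by a function which is locally in `L^p`. -/
theorem BoxCoords.exists_represents (h : BoxCoords e l I a c U) {p q : ℝ}
    (hpq : p.HolderConjugate q) {T : (V → ℝ) → ℝ}
    (hadd : ∀ φ ψ, IsTest U φ → IsTest U ψ → T (φ + ψ) = T φ + T ψ)
    (hsmul : ∀ (r : ℝ) φ, IsTest U φ → T (r • φ) = r * T φ)
    {g : Fin n → V → ℝ} (hg : ∀ i, LpLoc (ENNReal.ofReal p) (g i))
    (hT : ∀ i φ, IsTest U φ → T (dirDeriv (e i) φ) = - ∫ x, g i x * φ x) :
    ∃ w, LpLoc (ENNReal.ofReal p) w ∧ ∀ φ, IsTest U φ → T φ = ∫ x, w x * φ x := by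
  have : ProperSpace V := FiniteDimensional.proper ℝ V
  have hp1 : 1 ≤ ENNReal.ofReal p := by simpa using hpq.lt.le
  choose Θ hΘ using fun i => exists_isStep (h.lt i)
  obtain ⟨Q, hQ, hQi, -, ⟨w, hw, hTw⟩, hQR⟩ := h.exists_averaging hpq hadd hg hT hΘ n le_rfl
  have hmem : (∑ i, a i • e i) ∈ U := by
    rw [h.mem_iff]
    intro i
    have : l i (∑ j, a j • e j) = a i := by simp [h.dual]
    rw [this]; exact h.left_mem i
  obtain ⟨φ₀, hs, hc, hd, hr, h1⟩ := exists_contDiff_tsupport_subset (n := ⊤)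
    (h.isOpen.mem_nhds hmem)
  have hφ₀ : IsTest U φ₀ := ⟨hd, hc, hs⟩
  have hI0 : 0 < ∫ x, φ₀ x := by
    rw [integral_pos_iff_support_of_nonneg (μ := volume) (fun x => (hr ⟨x, rfl⟩).1)
      (hd.continuous.integrable_of_hasCompactSupport hc)]
    exact hd.continuous.isOpen_support.measure_pos volume ⟨_, by rw [Function.mem_support, h1]; norm_num⟩
  -- After averaging in all `n` directions `R` is invariant under every translation, hence constant.
  have hform : ∀ φ, IsTest U φ → ∃ r : ℝ, Q φ = r • fun x => ∏ i, deriv (Θ i) (l i x) := by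
    intro φ hφ
    obtain ⟨R, hR1, hR2⟩ := hQR φ hφ
    refine ⟨R 0, ?_⟩
    funext x
    rw [hR2, h.eq_of_invariant (fun i => hR1 i i.2) x]
    simp [mul_comm]
  obtain ⟨r₀, hr₀⟩ := hform φ₀ hφ₀
  have hr₀' : r₀ ≠ 0 := by
    rintro rfl
    have := hQi φ₀ hφ₀
    rw [hr₀] at this
    simp at this
    exact hI0.ne this
  -- The multiple is determined by the integral, which averaging preserves; `φ₀` only serves to
  -- normalise.
  have hQφ : ∀ φ, IsTest U φ → Q φ = ((∫ x, φ x) / ∫ x, φ₀ x) • Q φ₀ := by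
    intro φ hφ
    obtain ⟨r, hr⟩ := hform φ hφ
    have e1 : Q φ = (r / r₀) • Q φ₀ := by
      rw [hr, hr₀, smul_smul, div_mul_cancel₀ _ hr₀']
    have e2 : ∫ x, φ x = (r / r₀) * ∫ x, φ₀ x := by
      rw [← hQi φ hφ, e1, ← hQi φ₀ hφ₀, ← integral_const_mul]
      rfl
    rw [e2, mul_div_cancel_right₀ _ hI0.ne', e1]
  -- `T (Q φ)` is a fixed multiple of `∫ φ`, that is, the pairing of `φ` with a constant.
  refine ⟨fun x => w x + T (Q φ₀) / ∫ x, φ₀ x, hw.add (LpLoc.const _), fun φ hφ => ?_⟩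
  have i1 := integrable_mul_of_tsupport_subset (hw.locallyIntegrable hp1 |>.locallyIntegrableOn U)
    hφ.contDiff.continuous hφ.hasCompactSupport hφ.tsupport_subset
  have i2 := hφ.contDiff.continuous.integrable_of_hasCompactSupport (μ := volume)
    hφ.hasCompactSupport
  rw [hTw φ hφ, hQφ φ hφ, hsmul _ _ (hQ φ₀ hφ₀)]
  simp only [add_mul]
  rw [integral_add i1 (i2.const_mul _), integral_const_mul]
  ring

end Primitive

/-! ### Linearity of partial derivatives -/

section PartialDerivLinear

variable {V : Type*} [NormedAddCommGroup V] [NormedSpace ℝ V]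

theorem dirDeriv_add {φ ψ : V → ℝ} (hφ : ContDiff ℝ ∞ φ) (hψ : ContDiff ℝ ∞ ψ) (v : V) :
    dirDeriv v (φ + ψ) = dirDeriv v φ + dirDeriv v ψ := by
  funext x
  simp only [dirDeriv, Pi.add_apply]
  rw [fderiv_add (hφ.differentiable (by simp) x) (hψ.differentiable (by simp) x)]
  rfl

theorem dirDeriv_smul (r : ℝ) {φ : V → ℝ} (hφ : ContDiff ℝ ∞ φ) (v : V) :
    dirDeriv v (r • φ) = r • dirDeriv v φ := by
  funext x
  simp only [dirDeriv, Pi.smul_apply]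
  rw [fderiv_const_smul (hφ.differentiable (by simp) x)]
  rfl

theorem partialDeriv_add {n : ℕ} (e : Fin n → V) (α : Fin n → ℕ) {φ ψ : V → ℝ}
    (hφ : ContDiff ℝ ∞ φ) (hψ : ContDiff ℝ ∞ ψ) :
    partialDeriv e α (φ + ψ) = partialDeriv e α φ + partialDeriv e α ψ := by
  induction n with
  | zero => simp [partialDeriv_nil]
  | succ n ih =>
    simp only [partialDeriv_succ]
    rw [ih]
    have h1 := contDiff_partialDeriv (fun i => e i.succ) (fun i => α i.succ) hφ
    have h2 := contDiff_partialDeriv (fun i => e i.succ) (fun i => α i.succ) hψ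
    generalize partialDeriv (fun i => e i.succ) (fun i => α i.succ) φ = f at h1 ⊢
    generalize partialDeriv (fun i => e i.succ) (fun i => α i.succ) ψ = g at h2 ⊢
    generalize α 0 = k
    induction k generalizing f g with
    | zero => rfl
    | succ k ihk =>
      simp only [Function.iterate_succ_apply]
      rw [dirDeriv_add h1 h2, ihk _ (contDiff_dirDeriv h1 _) _ (contDiff_dirDeriv h2 _)]

theorem partialDeriv_smul {n : ℕ} (e : Fin n → V) (α : Fin n → ℕ) (r : ℝ) {φ : V → ℝ}
    (hφ : ContDiff ℝ ∞ φ) : partialDeriv e α (r • φ) = r • partialDeriv e α φ := by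
  induction n with
  | zero => simp [partialDeriv_nil]
  | succ n ih =>
    simp only [partialDeriv_succ]
    rw [ih]
    have h1 := contDiff_partialDeriv (fun i => e i.succ) (fun i => α i.succ) hφ
    generalize partialDeriv (fun i => e i.succ) (fun i => α i.succ) φ = f at h1 ⊢
    generalize α 0 = k
    induction k generalizing f with
    | zero => rfl
    | succ k ihk =>
      simp only [Function.iterate_succ_apply]
      rw [dirDeriv_smul r h1, ihk _ (contDiff_dirDeriv h1 _)]

end PartialDerivLinear

/-! ### The strip as a box; existence of all intermediate weak derivatives -/

section Strip

variable {d : ℕ} {bm bp : ℝ}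

instance isAddHaarMeasure_full : (volume : Measure (Full d)).IsAddHaarMeasure := by
  rw [Measure.volume_eq_prod]
  infer_instance

theorem mem_strip {x : Full d} : x ∈ strip d bm bp ↔ bm < x.2 ∧ x.2 < bp := Iff.rfl

theorem isOpen_strip : IsOpen (strip d bm bp) :=
  (isOpen_lt continuous_const continuous_snd).inter (isOpen_lt continuous_snd continuous_const)

theorem measurableSet_strip : MeasurableSet (strip d bm bp) := isOpen_strip.measurableSet

@[simp] theorem fullDir_castSucc (j : Fin d) : fullDir d j.castSucc = (horDir d j, 0) := by
  simp [fullDir]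

@[simp] theorem fullDir_last : fullDir d (Fin.last d) = (0, 1) := by
  simp [fullDir]

/-- The coordinate functionals of `ℝ^N = ℝ^{N-1} × ℝ`. -/
noncomputable def fullCoord (d : ℕ) : Fin (d + 1) → Full d →L[ℝ] ℝ :=
  Fin.snoc (α := fun _ => Full d →L[ℝ] ℝ)
    (fun j => (EuclideanSpace.proj j : Hor d →L[ℝ] ℝ).comp (ContinuousLinearMap.fst ℝ (Hor d) ℝ))
    (ContinuousLinearMap.snd ℝ (Hor d) ℝ)

@[simp] theorem fullCoord_castSucc (j : Fin d) (x : Full d) : fullCoord d j.castSucc x = x.1 j := by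
  simp [fullCoord]

@[simp] theorem fullCoord_last (x : Full d) : fullCoord d (Fin.last d) x = x.2 := by
  simp [fullCoord]

theorem boxCoords_strip (hb : bm < bp) :
    BoxCoords (fullDir d) (fullCoord d)
      (Fin.snoc (α := fun _ => Set ℝ) (fun _ => univ) (Ioo bm bp))
      (Fin.snoc (α := fun _ => ℝ) (fun _ => 0) (bm + (bp - bm) / 3))
      (Fin.snoc (α := fun _ => ℝ) (fun _ => 1) (bm + 2 * (bp - bm) / 3))
      (strip d bm bp) := by
  refine ⟨?_, ?_, ?_, ?_, isOpen_strip, ?_, ?_, ?_, ?_⟩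
  · intro i j
    refine Fin.lastCases ?_ (fun i => ?_) i <;> refine Fin.lastCases ?_ (fun j => ?_) j
    · simp
    · simp [(Fin.castSucc_lt_last j).ne']
    · simp [(Fin.castSucc_lt_last i).ne]
    · simp [horDir]
  · intro x
    rw [Fin.sum_univ_castSucc]
    ext j
    · simp [Prod.fst_sum, horDir, Pi.single_apply]
    · simp [Prod.snd_sum]
  · intro A C
    refine Metric.isCompact_of_isClosed_isBounded ?_ ?_
    · have : {x : Full d | ∀ i, fullCoord d i x ∈ Icc (A i) (C i)} =
          ⋂ i, (fullCoord d i) ⁻¹' Icc (A i) (C i) := by ext; simp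
      rw [this]
      exact isClosed_iInter fun i => isClosed_Icc.preimage (fullCoord d i).continuous
    · have hK : IsCompact ((fun y : Fin (d + 1) → ℝ => ∑ i, y i • fullDir d i) '' (Icc A C)) :=
        isCompact_Icc.image (by fun_prop)
      refine hK.isBounded.subset fun x hx => ?_
      refine ⟨fun i => fullCoord d i x, ⟨fun i => (hx i).1, fun i => (hx i).2⟩, ?_⟩
      simp only
      rw [Fin.sum_univ_castSucc]
      ext j
      · simp [Prod.fst_sum, horDir, Pi.single_apply]
      · simp [Prod.snd_sum]
  · intro x
    constructor
    · intro hx i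
      refine Fin.lastCases ?_ (fun j => ?_) i
      · simpa [mem_strip] using hx
      · simp
    · intro h
      simpa [mem_strip] using h (Fin.last d)
  · intro i
    refine Fin.lastCases ?_ (fun j => ?_) i
    · simpa using ordConnected_Ioo
    · simpa using ordConnected_univ
  · intro i
    refine Fin.lastCases ?_ (fun j => ?_) i
    · simp; linarith
    · simp
  · intro i
    refine Fin.lastCases ?_ (fun j => ?_) i
    · simp; constructor <;> linarith
    · simp
  · intro i
    refine Fin.lastCases ?_ (fun j => ?_) i
    · simp; constructor <;> linarith
    · simp

theorem IsTest.setIntegral_mul {V : Type*} [NormedAddCommGroup V] [NormedSpace ℝ V]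
    [MeasureSpace V] {U : Set V} {φ : V → ℝ} (hφ : IsTest U φ) (f : V → ℝ) :
    ∫ x in U, f x * φ x = ∫ x, f x * φ x := by
  apply setIntegral_eq_integral_of_forall_compl_eq_zero
  intro x hx
  rw [image_eq_zero_of_notMem_tsupport (fun hh => hx (hφ.3 hh)), mul_zero]

theorem IsTest.integral_indicator_mul {V : Type*} [NormedAddCommGroup V] [NormedSpace ℝ V]
    [MeasureSpace V] {U : Set V} {φ : V → ℝ} (hφ : IsTest U φ) (f : V → ℝ) :
    ∫ x, U.indicator f x * φ x = ∫ x, f x * φ x := by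
  congr 1; funext x
  by_cases hx : x ∈ U
  · rw [indicator_of_mem hx]
  · rw [image_eq_zero_of_notMem_tsupport (fun hh => hx (hφ.3 hh)), mul_zero, mul_zero]

/-- All intermediate weak derivatives of a function in the homogeneous Sobolev space of the strip
exist, and their extensions by zero are locally in `L^p`. -/
theorem exists_isWeakDeriv (hb : bm < bp) {p : ℝ} (hp : 1 < p) {m : ℕ} {u : Full d → ℝ}
    (hu : MemHomSobolev (fullDir d) (strip d bm bp) m p u) (k : ℕ) (hk : k ≤ m)
    (α : Fin (d + 1) → ℕ) (hα : ∑ i, α i = m - k) :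
    ∃ w, IsWeakDeriv (fullDir d) (strip d bm bp) α u w ∧
      LpLoc (ENNReal.ofReal p) ((strip d bm bp).indicator w) := by
  have hpq := Real.HolderConjugate.conjExponent hp
  have hp1 : 1 ≤ ENNReal.ofReal p := by simpa using hp.le
  induction k generalizing α with
  | zero =>
    obtain ⟨g, hg, hg2⟩ := hu.2 α (by simpa using hα)
    refine ⟨g, hg, fun K hK => ?_⟩
    exact ((memLp_indicator_iff_restrict measurableSet_strip).2 hg2).restrict K
  | succ k ih =>
    have hsucc : ∀ i, ∑ j, (α + Pi.single i 1 : Fin (d + 1) → ℕ) j = m - k := by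
      intro i
      rw [sum_add_single, hα]; omega
    choose g hg hgL using fun i => ih (by omega) (α + Pi.single i 1) (hsucc i)
    -- `T` is the distribution `∂^α u`. Its first derivatives are the `∂^{α + e_i} u`, which are
    -- functions by the induction hypothesis, the induction running downwards in the order.
    set T : (Full d → ℝ) → ℝ := fun φ =>
      (-1) ^ (∑ i, α i) * ∫ x in strip d bm bp, u x * partialDeriv (fullDir d) α φ x with hTdef
    have hadd : ∀ φ ψ, IsTest (strip d bm bp) φ → IsTest (strip d bm bp) ψ →
        T (φ + ψ) = T φ + T ψ := by
      intro φ ψ hφ hψ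
      simp only [hTdef]
      rw [partialDeriv_add _ _ hφ.1 hψ.1, ← mul_add, ← integral_add]
      · simp only [Pi.add_apply, mul_add]
      · exact (integrable_mul_of_tsupport_subset hu.1 (hφ.partialDeriv _ α).1.continuous
          (hφ.partialDeriv _ α).2 (hφ.partialDeriv _ α).3).integrableOn
      · exact (integrable_mul_of_tsupport_subset hu.1 (hψ.partialDeriv _ α).1.continuous
          (hψ.partialDeriv _ α).2 (hψ.partialDeriv _ α).3).integrableOn
    have hsmul : ∀ (r : ℝ) φ, IsTest (strip d bm bp) φ → T (r • φ) = r * T φ := by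
      intro r φ hφ
      simp only [hTdef]
      rw [partialDeriv_smul _ _ _ hφ.1, mul_left_comm r]
      congr 1
      rw [← integral_const_mul]
      congr 1; funext x
      simp only [Pi.smul_apply, smul_eq_mul]; ring
    have hder : ∀ i φ, IsTest (strip d bm bp) φ → T (dirDeriv (fullDir d i) φ) =
        - ∫ x, (strip d bm bp).indicator (g i) x * φ x := by
      intro i φ hφ
      simp only [hTdef]
      have := (hg i).integral_eq_of_isTest hφ
      rw [partialDeriv_add_single _ _ _ hφ.1, ← partialDeriv_dirDeriv _ _ hφ.1,
        sum_add_single] at this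
      rw [this, hφ.integral_indicator_mul, hφ.setIntegral_mul, pow_succ, ← mul_assoc, ← mul_assoc,
        ← mul_pow]
      simp
    obtain ⟨w, hw, hTw⟩ := (boxCoords_strip (d := d) hb).exists_represents hpq hadd hsmul hgL hder
    have hwl := hw.locallyIntegrable hp1
    refine ⟨w, ⟨hu.1, hwl.locallyIntegrableOn _, fun φ h1 h2 h3 => ?_⟩,
      fun K hK => (hw K hK).indicator measurableSet_strip⟩
    have hφ : IsTest (strip d bm bp) φ := ⟨h1, h2, h3⟩
    rw [hφ.setIntegral_mul w, ← hTw φ hφ, hTdef, ← mul_assoc, ← mul_pow]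
    simp

theorem isWeakDeriv_stripDeriv (hb : bm < bp) {p : ℝ} (hp : 1 < p) {m : ℕ} {u : Full d → ℝ}
    (hu : MemHomSobolev (fullDir d) (strip d bm bp) m p u)
    (α : Fin (d + 1) → ℕ) (hα : ∑ i, α i ≤ m) :
    IsWeakDeriv (fullDir d) (strip d bm bp) α u (stripDeriv bm bp α u) ∧
      LpLoc (ENNReal.ofReal p) ((strip d bm bp).indicator (stripDeriv bm bp α u)) := by
  obtain ⟨w, hw, hwL⟩ := exists_isWeakDeriv hb hp hu (m - ∑ i, α i) (by omega) α (by omega)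
  refine ⟨hw.weakDeriv, fun K hK => (hwL K hK).ae_eq ?_⟩
  have := hw.weakDeriv_ae_eq isOpen_strip
  exact ae_restrict_of_ae ((ae_eq_restrict_iff_indicator_ae_eq measurableSet_strip).1 this.symm)

theorem volume_preimage_snd_singleton (b : ℝ) :
    volume {x : Full d | x.2 = b} = 0 := by
  have : {x : Full d | x.2 = b} = univ ×ˢ {b} := by ext; simp
  rw [this, Measure.volume_eq_prod, Measure.prod_prod]
  simp

theorem closure_strip_ae_eq : (closure (strip d bm bp) : Set (Full d)) =ᵐ[volume] strip d bm bp := by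
  refine Filter.EventuallyLE.antisymm ?_ (LE.le.eventuallyLE subset_closure)
  have h1 : ∀ᵐ x : Full d, x.2 ≠ bm := by
    rw [ae_iff]; simpa using volume_preimage_snd_singleton bm
  have h2 : ∀ᵐ x : Full d, x.2 ≠ bp := by
    rw [ae_iff]; simpa using volume_preimage_snd_singleton bp
  have hcl : closure (strip d bm bp) ⊆ {x | bm ≤ x.2 ∧ x.2 ≤ bp} :=
    closure_minimal (fun x hx => ⟨hx.1.le, hx.2.le⟩)
      ((isClosed_le continuous_const continuous_snd).inter
        (isClosed_le continuous_snd continuous_const))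
  filter_upwards [h1, h2] with x hx1 hx2 hx
  have := hcl hx
  exact ⟨lt_of_le_of_ne this.1 hx1.symm, lt_of_le_of_ne this.2 hx2⟩

theorem LpLoc.locallyIntegrableOn_closure_strip {p : ℝ≥0∞} (hp : 1 ≤ p) {v : Full d → ℝ}
    (hv : LpLoc p ((strip d bm bp).indicator v)) :
    LocallyIntegrableOn v (closure (strip d bm bp)) := by
  refine ((hv.locallyIntegrable hp).locallyIntegrableOn _).congr ?_
  rw [Measure.restrict_congr_set closure_strip_ae_eq]
  filter_upwards [ae_restrict_mem measurableSet_strip] with x hx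
  rw [indicator_of_mem hx]

/-- Local integrability up to the boundary, as in the definition of the trace, is used from here on
through the extension by zero. -/
theorem locallyIntegrable_indicator_of_closure {v : Full d → ℝ}
    (hv : LocallyIntegrableOn v (closure (strip d bm bp))) :
    LocallyIntegrable ((strip d bm bp).indicator v) := by
  rw [locallyIntegrable_iff]
  intro K hK
  have h1 : IntegrableOn v (closure (strip d bm bp) ∩ K) :=
    hv.integrableOn_compact_subset inter_subset_left (hK.inter_left isClosed_closure)
  rw [IntegrableOn, integrable_indicator_iff measurableSet_strip, IntegrableOn,
    Measure.restrict_restrict measurableSet_strip]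
  exact h1.mono_set (inter_subset_inter_left _ subset_closure)

end Strip

/-! ### Testing weak derivatives with `C¹` functions -/

section Mollification

variable {V : Type*} [NormedAddCommGroup V] [NormedSpace ℝ V] [MeasureSpace V] [BorelSpace V]
  [FiniteDimensional ℝ V] [(volume : Measure V).IsAddHaarMeasure]

theorem tendsto_setIntegral_mul_of_bounded {U K : Set V} (hK : IsCompact K)
    (hKU : K ⊆ U) {v : V → ℝ} (hv : LocallyIntegrableOn v U) {f : ℕ → V → ℝ} {f₀ : V → ℝ} {B : ℝ}
    (hf : ∀ n, Continuous (f n)) (hB : ∀ n x, |f n x| ≤ B) (hs : ∀ n x, x ∉ K → f n x = 0)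
    (hlim : ∀ x, Filter.Tendsto (fun n => f n x) Filter.atTop (nhds (f₀ x))) :
    Filter.Tendsto (fun n => ∫ x in U, v x * f n x) Filter.atTop
      (nhds (∫ x in U, v x * f₀ x)) := by
  have hi : IntegrableOn v K := hv.integrableOn_compact_subset hKU hK
  refine tendsto_integral_of_dominated_convergence (fun x => K.indicator (fun x => |v x| * B) x)
    (fun n => ?_) ?_ (fun n => ?_) ?_
  · exact hv.aestronglyMeasurable.mul (hf n).aestronglyMeasurable
  · exact ((integrable_indicator_iff hK.measurableSet).2 (hi.abs.mul_const B)).integrableOn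
  · refine ae_of_all _ fun x => ?_
    by_cases hx : x ∈ K
    · rw [indicator_of_mem hx, norm_mul]
      exact mul_le_mul_of_nonneg_left (hB n x) (norm_nonneg _)
    · rw [indicator_of_notMem hx, hs n x hx]; simp
  · exact ae_of_all _ fun x => (hlim x).const_mul _

/-- First order weak derivatives may be tested with `C¹` functions. -/
theorem IsWeakDeriv.integral_single_eq_of_contDiff_one {n : ℕ} {e : Fin n → V} {U : Set V}
    (hU : IsOpen U) {v g : V → ℝ} {i : Fin n} (hg : IsWeakDeriv e U (Pi.single i 1) v g)
    {ψ : V → ℝ} (hψ : ContDiff ℝ 1 ψ) (hψc : HasCompactSupport ψ) (hψU : tsupport ψ ⊆ U) :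
    ∫ x in U, v x * dirDeriv (e i) ψ x = - ∫ x in U, g x * ψ x := by
  have : ProperSpace V := FiniteDimensional.proper ℝ V
  obtain ⟨δ, hδ, hδU⟩ := IsCompact.exists_cthickening_subset_open hψc hU hψU
  have hK : IsCompact (Metric.cthickening δ (tsupport ψ)) := IsCompact.cthickening hψc
  set K := Metric.cthickening δ (tsupport ψ)
  -- All radii are smaller than `δ`, so every mollification of `ψ` is supported in the fixed compact
  -- set `K ⊆ U`.
  let η : ℕ → ContDiffBump (0 : V) := fun k =>
    { rIn := δ / (k + 2) / 2, rOut := δ / (k + 2), rIn_pos := by positivity,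
      rIn_lt_rOut := half_lt_self (by positivity) }
  have hη : ∀ k, (η k).rOut = δ / (k + 2) := fun k => rfl
  have hηlt : ∀ k, (η k).rOut < δ := by
    intro k
    rw [hη, div_lt_iff₀ (by positivity)]
    have : (0 : ℝ) ≤ k := k.cast_nonneg
    nlinarith
  have hηlim : Filter.Tendsto (fun k => (η k).rOut) Filter.atTop (nhds 0) := by
    simp only [hη]
    refine Filter.Tendsto.div_atTop tendsto_const_nhds ?_
    exact Filter.tendsto_atTop_add_const_right _ _ tendsto_natCast_atTop_atTop
  let M : ℕ → (V → ℝ) → V → ℝ := fun k f =>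
    MeasureTheory.convolution ((η k).normed volume) f (ContinuousLinearMap.lsmul ℝ ℝ) volume
  have hloc : ∀ k, LocallyIntegrable ((η k).normed volume) := fun k =>
    ((η k).contDiff_normed (n := 0)).continuous.locallyIntegrable
  have hMlim : ∀ f, Continuous f → ∀ x,
      Filter.Tendsto (fun k => M k f x) Filter.atTop (nhds (f x)) := fun f hf x =>
    ContDiffBump.convolution_tendsto_right_of_continuous hηlim hf x
  have hMbd : ∀ f, Continuous f → ∀ B, (∀ x, |f x| ≤ B) → ∀ k x, |M k f x| ≤ 3 * B := by
    intro f hf B hB k x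
    have h1 : dist (M k f x) (f x) ≤ 2 * B := by
      refine (η k).dist_normed_convolution_le hf.aestronglyMeasurable fun y _ => ?_
      rw [Real.dist_eq]
      calc |f y - f x| ≤ |f y| + |f x| := abs_sub _ _
        _ ≤ 2 * B := by linarith [hB x, hB y]
    rw [Real.dist_eq] at h1
    calc |M k f x| = |(M k f x - f x) + f x| := by congr 1; ring
      _ ≤ |M k f x - f x| + |f x| := abs_add_le _ _
      _ ≤ _ := by linarith [hB x]
  have hMsupp : ∀ f, Function.support f ⊆ tsupport ψ → ∀ k x, x ∉ K → M k f x = 0 := by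
    intro f hf k x hx
    by_contra hne
    apply hx
    obtain ⟨y, hy, z, hz, rfl⟩ := support_convolution_subset _ (Function.mem_support.2 hne)
    rw [(η k).support_normed_eq, mem_ball_zero_iff] at hy
    refine Metric.mem_cthickening_of_dist_le _ z δ _ (hf hz) ?_
    rw [dist_eq_norm, add_sub_cancel_right]
    exact (hy.trans (hηlt k)).le
  have hψd : Continuous (dirDeriv (e i) ψ) := (hψ.continuous_fderiv (by simp)).clm_apply continuous_const
  have hψdc : HasCompactSupport (dirDeriv (e i) ψ) := hψc.fderiv_apply ℝ (e i)
  have hcd : ∀ k, ContDiff ℝ ∞ (M k ψ) := fun k =>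
    HasCompactSupport.contDiff_convolution_left (n := ⊤) _ (η k).hasCompactSupport_normed
      (η k).contDiff_normed hψ.continuous.locallyIntegrable
  have hder : ∀ k, dirDeriv (e i) (M k ψ) = M k (dirDeriv (e i) ψ) := by
    intro k
    funext x
    have := HasCompactSupport.hasFDerivAt_convolution_right (ContinuousLinearMap.lsmul ℝ ℝ)
      hψc (hloc k) hψ x
    simp only [dirDeriv, M]
    rw [this.fderiv]
    exact convolution_precompR_apply _ (hloc k) (hψc.fderiv ℝ) (hψ.continuous_fderiv (by simp)) x (e i)
  have htest : ∀ k, IsTest U (M k ψ) := by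
    intro k
    have hsub : tsupport (M k ψ) ⊆ K := by
      refine closure_minimal (fun x hx => ?_) hK.isClosed
      by_contra hc
      exact hx (hMsupp ψ subset_closure k x hc)
    exact ⟨hcd k, hK.of_isClosed_subset isClosed_closure hsub, hsub.trans hδU⟩
  obtain ⟨B, hB⟩ := hψc.exists_bound_of_continuous hψ.continuous
  obtain ⟨B', hB'⟩ := hψdc.exists_bound_of_continuous hψd
  have l1 := tendsto_setIntegral_mul_of_bounded hK hδU hg.1
    (f := fun k => M k (dirDeriv (e i) ψ)) (f₀ := dirDeriv (e i) ψ) (B := 3 * B')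
    (fun k => by rw [← hder]; exact (contDiff_dirDeriv (hcd k) _).continuous)
    (hMbd _ hψd B' hB') (hMsupp _ (support_dirDeriv_subset ψ (e i))) (hMlim _ hψd)
  have l2 := tendsto_setIntegral_mul_of_bounded hK hδU hg.2
    (f := fun k => M k ψ) (f₀ := ψ) (B := 3 * B) (fun k => (hcd k).continuous)
    (hMbd _ hψ.continuous B hB) (hMsupp _ subset_closure) (hMlim _ hψ.continuous)
  refine tendsto_nhds_unique l1 (l2.neg.congr fun k => ?_)
  rw [← hder, hg.integral_single_eq (htest k)]

end Mollification

/-! ### Test functions with bounded support in the horizontal directions only -/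

section HorizontalSupport

variable {d : ℕ} {bm bp : ℝ}

/-- The support of `ψ` is bounded in the horizontal directions. -/
def HorSupp (ψ : Full d → ℝ) : Prop := ∃ K : Set (Hor d), IsCompact K ∧ ∀ x, x.1 ∉ K → ψ x = 0

theorem HorSupp.of_hasCompactSupport {ψ : Full d → ℝ} (h : HasCompactSupport ψ) : HorSupp ψ := by
  refine ⟨Prod.fst '' tsupport ψ, IsCompact.image h continuous_fst, fun x hx => ?_⟩
  by_contra hne
  exact hx ⟨x, subset_tsupport _ hne, rfl⟩

theorem HorSupp.mul_right {ψ f : Full d → ℝ} (h : HorSupp ψ) : HorSupp (fun x => ψ x * f x) := by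
  obtain ⟨K, hK, h0⟩ := h
  exact ⟨K, hK, fun x hx => by simp [h0 x hx]⟩

theorem HorSupp.add {ψ f : Full d → ℝ} (h : HorSupp ψ) (h' : HorSupp f) :
    HorSupp (fun x => ψ x + f x) := by
  obtain ⟨K, hK, h0⟩ := h
  obtain ⟨K', hK', h0'⟩ := h'
  exact ⟨K ∪ K', hK.union hK', fun x hx => by
    simp [h0 x (fun h => hx (Or.inl h)), h0' x (fun h => hx (Or.inr h))]⟩

theorem HorSupp.neg {ψ : Full d → ℝ} (h : HorSupp ψ) : HorSupp (fun x => - ψ x) := by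
  obtain ⟨K, hK, h0⟩ := h
  exact ⟨K, hK, fun x hx => by simp [h0 x hx]⟩

theorem HorSupp.sub {ψ f : Full d → ℝ} (h : HorSupp ψ) (h' : HorSupp f) :
    HorSupp (fun x => ψ x - f x) := by
  simpa [sub_eq_add_neg] using h.add h'.neg

theorem HorSupp.dirDeriv {ψ : Full d → ℝ} (h : HorSupp ψ) (v : Full d) :
    HorSupp (dirDeriv v ψ) := by
  obtain ⟨K, hK, h0⟩ := h
  refine ⟨K, hK, fun x hx => ?_⟩
  have : ψ =ᶠ[nhds x] fun _ => 0 := by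
    have ho : IsOpen {y : Full d | y.1 ∉ K} := hK.isClosed.isOpen_compl.preimage continuous_fst
    filter_upwards [ho.mem_nhds hx] with y hy using h0 y hy
  simp [TraceStrip.dirDeriv, this.fderiv_eq]

theorem horSupp_comp_fst {φ : Hor d → ℝ} (h : HasCompactSupport φ) :
    HorSupp (fun x : Full d => φ x.1) :=
  ⟨tsupport φ, h, fun _ hx => image_eq_zero_of_notMem_tsupport hx⟩

theorem HorSupp.exists_bound {ψ : Full d → ℝ} (h : HorSupp ψ) (hc : Continuous ψ) (bm bp : ℝ) :
    ∃ B, ∀ x : Full d, x.2 ∈ Icc bm bp → |ψ x| ≤ B := by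
  obtain ⟨K, hK, h0⟩ := h
  obtain ⟨B, hB⟩ := (hK.prod (isCompact_Icc (a := bm) (b := bp))).exists_bound_of_continuousOn
    hc.continuousOn
  refine ⟨max B 0, fun x hx => ?_⟩
  by_cases hxK : x.1 ∈ K
  · exact (hB x ⟨hxK, hx⟩).trans (le_max_left _ _)
  · rw [h0 x hxK]; simp

theorem HorSupp.integrableOn_strip {ψ v : Full d → ℝ}
    (hv : LocallyIntegrable ((strip d bm bp).indicator v)) (h : HorSupp ψ) (hc : Continuous ψ) :
    IntegrableOn (fun x => v x * ψ x) (strip d bm bp) := by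
  obtain ⟨B, hB⟩ := h.exists_bound hc bm bp
  obtain ⟨K, hK, h0⟩ := h
  have hKI : IsCompact (K ×ˢ Icc bm bp) := hK.prod isCompact_Icc
  have h1 : IntegrableOn v (strip d bm bp ∩ K ×ˢ Icc bm bp) := by
    have := hv.integrableOn_isCompact hKI
    rw [IntegrableOn, integrable_indicator_iff measurableSet_strip, IntegrableOn,
      Measure.restrict_restrict measurableSet_strip] at this
    exact this
  have h2 : IntegrableOn (fun x => v x * ψ x) (strip d bm bp ∩ K ×ˢ Icc bm bp) := by
    refine Integrable.mul_bdd (c := B) h1 hc.aestronglyMeasurable ?_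
    filter_upwards [ae_restrict_mem (measurableSet_strip.inter hKI.measurableSet)] with x hx
    exact hB x hx.2.2
  refine h2.of_forall_sdiff_eq_zero measurableSet_strip fun x hx => ?_
  have : x.1 ∉ K := fun hxK => hx.2 ⟨hx.1, hxK, hx.1.1.le, hx.1.2.le⟩
  rw [h0 x this, mul_zero]

end HorizontalSupport

/-! ### Integration by parts for test functions vanishing on the boundary -/

section BoundaryCutoff

variable {d : ℕ} {bm bp : ℝ}

theorem dirDeriv_mul_comp_snd {ψ : Full d → ℝ} (hψ : Differentiable ℝ ψ) {χ : ℝ → ℝ}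
    (hχ : Differentiable ℝ χ) (v x : Full d) :
    dirDeriv v (fun x => ψ x * χ x.2) x = dirDeriv v ψ x * χ x.2 + ψ x * (deriv χ x.2 * v.2) := by
  have h1 := (hψ x).hasFDerivAt
  have h2 : HasFDerivAt (fun x : Full d => χ x.2)
      (deriv χ x.2 • ContinuousLinearMap.snd ℝ (Hor d) ℝ) x :=
    (hχ x.2).hasDerivAt.comp_hasFDerivAt x hasFDerivAt_snd
  have h3 : HasFDerivAt (fun x : Full d => ψ x * χ x.2) _ x := h1.mul h2
  unfold dirDeriv
  rw [h3.fderiv]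
  simp
  ring

theorem dirDeriv_comp_fst {φ : Hor d → ℝ} (hφ : Differentiable ℝ φ) (v x : Full d) :
    dirDeriv v (fun x : Full d => φ x.1) x = dirDeriv v.1 φ x.1 := by
  have h2 : HasFDerivAt (fun x : Full d => φ x.1)
      ((fderiv ℝ φ x.1).comp (ContinuousLinearMap.fst ℝ (Hor d) ℝ)) x :=
    (hφ x.1).hasFDerivAt.comp x hasFDerivAt_fst
  unfold dirDeriv
  rw [h2.fderiv]
  simp

theorem ContDiff.continuous_dirDeriv {ψ : Full d → ℝ} (hψ : ContDiff ℝ 1 ψ) (v : Full d) :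
    Continuous (dirDeriv v ψ) :=
  (hψ.continuous_fderiv (by simp)).clm_apply continuous_const

theorem hasDerivAt_vertical {ψ : Full d → ℝ} (hψ : Differentiable ℝ ψ) (x' : Hor d) (s : ℝ) :
    HasDerivAt (fun s => ψ (x', s)) (dirDeriv (0, 1) ψ (x', s)) s := by
  have h1 : HasDerivAt (fun s : ℝ => (x', s)) ((0 : Hor d), (1 : ℝ)) s :=
    (hasDerivAt_const s x').prodMk (hasDerivAt_id s)
  exact (hψ (x', s)).hasFDerivAt.comp_hasDerivAt s h1

/-- `Θ'` vanishes beyond `2`. Applied with `t` equal to `n + 1` times the distance to the boundary,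
this absorbs the factor `n + 1` from differentiating the cutoff. -/
theorem IsStep.abs_mul_deriv_le {Θ : ℝ → ℝ} (h : IsStep Θ 1 2) {C : ℝ}
    (hC : ∀ t, |deriv Θ t| ≤ C) {t : ℝ} : t * |deriv Θ t| ≤ 2 * C := by
  have hC0 : 0 ≤ C := (abs_nonneg _).trans (hC 0)
  by_cases h2 : 2 < t
  · rw [h.deriv_eq_zero_of_gt h2]; simpa using hC0
  · exact mul_le_mul (not_lt.1 h2) (hC t) (abs_nonneg _) (by norm_num)

/-- The integration by parts formula without boundary terms, for test functions which in the
normal direction vanish on the boundary of the strip. -/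
theorem IsWeakDeriv.integral_strip_eq {v g : Full d → ℝ} {i : Fin (d + 1)}
    (hw : IsWeakDeriv (fullDir d) (strip d bm bp) (Pi.single i 1) v g)
    (hv : LocallyIntegrable ((strip d bm bp).indicator v))
    (hg : LocallyIntegrable ((strip d bm bp).indicator g))
    {ψ : Full d → ℝ} (hψ : ContDiff ℝ 1 ψ) (hψs : HorSupp ψ)
    (hbd : i = Fin.last d → ∀ x', ψ (x', bm) = 0 ∧ ψ (x', bp) = 0) :
    ∫ x in strip d bm bp, v x * dirDeriv (fullDir d i) ψ x =
      - ∫ x in strip d bm bp, g x * ψ x := by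
  obtain ⟨Θ, hΘ⟩ := exists_isStep (show (1 : ℝ) < 2 by norm_num)
  obtain ⟨C, hC⟩ := hΘ.exists_deriv_bound
  have hC0 : 0 ≤ C := (abs_nonneg _).trans (hC 0)
  have hΘd : Differentiable ℝ Θ := hΘ.contDiff.differentiable (by simp)
  have hψd : Differentiable ℝ ψ := hψ.differentiable (by simp)
  -- A cutoff supported away from both boundary components, equal to `1` at distance at least `2 /
  -- (n + 1)` from them.
  let χ : ℕ → ℝ → ℝ := fun n s => Θ ((n + 1) * (s - bm)) * Θ ((n + 1) * (bp - s))
  have hχ : ∀ n, ContDiff ℝ ∞ (χ n) := fun n =>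
    (hΘ.contDiff.comp (by fun_prop)).mul (hΘ.contDiff.comp (by fun_prop))
  have hχd : ∀ n, Differentiable ℝ (χ n) := fun n => (hχ n).differentiable (by simp)
  have hχ' : ∀ n s, deriv (χ n) s =
      (n + 1) * deriv Θ ((n + 1) * (s - bm)) * Θ ((n + 1) * (bp - s)) -
        Θ ((n + 1) * (s - bm)) * ((n + 1) * deriv Θ ((n + 1) * (bp - s))) := by
    intro n s
    have a1 : HasDerivAt (fun s : ℝ => ((n : ℝ) + 1) * (s - bm)) ((n : ℝ) + 1) s := by
      simpa using ((hasDerivAt_id s).sub_const bm).const_mul ((n : ℝ) + 1)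
    have a2 : HasDerivAt (fun s : ℝ => ((n : ℝ) + 1) * (bp - s)) (-((n : ℝ) + 1)) s := by
      simpa using ((hasDerivAt_id s).const_sub bp).const_mul ((n : ℝ) + 1)
    have b1 := (hΘd _).hasDerivAt.comp s a1
    have b2 := (hΘd _).hasDerivAt.comp s a2
    have := (b1.mul b2).deriv
    simp only [χ]
    refine Eq.trans this ?_
    simp only [Function.comp]
    ring
  have hχ1 : ∀ n s, |χ n s| ≤ 1 := by
    intro n s
    rw [abs_mul, abs_of_nonneg (hΘ.nonneg _), abs_of_nonneg (hΘ.nonneg _)]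
    exact mul_le_one₀ (hΘ.le_one _) (hΘ.nonneg _) (hΘ.le_one _)
  have hev : ∀ s ∈ Ioo bm bp, ∀ᶠ n : ℕ in Filter.atTop,
      2 < ((n : ℝ) + 1) * (s - bm) ∧ 2 < ((n : ℝ) + 1) * (bp - s) := by
    intro s hs
    have t1 : ∀ r : ℝ, 0 < r → ∀ᶠ n : ℕ in Filter.atTop, 2 < ((n : ℝ) + 1) * r := fun r hr =>
      (((Filter.tendsto_atTop_add_const_right _ 1 tendsto_natCast_atTop_atTop).atTop_mul_const
        hr).eventually_gt_atTop 2)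
    exact (t1 _ (by linarith [hs.1])).and (t1 _ (by linarith [hs.2]))
  have hχlim : ∀ s ∈ Ioo bm bp, ∀ᶠ n : ℕ in Filter.atTop, χ n s = 1 ∧ deriv (χ n) s = 0 := by
    intro s hs
    filter_upwards [hev s hs] with n hn
    refine ⟨?_, ?_⟩
    · simp only [χ]
      rw [hΘ.eq_one _ hn.1.le, hΘ.eq_one _ hn.2.le, mul_one]
    · rw [hχ', hΘ.deriv_eq_zero_of_gt hn.1, hΘ.deriv_eq_zero_of_gt hn.2]; ring
  have hcut : ∀ n, ∫ x in strip d bm bp, v x * dirDeriv (fullDir d i) (fun x => ψ x * χ n x.2) x =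
      - ∫ x in strip d bm bp, g x * (ψ x * χ n x.2) := by
    intro n
    obtain ⟨K, hK, hK0⟩ := hψs
    have hn : (0 : ℝ) < (n : ℝ) + 1 := by positivity
    set S : Set (Full d) := K ×ˢ Icc (bm + 1 / ((n : ℝ) + 1)) (bp - 1 / ((n : ℝ) + 1))
    have hS : IsCompact S := hK.prod isCompact_Icc
    have hsub : tsupport (fun x : Full d => ψ x * χ n x.2) ⊆ S := by
      refine closure_minimal (fun x hx => ?_) hS.isClosed
      rw [Function.mem_support] at hx
      refine ⟨?_, ?_, ?_⟩
      · by_contra hc; exact hx (by simp [hK0 x hc])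
      · by_contra hc
        apply hx
        have : ((n : ℝ) + 1) * (x.2 - bm) ≤ 1 := by
          rw [not_le, ← sub_lt_iff_lt_add', lt_div_iff₀ hn] at hc
          linarith
        simp [χ, hΘ.eq_zero _ this]
      · by_contra hc
        apply hx
        have : ((n : ℝ) + 1) * (bp - x.2) ≤ 1 := by
          rw [not_le, sub_lt_comm, lt_div_iff₀ hn] at hc
          linarith
        simp [χ, hΘ.eq_zero _ this]
    refine hw.integral_single_eq_of_contDiff_one isOpen_strip ?_
      (hS.of_isClosed_subset isClosed_closure hsub) (hsub.trans ?_)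
    · exact hψ.mul (((hχ n).of_le (by simp)).comp contDiff_snd)
    · rintro x ⟨-, hx1, hx2⟩
      have : 0 < 1 / ((n : ℝ) + 1) := by positivity
      exact ⟨by linarith, by linarith⟩
  have l2 : Filter.Tendsto (fun n => ∫ x in strip d bm bp, g x * (ψ x * χ n x.2)) Filter.atTop
      (nhds (∫ x in strip d bm bp, g x * ψ x)) := by
    have hi := hψs.integrableOn_strip hg hψ.continuous
    refine tendsto_integral_of_dominated_convergence (fun x => |g x * ψ x|) (fun n => ?_)
      hi.abs (fun n => ?_) ?_
    · have := hi.1.mul (((hχ n).continuous.comp continuous_snd).aestronglyMeasurable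
        (μ := volume.restrict (strip d bm bp)))
      refine this.congr (ae_of_all _ fun x => ?_)
      simp [mul_assoc]
    · refine ae_of_all _ fun x => ?_
      rw [← mul_assoc, norm_mul, Real.norm_eq_abs]
      exact mul_le_of_le_one_right (abs_nonneg _) (hχ1 n _)
    · filter_upwards [ae_restrict_mem measurableSet_strip] with x hx
      refine tendsto_const_nhds.congr' ?_
      filter_upwards [hχlim x.2 hx] with n hn
      rw [hn.1, mul_one]
  have hψd' := ContDiff.continuous_dirDeriv hψ
  obtain ⟨B, hB⟩ := (hψs.dirDeriv (0, 1)).exists_bound (hψd' (0, 1)) bm bp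
  have hB0 : ∀ x ∈ strip d bm bp, 0 ≤ B := fun x hx =>
    (abs_nonneg _).trans (hB x ⟨hx.1.le, hx.2.le⟩)
  have hmv : ∀ x' : Hor d, ∀ s ∈ Icc bm bp, ∀ t ∈ Icc bm bp, |ψ (x', s) - ψ (x', t)| ≤ B * |s - t| := by
    intro x' s hs t ht
    exact (convex_Icc bm bp).norm_image_sub_le_of_norm_hasDerivWithin_le
      (fun r hr => (hasDerivAt_vertical hψd x' r).hasDerivWithinAt)
      (fun r hr => hB (x', r) hr) ht hs
  -- The mean value theorem bounds `|ψ|` by `B` times the distance to either component, while `χ_n'`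
  -- is of size `n + 1` in layers of width comparable to `1 / (n + 1)`. The product stays bounded,
  -- each component contributing `2 * B * C`.
  have hbound : i = Fin.last d → ∀ n, ∀ x ∈ strip d bm bp,
      |ψ x * deriv (χ n) x.2| ≤ 4 * B * C := by
    intro hi n x hx
    have hn : (0 : ℝ) < (n : ℝ) + 1 := by positivity
    have hs : x.2 ∈ Icc bm bp := ⟨hx.1.le, hx.2.le⟩
    have hle : bm ≤ bp := hs.1.trans hs.2
    have e1 : |ψ x| ≤ B * (x.2 - bm) := by
      have := hmv x.1 x.2 hs bm (left_mem_Icc.2 hle)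
      rwa [(hbd hi x.1).1, sub_zero, abs_of_pos (sub_pos.2 hx.1)] at this
    have e2 : |ψ x| ≤ B * (bp - x.2) := by
      have := hmv x.1 x.2 hs bp (right_mem_Icc.2 hle)
      rwa [(hbd hi x.1).2, sub_zero, abs_sub_comm, abs_of_pos (sub_pos.2 hx.2)] at this
    have f1 := hΘ.abs_mul_deriv_le hC (t := ((n : ℝ) + 1) * (x.2 - bm))
    have f2 := hΘ.abs_mul_deriv_le hC (t := ((n : ℝ) + 1) * (bp - x.2))
    have b0 := hB0 x hx
    rw [hχ', mul_sub]
    set D1 := deriv Θ (((n : ℝ) + 1) * (x.2 - bm))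
    set D2 := deriv Θ (((n : ℝ) + 1) * (bp - x.2))
    set T1 := Θ (((n : ℝ) + 1) * (x.2 - bm))
    set T2 := Θ (((n : ℝ) + 1) * (bp - x.2))
    have hT1 : |T1| ≤ 1 := by rw [abs_of_nonneg (hΘ.nonneg _)]; exact hΘ.le_one _
    have hT2 : |T2| ≤ 1 := by rw [abs_of_nonneg (hΘ.nonneg _)]; exact hΘ.le_one _
    have g1 : |ψ x * (((n : ℝ) + 1) * D1 * T2)| ≤ 2 * B * C := by
      calc |ψ x * (((n : ℝ) + 1) * D1 * T2)| = |ψ x| * (((n : ℝ) + 1) * |D1|) * |T2| := by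
            rw [abs_mul, abs_mul, abs_mul, abs_of_pos hn]; ring
        _ ≤ |ψ x| * (((n : ℝ) + 1) * |D1|) := mul_le_of_le_one_right (by positivity) hT2
        _ ≤ B * (x.2 - bm) * (((n : ℝ) + 1) * |D1|) := by gcongr
        _ = B * (((n : ℝ) + 1) * (x.2 - bm) * |D1|) := by ring
        _ ≤ B * (2 * C) := by gcongr
        _ = _ := by ring
    have g2 : |ψ x * (T1 * (((n : ℝ) + 1) * D2))| ≤ 2 * B * C := by
      calc |ψ x * (T1 * (((n : ℝ) + 1) * D2))| = |ψ x| * (((n : ℝ) + 1) * |D2|) * |T1| := by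
            rw [abs_mul, abs_mul, abs_mul, abs_of_pos hn]; ring
        _ ≤ |ψ x| * (((n : ℝ) + 1) * |D2|) := mul_le_of_le_one_right (by positivity) hT1
        _ ≤ B * (bp - x.2) * (((n : ℝ) + 1) * |D2|) := by gcongr
        _ = B * (((n : ℝ) + 1) * (bp - x.2) * |D2|) := by ring
        _ ≤ B * (2 * C) := by gcongr
        _ = _ := by ring
    calc _ ≤ _ := abs_sub _ _
      _ ≤ 4 * B * C := by linarith
  have l1 : Filter.Tendsto
      (fun n => ∫ x in strip d bm bp, v x * dirDeriv (fullDir d i) (fun x => ψ x * χ n x.2) x)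
      Filter.atTop (nhds (∫ x in strip d bm bp, v x * dirDeriv (fullDir d i) ψ x)) := by
    obtain ⟨K, hK, hK0⟩ := id hψs
    -- `ρ` localises the constant bound horizontally, so that the majorant `4 * B * C * |v ρ|` is
    -- integrable.
    obtain ⟨ρ, hρ1, hρc, -, hρ⟩ : ∃ ρ : Hor d → ℝ, (∀ x ∈ K, ρ x = 1) ∧ HasCompactSupport ρ ∧
        True ∧ Continuous ρ := by
      obtain ⟨f, hf1, -, hf2, -⟩ := exists_continuous_one_zero_of_isCompact hK
        (isClosed_empty (X := Hor d)) (by simp)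
      exact ⟨f, hf1, hf2, trivial, f.continuous⟩
    have hi := (hψs.dirDeriv (fullDir d i)).integrableOn_strip hv (hψd' (fullDir d i))
    have hi2 := (horSupp_comp_fst hρc).integrableOn_strip hv (hρ.comp continuous_fst)
    refine tendsto_integral_of_dominated_convergence
      (fun x => |v x * dirDeriv (fullDir d i) ψ x| + 4 * B * C * |v x * ρ x.1|) (fun n => ?_)
      (hi.abs.add (hi2.abs.const_mul _)) (fun n => ?_) ?_
    · refine hw.1.aestronglyMeasurable.mul (Continuous.aestronglyMeasurable ?_)
      exact ContDiff.continuous_dirDeriv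
        (hψ.mul (((hχ n).of_le (by simp)).comp contDiff_snd)) _
    · filter_upwards [ae_restrict_mem measurableSet_strip] with x hx
      rw [dirDeriv_mul_comp_snd hψd (hχd n), mul_add]
      refine (norm_add_le _ _).trans (add_le_add ?_ ?_)
      · rw [← mul_assoc, norm_mul, Real.norm_eq_abs]
        exact mul_le_of_le_one_right (abs_nonneg _) (hχ1 n _)
      · have b0 := hB0 x hx
        by_cases hxK : x.1 ∈ K
        · by_cases hi : i = Fin.last d
          · subst hi
            simp only [fullDir_last, mul_one, norm_mul]
            rw [hρ1 _ hxK, mul_one, mul_comm (4 * B * C), ← norm_mul (ψ x)]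
            exact mul_le_mul_of_nonneg_left (hbound rfl n x hx) (abs_nonneg _)
          · obtain ⟨j, rfl⟩ := Fin.exists_castSucc_eq.2 hi
            simp only [fullDir_castSucc, mul_zero, norm_zero]
            positivity
        · rw [hK0 x hxK]
          simp only [zero_mul, mul_zero, norm_zero]
          positivity
    · filter_upwards [ae_restrict_mem measurableSet_strip] with x hx
      refine tendsto_const_nhds.congr' ?_
      filter_upwards [hχlim x.2 hx] with n hn
      rw [dirDeriv_mul_comp_snd hψd (hχd n), hn.1, hn.2]
      simp
  exact tendsto_nhds_unique l1 (l2.neg.congr fun n => (hcut n).symm)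

end BoundaryCutoff

/-! ### Construction of the trace -/

section TraceExistence

variable {d : ℕ} {bm bp : ℝ}

theorem strip_eq_prod : strip d bm bp = univ ×ˢ Ioo bm bp := by
  ext x; simp [mem_strip]

theorem setIntegral_strip {F : Full d → ℝ} (hF : IntegrableOn F (strip d bm bp)) :
    ∫ x in strip d bm bp, F x = ∫ x' : Hor d, ∫ t in Ioo bm bp, F (x', t) := by
  rw [strip_eq_prod, Measure.volume_eq_prod] at *
  rw [setIntegral_prod _ hF, Measure.restrict_univ]

theorem LpLoc.mul_continuous {p : ℝ≥0∞} {h f : Full d → ℝ} (hh : LpLoc p h) (hf : Continuous f) :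
    LpLoc p (fun x => h x * f x) := by
  intro K hK
  obtain ⟨C, hC⟩ := hK.exists_bound_of_continuousOn hf.continuousOn
  refine MemLp.of_le_mul (c := C) (hh K hK) ((hh K hK).1.mul hf.aestronglyMeasurable) ?_
  filter_upwards [ae_restrict_mem hK.measurableSet] with x hx
  rw [norm_mul, mul_comm]
  exact mul_le_mul_of_nonneg_right (hC x hx) (norm_nonneg _)

theorem lpLoc_vertical_integral {p q : ℝ} (hpq : p.HolderConjugate q) {h : Full d → ℝ}
    (hh : LpLoc (ENNReal.ofReal p) ((strip d bm bp).indicator h)) :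
    LpLoc (ENNReal.ofReal p) (fun x' : Hor d => ∫ t in Ioo bm bp, h (x', t)) := by
  intro K hK
  have h1 := hh (K ×ˢ Icc bm bp) (hK.prod isCompact_Icc)
  rw [Measure.volume_eq_prod, ← Measure.prod_restrict] at h1
  have : IsFiniteMeasure ((volume : Measure ℝ).restrict (Icc bm bp)) :=
    ⟨by rw [Measure.restrict_apply_univ]; exact isCompact_Icc.measure_lt_top⟩
  have h2 := memLp_integral_right hpq h1
  refine h2.ae_eq (ae_of_all _ fun x' => ?_)
  simp only
  rw [← integral_indicator measurableSet_Icc, ← integral_indicator measurableSet_Ioo]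
  congr 1; funext t
  have hiff : (x', t) ∈ strip d bm bp ↔ t ∈ Ioo bm bp := Iff.rfl
  by_cases ht : t ∈ Ioo bm bp
  · simp [hiff, ht, Ioo_subset_Icc_self ht]
  · simp [indicator_apply, hiff, ht]

theorem dirDeriv_last_fst_mul_snd {φ : Hor d → ℝ} (hφ : Differentiable ℝ φ) {χ : ℝ → ℝ}
    (hχ : Differentiable ℝ χ) (x : Full d) :
    dirDeriv (fullDir d (Fin.last d)) (fun x : Full d => φ x.1 * χ x.2) x =
      φ x.1 * deriv χ x.2 := by
  rw [dirDeriv_mul_comp_snd (ψ := fun x : Full d => φ x.1) (hφ.comp differentiable_fst) hχ,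
    dirDeriv_comp_fst hφ]
  simp [dirDeriv]

theorem dirDeriv_castSucc_fst_mul_snd {φ : Hor d → ℝ} (hφ : Differentiable ℝ φ) {χ : ℝ → ℝ}
    (hχ : Differentiable ℝ χ) (j : Fin d) (x : Full d) :
    dirDeriv (fullDir d j.castSucc) (fun x : Full d => φ x.1 * χ x.2) x =
      dirDeriv (horDir d j) φ x.1 * χ x.2 := by
  rw [dirDeriv_mul_comp_snd (ψ := fun x : Full d => φ x.1) (hφ.comp differentiable_fst) hχ,
    dirDeriv_comp_fst hφ]
  simp

theorem HorSupp.slice {ψ : Full d → ℝ} (h : HorSupp ψ) (b : ℝ) :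
    HasCompactSupport (fun x' => ψ (x', b)) := by
  obtain ⟨K, hK, h0⟩ := h
  exact HasCompactSupport.intro hK fun x' hx' => h0 (x', b) hx'

theorem dirDeriv_sub_apply {V : Type*} [NormedAddCommGroup V] [NormedSpace ℝ V] {f g : V → ℝ}
    (hf : Differentiable ℝ f) (hg : Differentiable ℝ g) (v x : V) :
    dirDeriv v (fun x => f x - g x) x = dirDeriv v f x - dirDeriv v g x := by
  unfold dirDeriv
  rw [fderiv_fun_sub (hf x) (hg x)]
  rfl

/-- For smooth `v` the fundamental theorem of calculus gives `v(·, b⁺) = ∫ (v Θ)' dt` and `v(·, b⁺)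
- v(·, b⁻) = ∫ ∂_N v dt`; the right-hand sides serve as the definition. They are in `L^p_loc`
because fibre integration over a bounded interval preserves it. -/
theorem exists_isStripTrace (hb : bm < bp) {p : ℝ} (hp : 1 < p) {v : Full d → ℝ}
    (hw : ∀ i, IsWeakDeriv (fullDir d) (strip d bm bp) (Pi.single i 1) v
      (stripDeriv bm bp (Pi.single i 1) v))
    (hvL : LpLoc (ENNReal.ofReal p) ((strip d bm bp).indicator v))
    (hgL : ∀ i, LpLoc (ENNReal.ofReal p)
      ((strip d bm bp).indicator (stripDeriv bm bp (Pi.single i 1) v))) :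
    IsStripTrace bm bp p v (trace bm bp p v) := by
  suffices hex : ∃ f, IsStripTrace bm bp p v f by
    rw [trace, dif_pos hex]
    exact hex.choose_spec
  have hpq := Real.HolderConjugate.conjExponent hp
  have hp1 : 1 ≤ ENNReal.ofReal p := by simpa using hp.le
  have hv := hvL.locallyIntegrable hp1
  have hgl := fun i => (hgL i).locallyIntegrable hp1
  set g := stripDeriv bm bp (Pi.single (Fin.last d) 1) v with hgdef
  have hg : LocallyIntegrable ((strip d bm bp).indicator g) := hgl _
  obtain ⟨Θ, hΘ⟩ := exists_isStep hb
  have hΘc := hΘ.contDiff.continuous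
  have hθc := hΘ.contDiff_deriv.continuous
  have hΘd : Differentiable ℝ Θ := hΘ.contDiff.differentiable (by simp)
  have L1 : LpLoc (ENNReal.ofReal p) (fun x' : Hor d =>
      ∫ t in Ioo bm bp, (v (x', t) * deriv Θ t + g (x', t) * Θ t)) := by
    refine lpLoc_vertical_integral (h := fun x => v x * deriv Θ x.2 + g x * Θ x.2) hpq ?_
    have := (hvL.mul_continuous (hθc.comp continuous_snd)).add
      ((hgL (Fin.last d)).mul_continuous (hΘc.comp continuous_snd))
    convert this using 1
    funext x
    by_cases hx : x ∈ strip d bm bp <;> simp [hx, hgdef]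
  have L2 : LpLoc (ENNReal.ofReal p) (fun x' : Hor d => ∫ t in Ioo bm bp, g (x', t)) :=
    lpLoc_vertical_integral hpq (hgL (Fin.last d))
  refine ⟨(_, _), hw, hvL.locallyIntegrableOn_closure_strip hp1,
    fun i => (hgL i).locallyIntegrableOn_closure_strip hp1, L1.sub L2, L1, fun i ψ hψ hψc => ?_⟩
  have hψs := HorSupp.of_hasCompactSupport hψc
  by_cases hi : i = Fin.last d
  swap
  · rw [if_neg hi, add_zero]
    have := (hw i).integral_strip_eq hv (hgl i) hψ hψs (fun h => absurd h hi)
    simpa only [dirDeriv, mul_comm (ψ _)] using this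
  subst hi
  rw [if_pos rfl]
  simp only
  set φp : Hor d → ℝ := fun x' => ψ (x', bp)
  set φm : Hor d → ℝ := fun x' => ψ (x', bm)
  have hφp : ContDiff ℝ 1 φp := hψ.comp (by fun_prop)
  have hφm : ContDiff ℝ 1 φm := hψ.comp (by fun_prop)
  have sφp : HasCompactSupport φp := hψs.slice bp
  have sφm : HasCompactSupport φm := hψs.slice bm
  set φ : Hor d → ℝ := fun x' => φp x' - φm x' with hφdef
  have hφ : ContDiff ℝ 1 φ := hφp.sub hφm
  have sφ : HasCompactSupport φ := sφp.sub sφm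
  have hφΘ : ContDiff ℝ 1 (fun x : Full d => φ x.1 * Θ x.2) :=
    (hφ.comp contDiff_fst).mul ((hΘ.contDiff.of_le (by simp)).comp contDiff_snd)
  have hφm' : ContDiff ℝ 1 (fun x : Full d => φm x.1) := hφm.comp contDiff_fst
  -- The function `φ(x') Θ(t) + φm(x')`, with `φ = φp - φm`, has the boundary values of `ψ`, so the
  -- difference admits integration by parts without boundary terms.
  have key := (hw (Fin.last d)).integral_strip_eq hv hg
    (ψ := fun x => ψ x - φ x.1 * Θ x.2 - φm x.1) ((hψ.sub hφΘ).sub hφm')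
    ((hψs.sub (horSupp_comp_fst sφ).mul_right).sub (horSupp_comp_fst sφm)) (fun _ x' => by
      constructor
      · simp [φ, φm, φp, hΘ.eq_zero _ le_rfl]
      · simp [φ, φm, φp, hΘ.eq_one _ le_rfl])
  have hder : ∀ x, dirDeriv (fullDir d (Fin.last d)) (fun x => ψ x - φ x.1 * Θ x.2 - φm x.1) x =
      dirDeriv (fullDir d (Fin.last d)) ψ x - φ x.1 * deriv Θ x.2 := by
    intro x
    rw [dirDeriv_sub_apply ((hψ.sub hφΘ).differentiable (by simp)) (hφm'.differentiable (by simp)),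
      dirDeriv_sub_apply (hψ.differentiable (by simp)) (hφΘ.differentiable (by simp)),
      dirDeriv_last_fst_mul_snd (hφ.differentiable (by simp)) hΘd,
      dirDeriv_comp_fst (hφm.differentiable (by simp))]
    simp [dirDeriv]
  simp_rw [hder] at key
  have I1 := (hψs.dirDeriv (fullDir d (Fin.last d))).integrableOn_strip hv
    (ContDiff.continuous_dirDeriv hψ _)
  have I2 := hψs.integrableOn_strip hg hψ.continuous
  have I3 : IntegrableOn (fun x => v x * (φ x.1 * deriv Θ x.2)) (strip d bm bp) :=
    ((horSupp_comp_fst sφ).mul_right (f := fun x => deriv Θ x.2)).integrableOn_strip hv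
      ((hφ.continuous.comp continuous_fst).mul (hθc.comp continuous_snd))
  have I4 : IntegrableOn (fun x => g x * (φ x.1 * Θ x.2)) (strip d bm bp) :=
    ((horSupp_comp_fst sφ).mul_right (f := fun x => Θ x.2)).integrableOn_strip hg hφΘ.continuous
  have I5 : IntegrableOn (fun x => g x * φm x.1) (strip d bm bp) :=
    (horSupp_comp_fst sφm).integrableOn_strip hg hφm'.continuous
  have F1 : ∫ x in strip d bm bp, (v x * (φ x.1 * deriv Θ x.2) + g x * (φ x.1 * Θ x.2)) =
      ∫ x' : Hor d, φ x' * ∫ t in Ioo bm bp, (v (x', t) * deriv Θ t + g (x', t) * Θ t) := by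
    refine (setIntegral_strip (I3.add I4)).trans ?_
    congr 1; funext x'
    rw [← integral_const_mul]
    congr 1; funext t
    simp only [Pi.add_apply]; ring
  have F2 : ∫ x in strip d bm bp, g x * φm x.1 =
      ∫ x' : Hor d, φm x' * ∫ t in Ioo bm bp, g (x', t) := by
    rw [setIntegral_strip I5]
    congr 1; funext x'
    rw [← integral_const_mul]
    congr 1; funext t; ring
  have J : ∀ {f χ : Hor d → ℝ}, LpLoc (ENNReal.ofReal p) f → Continuous χ → HasCompactSupport χ →
      Integrable (fun x' => χ x' * f x') := by
    intro f χ hf hχ hs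
    have := integrable_mul_of_tsupport_subset
      ((hf.locallyIntegrable hp1).locallyIntegrableOn univ) hχ hs (subset_univ _)
    simpa only [mul_comm] using this
  simp only [mul_sub] at key
  have K1 : ∫ x in strip d bm bp, (v x * dirDeriv (fullDir d (Fin.last d)) ψ x -
      v x * (φ x.1 * deriv Θ x.2)) =
      (∫ x in strip d bm bp, v x * dirDeriv (fullDir d (Fin.last d)) ψ x) -
      ∫ x in strip d bm bp, v x * (φ x.1 * deriv Θ x.2) := integral_sub I1 I3
  have K2 : ∫ x in strip d bm bp, (g x * ψ x - g x * (φ x.1 * Θ x.2) - g x * φm x.1) =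
      (∫ x in strip d bm bp, g x * ψ x) - (∫ x in strip d bm bp, g x * (φ x.1 * Θ x.2)) -
      ∫ x in strip d bm bp, g x * φm x.1 := by
    rw [← integral_sub I2 I4]
    exact integral_sub (I2.sub I4) I5
  rw [K1, ← hgdef, K2] at key
  have F1' : (∫ x in strip d bm bp, v x * (φ x.1 * deriv Θ x.2)) +
      (∫ x in strip d bm bp, g x * (φ x.1 * Θ x.2)) =
      (∫ x' : Hor d, φp x' * ∫ t in Ioo bm bp, (v (x', t) * deriv Θ t + g (x', t) * Θ t)) -
      ∫ x' : Hor d, φm x' * ∫ t in Ioo bm bp, (v (x', t) * deriv Θ t + g (x', t) * Θ t) := by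
    rw [← integral_add I3 I4, F1, ← integral_sub (J L1 hφp.continuous sφp) (J L1 hφm.continuous sφm)]
    congr 1; funext x'
    simp only [hφdef]; ring
  have F3 : ∫ x' : Hor d, φm x' * ((∫ t in Ioo bm bp, (v (x', t) * deriv Θ t + g (x', t) * Θ t)) -
      ∫ t in Ioo bm bp, g (x', t)) =
      (∫ x' : Hor d, φm x' * ∫ t in Ioo bm bp, (v (x', t) * deriv Θ t + g (x', t) * Θ t)) -
      ∫ x' : Hor d, φm x' * ∫ t in Ioo bm bp, g (x', t) := by
    rw [← integral_sub (J L1 hφm.continuous sφm) (J L2 hφm.continuous sφm)]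
    congr 1; funext x'; ring
  rw [F3]
  have hmain : ∫ x in strip d bm bp, v x * fderiv ℝ ψ x (fullDir d (Fin.last d)) =
      ∫ x in strip d bm bp, v x * dirDeriv (fullDir d (Fin.last d)) ψ x := rfl
  have hsymm : ∫ x in strip d bm bp, ψ x * g x = ∫ x in strip d bm bp, g x * ψ x := by
    simp only [mul_comm]
  rw [hmain, hsymm]
  linarith [F2]

end TraceExistence

/-! ### Green's formula and tangential derivatives of traces -/

section TraceIdentities

variable {d : ℕ} {bm bp p : ℝ}

theorem exists_vertical_cutoff (bm bp : ℝ) : ∃ ρ : ℝ → ℝ, ContDiff ℝ ∞ ρ ∧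
    (∀ t ∈ Icc bm bp, ρ t = 1 ∧ deriv ρ t = 0) ∧ ∀ t ∉ Icc (bm - 2) (bp + 2), ρ t = 0 := by
  obtain ⟨Θ, hΘ⟩ := exists_isStep (show bm - 2 < bm - 1 by linarith)
  obtain ⟨Ξ, hΞ⟩ := exists_isStep (show bp + 1 < bp + 2 by linarith)
  have h1 : ∀ t ∈ Ioo (bm - 1) (bp + 1), Θ t * (1 - Ξ t) = 1 := fun t ht => by
    rw [hΘ.eq_one t ht.1.le, hΞ.eq_zero t ht.2.le]; ring
  refine ⟨fun t => Θ t * (1 - Ξ t), hΘ.contDiff.mul (contDiff_const.sub hΞ.contDiff), ?_, ?_⟩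
  · intro t ht
    have ht' : t ∈ Ioo (bm - 1) (bp + 1) := ⟨by linarith [ht.1], by linarith [ht.2]⟩
    refine ⟨h1 t ht', ?_⟩
    have : (fun t => Θ t * (1 - Ξ t)) =ᶠ[nhds t] fun _ => 1 := by
      filter_upwards [isOpen_Ioo.mem_nhds ht'] with s hs using h1 s hs
    rw [this.deriv_eq]; simp
  · intro t ht
    rw [mem_Icc, not_and_or, not_le, not_le] at ht
    rcases ht with ht | ht
    · simp only; rw [hΘ.eq_zero t ht.le, zero_mul]
    · simp only; rw [hΞ.eq_one t ht.le, sub_self, mul_zero]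

theorem IsStripTrace.indicator_locallyIntegrable {v : Full d → ℝ} {f : (Hor d → ℝ) × (Hor d → ℝ)}
    (h : IsStripTrace bm bp p v f) : LocallyIntegrable ((strip d bm bp).indicator v) :=
  locallyIntegrable_indicator_of_closure h.locallyIntegrable

theorem locallyIntegrable_indicator_congr {v w : Full d → ℝ}
    (hv : LocallyIntegrable ((strip d bm bp).indicator v))
    (h : v =ᵐ[volume.restrict (strip d bm bp)] w) :
    LocallyIntegrable ((strip d bm bp).indicator w) :=
  hv.congr ((ae_eq_restrict_iff_indicator_ae_eq measurableSet_strip).1 h)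

theorem IsStripTrace.indicator_locallyIntegrable_deriv {v g : Full d → ℝ}
    {f : (Hor d → ℝ) × (Hor d → ℝ)} (h : IsStripTrace bm bp p v f) {i : Fin (d + 1)}
    (hg : IsWeakDeriv (fullDir d) (strip d bm bp) (Pi.single i 1) v g) :
    LocallyIntegrable ((strip d bm bp).indicator g) :=
  locallyIntegrable_indicator_congr
    (locallyIntegrable_indicator_of_closure (h.locallyIntegrable_deriv i))
    ((h.hasWeakDeriv i).ae_eq isOpen_strip hg)

/-- A vertical cutoff equal to `1` on the closed strip makes any horizontally supported `ψ`
admissible without changing the integrals. This allows products `φ(x') ζ(t)` with arbitrary smooth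
`ζ`, in particular polynomials, and any representative `g` of the normal derivative. -/
theorem IsStripTrace.integral_normal_eq (hb : bm < bp) {v g : Full d → ℝ}
    {f : (Hor d → ℝ) × (Hor d → ℝ)} (h : IsStripTrace bm bp p v f)
    (hg : IsWeakDeriv (fullDir d) (strip d bm bp) (Pi.single (Fin.last d) 1) v g)
    {ψ : Full d → ℝ} (hψ : ContDiff ℝ 1 ψ) (hψs : HorSupp ψ) :
    ∫ x in strip d bm bp, v x * dirDeriv (fullDir d (Fin.last d)) ψ x =
      -(∫ x in strip d bm bp, g x * ψ x) +
        ((∫ x' : Hor d, ψ (x', bp) * f.2 x') - ∫ x' : Hor d, ψ (x', bm) * f.1 x') := by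
  obtain ⟨ρ, hρ, hρ1, hρ0⟩ := exists_vertical_cutoff bm bp
  have hc : HasCompactSupport (fun x : Full d => ψ x * ρ x.2) := by
    obtain ⟨K, hK, hK0⟩ := hψs
    refine HasCompactSupport.intro
      (hK.prod (isCompact_Icc (a := bm - 2) (b := bp + 2))) fun x hx => ?_
    rw [mem_prod, not_and_or] at hx
    rcases hx with hx | hx
    · rw [hK0 x hx, zero_mul]
    · rw [hρ0 _ hx, mul_zero]
  have key := h.integral_eq (Fin.last d) (fun x => ψ x * ρ x.2)
    (hψ.mul ((hρ.of_le (by simp)).comp contDiff_snd)) hc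
  rw [if_pos rfl] at key
  simp only [(hρ1 bm (left_mem_Icc.2 hb.le)).1, (hρ1 bp (right_mem_Icc.2 hb.le)).1, mul_one] at key
  have e1 : ∫ x in strip d bm bp, v x * fderiv ℝ (fun x => ψ x * ρ x.2) x (fullDir d (Fin.last d)) =
      ∫ x in strip d bm bp, v x * dirDeriv (fullDir d (Fin.last d)) ψ x := by
    refine setIntegral_congr_fun measurableSet_strip fun x hx => ?_
    have hx' : x.2 ∈ Icc bm bp := ⟨hx.1.le, hx.2.le⟩
    have := dirDeriv_mul_comp_snd (hψ.differentiable (by simp)) (hρ.differentiable (by simp))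
      (fullDir d (Fin.last d)) x
    rw [(hρ1 _ hx').1, (hρ1 _ hx').2] at this
    simp only [dirDeriv] at this ⊢
    rw [this]; ring
  have e2 : ∫ x in strip d bm bp, ψ x * ρ x.2 * stripDeriv bm bp (Pi.single (Fin.last d) 1) v x =
      ∫ x in strip d bm bp, g x * ψ x := by
    refine integral_congr_ae ?_
    filter_upwards [(h.hasWeakDeriv _).ae_eq isOpen_strip hg,
      ae_restrict_mem measurableSet_strip] with x hx hxs
    rw [hx, (hρ1 _ ⟨hxs.1.le, hxs.2.le⟩).1]; ring
  rw [e1, e2] at key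
  exact key

theorem MemLpLoc.integrable_mul (hp : 1 < p) {f φ : Hor d → ℝ} (hf : MemLpLoc p f)
    (hφ : Continuous φ) (hφc : HasCompactSupport φ) : Integrable (fun x' => φ x' * f x') := by
  have hp1 : 1 ≤ ENNReal.ofReal p := by simpa using hp.le
  have hf' : LpLoc (ENNReal.ofReal p) f := hf
  have := integrable_mul_of_tsupport_subset
    ((hf'.locallyIntegrable hp1).locallyIntegrableOn univ) hφ hφc (subset_univ _)
  simpa only [mul_comm] using this

theorem MemLpLoc.locallyIntegrable (hp : 1 < p) {f : Hor d → ℝ} (hf : MemLpLoc p f) :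
    LocallyIntegrable f :=
  LpLoc.locallyIntegrable (p := ENNReal.ofReal p) (by simpa using hp.le) hf

/-- Tangential weak derivatives commute with the trace, one derivative at a time. -/
theorem IsStripTrace.isWeakDeriv_tangential (hb : bm < bp) (hp : 1 < p) {v vj vN w : Full d → ℝ}
    {f fj : (Hor d → ℝ) × (Hor d → ℝ)} (j : Fin d)
    (h : IsStripTrace bm bp p v f) (hj : IsStripTrace bm bp p vj fj)
    (hvj : IsWeakDeriv (fullDir d) (strip d bm bp) (Pi.single j.castSucc 1) v vj)
    (hvN : IsWeakDeriv (fullDir d) (strip d bm bp) (Pi.single (Fin.last d) 1) v vN)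
    (hvNj : IsWeakDeriv (fullDir d) (strip d bm bp) (Pi.single j.castSucc 1) vN w)
    (hvjN : IsWeakDeriv (fullDir d) (strip d bm bp) (Pi.single (Fin.last d) 1) vj w) :
    IsWeakDeriv (horDir d) univ (Pi.single j 1) f.2 fj.2 ∧
      IsWeakDeriv (horDir d) univ (Pi.single j 1) f.1 fj.1 := by
  -- Green's formula for `v` against `∂_j φ ζ` and for `vj` against `φ ζ` have interior terms that
  -- agree up to sign: move `∂_j` from `φ` onto `v` in the term with `ζ'`, and onto `vN` in the term
  -- with `ζ`.
  have key : ∀ ζ : ℝ → ℝ, ContDiff ℝ ∞ ζ → ∀ φ : Hor d → ℝ, ContDiff ℝ ∞ φ → HasCompactSupport φ →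
      (∫ x', dirDeriv (horDir d j) φ x' * ζ bp * f.2 x') -
        (∫ x', dirDeriv (horDir d j) φ x' * ζ bm * f.1 x') =
      -((∫ x', φ x' * ζ bp * fj.2 x') - ∫ x', φ x' * ζ bm * fj.1 x') := by
    intro ζ hζ φ hφ hφc
    have hζ' : ContDiff ℝ ∞ (deriv ζ) := (contDiff_infty_iff_deriv.1 hζ).2
    have hζd : Differentiable ℝ ζ := hζ.differentiable (by simp)
    have hζd' : Differentiable ℝ (deriv ζ) := hζ'.differentiable (by simp)
    have hφd : Differentiable ℝ φ := hφ.differentiable (by simp)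
    have hφ' := contDiff_dirDeriv hφ (horDir d j)
    have hφd' : Differentiable ℝ (dirDeriv (horDir d j) φ) := hφ'.differentiable (by simp)
    have sφ' : HasCompactSupport (dirDeriv (horDir d j) φ) := hφc.fderiv_apply ℝ _
    have cd : ∀ {φ : Hor d → ℝ} {ζ : ℝ → ℝ}, ContDiff ℝ ∞ φ → ContDiff ℝ ∞ ζ →
        ContDiff ℝ 1 (fun x : Full d => φ x.1 * ζ x.2) := fun hφ hζ =>
      ((hφ.of_le (by simp)).comp contDiff_fst).mul ((hζ.of_le (by simp)).comp contDiff_snd)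
    have hs : ∀ {φ : Hor d → ℝ} {ζ : ℝ → ℝ}, HasCompactSupport φ →
        HorSupp (fun x : Full d => φ x.1 * ζ x.2) := fun hc => (horSupp_comp_fst hc).mul_right
    have hne : j.castSucc ≠ Fin.last d := (Fin.castSucc_lt_last j).ne
    have A1 := h.integral_normal_eq hb hvN (cd hφ' hζ) (hs sφ')
    have A2 := hj.integral_normal_eq hb hvjN (cd hφ hζ) (hs hφc)
    have A3 := hvj.integral_strip_eq h.indicator_locallyIntegrable hj.indicator_locallyIntegrable
      (cd hφ hζ') (hs hφc) (fun hc => absurd hc hne)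
    have A4 := hvNj.integral_strip_eq (h.indicator_locallyIntegrable_deriv hvN)
      (hj.indicator_locallyIntegrable_deriv hvjN) (cd hφ hζ) (hs hφc) (fun hc => absurd hc hne)
    simp_rw [dirDeriv_last_fst_mul_snd hφd' hζd] at A1
    simp_rw [dirDeriv_last_fst_mul_snd hφd hζd] at A2
    simp_rw [dirDeriv_castSucc_fst_mul_snd hφd hζd'] at A3
    simp_rw [dirDeriv_castSucc_fst_mul_snd hφd hζd] at A4
    linarith
  obtain ⟨Θ, hΘ⟩ := exists_isStep hb
  have hfin : ∀ (F G : Hor d → ℝ), MemLpLoc p F → MemLpLoc p G →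
      (∀ φ : Hor d → ℝ, ContDiff ℝ ∞ φ → HasCompactSupport φ →
        ∫ x', dirDeriv (horDir d j) φ x' * F x' = - ∫ x', φ x' * G x') →
      IsWeakDeriv (horDir d) univ (Pi.single j 1) F G := by
    intro F G hF hG H
    refine ⟨(hF.locallyIntegrable hp).locallyIntegrableOn _,
      (hG.locallyIntegrable hp).locallyIntegrableOn _, fun φ h1 h2 _ => ?_⟩
    rw [partialDeriv_single _ _ h1, Measure.restrict_univ]
    simp only [mul_comm (F _), mul_comm (G _)]
    rw [H φ h1 h2]
    simp
  refine ⟨hfin _ _ h.memLpLoc_upper hj.memLpLoc_upper fun φ h1 h2 => ?_,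
    hfin _ _ h.memLpLoc_lower hj.memLpLoc_lower fun φ h1 h2 => ?_⟩
  -- `Θ` is `0` on the lower and `1` on the upper component, so it isolates the upper trace; `1 - Θ`
  -- isolates the lower one.
  · have := key Θ hΘ.contDiff φ h1 h2
    simpa [hΘ.eq_zero bm le_rfl, hΘ.eq_one bp le_rfl] using this
  · have := key (fun t => 1 - Θ t) (contDiff_const.sub hΘ.contDiff) φ h1 h2
    simpa [hΘ.eq_zero bm le_rfl, hΘ.eq_one bp le_rfl, neg_eq_iff_eq_neg] using this

end TraceIdentities

/-! ### Taylor's formula from both ends of the interval -/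

section TaylorKernel

variable {d : ℕ} {bm bp p : ℝ}

/-- The kernel of the Taylor remainder with expansion points at both ends of an interval. -/
noncomputable def taylorKer (c : ℝ) (k : ℕ) (t : ℝ) : ℝ := (c - t) ^ k / (k.factorial : ℝ)

theorem contDiff_taylorKer (c : ℝ) (k : ℕ) : ContDiff ℝ ∞ (taylorKer c k) := by
  unfold taylorKer; fun_prop

theorem deriv_taylorKer_succ (c : ℝ) (k : ℕ) (t : ℝ) :
    deriv (taylorKer c (k + 1)) t = - taylorKer c k t := by
  have h1 : HasDerivAt (fun t : ℝ => c - t) (-1) t := by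
    simpa using (hasDerivAt_id t).const_sub c
  have h2 : HasDerivAt (taylorKer c (k + 1))
      (((k + 1 : ℕ) : ℝ) * (c - t) ^ k * (-1) / ((k + 1).factorial : ℝ)) t := by
    exact (h1.pow (k + 1)).div_const ((k + 1).factorial : ℝ)
  rw [h2.deriv, taylorKer, Nat.factorial_succ]
  have : (k.factorial : ℝ) ≠ 0 := by positivity
  push_cast
  field_simp

theorem taylorKer_right (k : ℕ) :
    taylorKer ((bm + bp) / 2) k bp = (-1) ^ k / (k.factorial : ℝ) * ((bp - bm) / 2) ^ k := by
  rw [taylorKer, show (bm + bp) / 2 - bp = (-1) * ((bp - bm) / 2) by ring, mul_pow]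
  ring

theorem taylorKer_left (k : ℕ) :
    taylorKer ((bm + bp) / 2) k bm =
      - ((-1) ^ k / (k.factorial : ℝ) * (-1) ^ (k + 1) * ((bp - bm) / 2) ^ k) := by
  rw [taylorKer, show (bm + bp) / 2 - bm = (bp - bm) / 2 by ring, pow_succ]
  have : ((-1 : ℝ) ^ k) * (-1) ^ k = 1 := by rw [← mul_pow]; simp
  linear_combination (-(((bp - bm) / 2) ^ k / (k.factorial : ℝ))) * this

/-- The combination of the boundary values in the jump estimate. -/
noncomputable def jumpSum (bm bp : ℝ) (F : ℕ → (Hor d → ℝ) × (Hor d → ℝ)) (M : ℕ) (x' : Hor d) : ℝ :=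
  ∑ k ∈ Finset.range M, (-1 : ℝ) ^ k / (k.factorial : ℝ) *
    ((F k).2 x' + (-1 : ℝ) ^ (k + 1) * (F k).1 x') * ((bp - bm) / 2) ^ k

/-- Green's formula for `f k` against `φ K_k` expresses its boundary term as `∫ f (k+1) φ K_k - ∫ f
k φ K_{k-1}`, because `K_k' = -K_{k-1}`. Summation over `k ≤ M` telescopes, the lower end
contributing nothing since `K_0` is constant. The weights in `jumpSum` are the values of `K_k` at
the two ends, by `taylorKer_right` and `taylorKer_left`. -/
theorem integral_mul_jumpSum (hb : bm < bp) (hp : 1 < p) {f : ℕ → Full d → ℝ}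
    {F : ℕ → (Hor d → ℝ) × (Hor d → ℝ)} (M : ℕ)
    (hF : ∀ k ≤ M, IsStripTrace bm bp p (f k) (F k))
    (hf : ∀ k ≤ M, IsWeakDeriv (fullDir d) (strip d bm bp) (Pi.single (Fin.last d) 1) (f k)
      (f (k + 1))) {φ : Hor d → ℝ} (hφ : ContDiff ℝ ∞ φ) (hφc : HasCompactSupport φ) :
    ∫ x', φ x' * jumpSum bm bp F (M + 1) x' =
      ∫ x in strip d bm bp, f (M + 1) x * (φ x.1 * taylorKer ((bm + bp) / 2) M x.2) := by
  have hφd : Differentiable ℝ φ := hφ.differentiable (by simp)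
  have cd : ∀ k, ContDiff ℝ 1 (fun x : Full d => φ x.1 * taylorKer ((bm + bp) / 2) k x.2) := fun k =>
    ((hφ.of_le (by simp)).comp contDiff_fst).mul
      (((contDiff_taylorKer _ k).of_le (by simp)).comp contDiff_snd)
  have hs : ∀ k, HorSupp (fun x : Full d => φ x.1 * taylorKer ((bm + bp) / 2) k x.2) := fun k =>
    (horSupp_comp_fst hφc).mul_right
  have hid := fun k hk => (hF k hk).integral_normal_eq hb (hf k hk) (cd k) (hs k)
  have i1 := fun k hk => (hF k hk).memLpLoc_lower.integrable_mul hp hφ.continuous hφc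
  have i2 := fun k hk => (hF k hk).memLpLoc_upper.integrable_mul hp hφ.continuous hφc
  have hterm : ∀ k (hk : k ≤ M), ∫ x', φ x' * ((-1 : ℝ) ^ k / (k.factorial : ℝ) *
      ((F k).2 x' + (-1 : ℝ) ^ (k + 1) * (F k).1 x') * ((bp - bm) / 2) ^ k) =
      (∫ x', φ x' * taylorKer ((bm + bp) / 2) k bp * (F k).2 x') -
        ∫ x', φ x' * taylorKer ((bm + bp) / 2) k bm * (F k).1 x' := by
    intro k hk
    rw [← integral_sub]
    · congr 1; funext x'
      rw [taylorKer_right, taylorKer_left]; ring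
    · refine ((i2 k hk).const_mul (taylorKer ((bm + bp) / 2) k bp)).congr (ae_of_all _ fun x => ?_)
      simp only; ring
    · refine ((i1 k hk).const_mul (taylorKer ((bm + bp) / 2) k bm)).congr (ae_of_all _ fun x => ?_)
      simp only; ring
  have hint : ∀ k (hk : k ≤ M), Integrable fun x' => φ x' * ((-1 : ℝ) ^ k / (k.factorial : ℝ) *
      ((F k).2 x' + (-1 : ℝ) ^ (k + 1) * (F k).1 x') * ((bp - bm) / 2) ^ k) := by
    intro k hk
    have := (((i2 k hk).add ((i1 k hk).const_mul ((-1 : ℝ) ^ (k + 1)))).const_mul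
      ((-1 : ℝ) ^ k / (k.factorial : ℝ) * ((bp - bm) / 2) ^ k))
    refine this.congr (ae_of_all _ fun x => ?_)
    simp only [Pi.add_apply]; ring
  induction M with
  | zero =>
    have h0 := hid 0 le_rfl
    have hd0 : ∀ x, dirDeriv (fullDir d (Fin.last d))
        (fun x : Full d => φ x.1 * taylorKer ((bm + bp) / 2) 0 x.2) x = 0 := by
      intro x
      rw [dirDeriv_last_fst_mul_snd hφd ((contDiff_taylorKer _ 0).differentiable (by simp))]
      have : taylorKer ((bm + bp) / 2) 0 = fun _ => 1 := by funext t; simp [taylorKer]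
      rw [this]; simp
    simp_rw [hd0] at h0
    simp only [mul_zero, integral_zero] at h0
    simp only [jumpSum, zero_add, Finset.sum_range_one]
    rw [hterm 0 le_rfl]
    linarith
  | succ M ih =>
    have hM := hid (M + 1) le_rfl
    have hd1 : ∀ x, dirDeriv (fullDir d (Fin.last d))
        (fun x : Full d => φ x.1 * taylorKer ((bm + bp) / 2) (M + 1) x.2) x =
        - (φ x.1 * taylorKer ((bm + bp) / 2) M x.2) := by
      intro x
      rw [dirDeriv_last_fst_mul_snd hφd ((contDiff_taylorKer _ _).differentiable (by simp)),
        deriv_taylorKer_succ]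
      ring
    simp_rw [hd1, mul_neg, integral_neg] at hM
    have hih := ih (fun k hk => hF k (by omega)) (fun k hk => hf k (by omega))
      (fun k hk => hid k (by omega)) (fun k hk => i1 k (by omega)) (fun k hk => i2 k (by omega))
      (fun k hk => hterm k (by omega)) (fun k hk => hint k (by omega))
    have hsplit : ∫ x', φ x' * jumpSum bm bp F (M + 1 + 1) x' =
        (∫ x', φ x' * jumpSum bm bp F (M + 1) x') +
        ∫ x', φ x' * ((-1 : ℝ) ^ (M + 1) / ((M + 1).factorial : ℝ) *
          ((F (M + 1)).2 x' + (-1 : ℝ) ^ (M + 1 + 1) * (F (M + 1)).1 x') *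
            ((bp - bm) / 2) ^ (M + 1)) := by
      rw [← integral_add _ (hint (M + 1) le_rfl)]
      · congr 1; funext x'
        rw [jumpSum, Finset.sum_range_succ, mul_add]; rfl
      · simp only [jumpSum, Finset.mul_sum]
        exact integrable_finsetSum _ fun k hk =>
          hint k (by have := Finset.mem_range.1 hk; omega)
    rw [hsplit, hih, hterm (M + 1) le_rfl]
    linarith

theorem jumpSum_ae_eq (hb : bm < bp) (hp : 1 < p) {f : ℕ → Full d → ℝ}
    {F : ℕ → (Hor d → ℝ) × (Hor d → ℝ)} (M : ℕ)
    (hF : ∀ k ≤ M, IsStripTrace bm bp p (f k) (F k))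
    (hf : ∀ k ≤ M, IsWeakDeriv (fullDir d) (strip d bm bp) (Pi.single (Fin.last d) 1) (f k)
      (f (k + 1))) (hL : LpLoc (ENNReal.ofReal p) ((strip d bm bp).indicator (f (M + 1)))) :
    jumpSum bm bp F (M + 1) =ᵐ[volume] fun x' =>
      ∫ t in Ioo bm bp, taylorKer ((bm + bp) / 2) M t * f (M + 1) (x', t) := by
  have hpq := Real.HolderConjugate.conjExponent hp
  have hp1 : 1 ≤ ENNReal.ofReal p := by simpa using hp.le
  have hK := (contDiff_taylorKer ((bm + bp) / 2) M).continuous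
  have hL2 : LpLoc (ENNReal.ofReal p) (fun x' : Hor d =>
      ∫ t in Ioo bm bp, taylorKer ((bm + bp) / 2) M t * f (M + 1) (x', t)) := by
    refine lpLoc_vertical_integral
      (h := fun x => taylorKer ((bm + bp) / 2) M x.2 * f (M + 1) x) hpq ?_
    convert hL.mul_continuous (hK.comp continuous_snd) using 1
    funext x
    by_cases hx : x ∈ strip d bm bp <;> simp [hx, mul_comm]
  refine ae_eq_of_integral_contDiff_smul_eq ?_ (hL2.locallyIntegrable hp1) fun φ hφ hφc => ?_
  · unfold jumpSum
    refine locallyIntegrable_finsetSum _ fun k hk => ?_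
    have hk' : k ≤ M := by have := Finset.mem_range.1 hk; omega
    have t1 := (hF k hk').memLpLoc_lower.locallyIntegrable hp
    have t2 := (hF k hk').memLpLoc_upper.locallyIntegrable hp
    have := (t2.add (t1.smul ((-1 : ℝ) ^ (k + 1)))).smul
      ((-1 : ℝ) ^ k / (k.factorial : ℝ) * ((bp - bm) / 2) ^ k)
    refine this.congr (ae_of_all _ fun x' => ?_)
    simp only [Pi.smul_apply, Pi.add_apply, smul_eq_mul]; ring
  · simp only [smul_eq_mul]
    rw [integral_mul_jumpSum hb hp M hF hf hφ hφc, setIntegral_strip]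
    · congr 1; funext x'
      rw [← integral_const_mul]
      congr 1; funext t; ring
    · exact ((horSupp_comp_fst hφc).mul_right
        (f := fun x : Full d => taylorKer ((bm + bp) / 2) M x.2)).integrableOn_strip
        (hL.locallyIntegrable hp1)
        ((hφ.continuous.comp continuous_fst).mul (hK.comp continuous_snd))

end TaylorKernel

/-! ### Norm inequalities for fibre integrals -/

section FibreIntegrals

variable {d : ℕ} {bm bp p : ℝ}

/-- The norm of a vector valued integral is at most the integral of the norm. If the vector function
is not integrable the right-hand side is infinite. -/
theorem ofReal_sqrt_sum_integral_le {Y I : Type*} [MeasurableSpace Y] {ν : Measure Y} (A : Finset I)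
    (H : I → Y → ℝ) (hH : ∀ a ∈ A, AEStronglyMeasurable (H a) ν) :
    ENNReal.ofReal (√(∑ a ∈ A, (∫ t, H a t ∂ν) ^ 2)) ≤
      ∫⁻ t, ENNReal.ofReal (√(∑ a ∈ A, H a t ^ 2)) ∂ν := by
  set vec : Y → EuclideanSpace ℝ A := fun t => WithLp.toLp 2 fun a => H a t
  have hvec : AEStronglyMeasurable vec ν :=
    (PiLp.continuous_toLp 2 _).comp_aestronglyMeasurable
      (AEMeasurable.aestronglyMeasurable (aemeasurable_pi_lambda _ fun a => (hH a a.2).aemeasurable))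
  have hn : ∀ t, ‖vec t‖ₑ = ENNReal.ofReal (√(∑ a ∈ A, H a t ^ 2)) := by
    intro t
    rw [← ofReal_norm, EuclideanSpace.norm_eq]
    congr 2
    rw [← Finset.sum_coe_sort A]
    simp [vec]
  simp_rw [← hn]
  by_cases hfin : ∫⁻ t, ‖vec t‖ₑ ∂ν < ⊤
  · have hint : Integrable vec ν := ⟨hvec, hfin⟩
    refine le_trans (le_of_eq ?_) (enorm_integral_le_lintegral_enorm vec)
    rw [← ofReal_norm, EuclideanSpace.norm_eq]
    congr 2
    rw [← Finset.sum_coe_sort A]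
    refine Finset.sum_congr rfl fun a _ => ?_
    have := (EuclideanSpace.proj a : EuclideanSpace ℝ A →L[ℝ] ℝ).integral_comp_comm hint
    have h2 : ∫ t, H a t ∂ν = (∫ t, vec t ∂ν) a := this
    rw [h2, Real.norm_eq_abs, sq_abs]
  · rw [not_lt_top_iff.1 hfin]
    exact le_top

theorem volume_restrict_strip : (volume : Measure (Full d)).restrict (strip d bm bp) =
    (volume : Measure (Hor d)).prod (volume.restrict (Ioo bm bp)) := by
  rw [strip_eq_prod, Measure.volume_eq_prod, ← Measure.prod_restrict, Measure.restrict_univ]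

/-- The Euclidean norm is taken inside the fibre integral before Hölder is applied with a constant
weight. The constant is therefore the same for any number of components. -/
theorem lintegral_sqrt_sum_integral_rpow_le (hb : bm < bp) (hp : 1 < p) {I : Type*} (A : Finset I)
    {G : I → Full d → ℝ} (hG : ∀ a ∈ A, AEStronglyMeasurable (G a) (volume.restrict (strip d bm bp)))
    {K : ℝ → ℝ} (hK : Continuous K) {κ : ℝ} (hκ : 0 ≤ κ) (hKκ : ∀ t ∈ Ioo bm bp, |K t| ≤ κ) :
    ∫⁻ x' : Hor d, ENNReal.ofReal
        (√(∑ a ∈ A, (∫ t in Ioo bm bp, K t * G a (x', t)) ^ 2) ^ p) ≤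
      ENNReal.ofReal (κ ^ p * (bp - bm) ^ (p - 1)) *
        ∫⁻ x in strip d bm bp, ENNReal.ofReal (√(∑ a ∈ A, G a x ^ 2) ^ p) := by
  have hpq := Real.HolderConjugate.conjExponent hp
  set q := p.conjExponent
  have hL : 0 < bp - bm := sub_pos.2 hb
  rw [volume_restrict_strip] at hG ⊢
  have hGs : AEStronglyMeasurable (fun x => ∑ a ∈ A, G a x ^ 2)
      ((volume : Measure (Hor d)).prod (volume.restrict (Ioo bm bp))) :=
    Finset.aestronglyMeasurable_fun_sum A fun a ha => (hG a ha).pow 2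
  have hN : AEMeasurable (fun x => ENNReal.ofReal (√(∑ a ∈ A, G a x ^ 2) ^ p))
      ((volume : Measure (Hor d)).prod (volume.restrict (Ioo bm bp))) :=
    ((hGs.aemeasurable.sqrt).pow_const p).ennreal_ofReal
  rw [lintegral_prod _ hN, ← lintegral_const_mul' _ _ ENNReal.ofReal_ne_top]
  refine lintegral_mono_ae ?_
  have hfib : ∀ᵐ x' : Hor d, ∀ a ∈ A,
      AEStronglyMeasurable (fun t => G a (x', t)) (volume.restrict (Ioo bm bp)) := by
    rw [Filter.eventually_all_finset]
    exact fun a ha => (hG a ha).prodMk_left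
  filter_upwards [hfib] with x' hx'
  have hKm : AEStronglyMeasurable K (volume.restrict (Ioo bm bp)) := hK.aestronglyMeasurable
  have h1 := ofReal_sqrt_sum_integral_le (ν := volume.restrict (Ioo bm bp)) A
    (fun a t => K t * G a (x', t)) (fun a ha => hKm.mul (hx' a ha))
  have h2 : ∫⁻ t in Ioo bm bp, ENNReal.ofReal (√(∑ a ∈ A, (K t * G a (x', t)) ^ 2)) ≤
      ∫⁻ t in Ioo bm bp, ENNReal.ofReal κ * ENNReal.ofReal (√(∑ a ∈ A, G a (x', t) ^ 2)) := by
    refine lintegral_mono_ae ?_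
    filter_upwards [ae_restrict_mem measurableSet_Ioo] with t ht
    rw [← ENNReal.ofReal_mul hκ]
    apply ENNReal.ofReal_le_ofReal
    simp_rw [mul_pow]
    rw [← Finset.mul_sum, Real.sqrt_mul (sq_nonneg _), Real.sqrt_sq_eq_abs]
    exact mul_le_mul_of_nonneg_right (hKκ t ht) (Real.sqrt_nonneg _)
  have hGf : AEMeasurable (fun t => ENNReal.ofReal (√(∑ a ∈ A, G a (x', t) ^ 2)))
      (volume.restrict (Ioo bm bp)) :=
    ((Finset.aemeasurable_fun_sum A fun a ha => (hx' a ha).aemeasurable.pow_const 2).sqrt).ennreal_ofReal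
  have h3 := lintegral_mul_rpow_le hpq (ν := volume.restrict (Ioo bm bp))
    (w := fun _ => ENNReal.ofReal κ) aemeasurable_const hGf
  rw [← ENNReal.ofReal_rpow_of_nonneg (Real.sqrt_nonneg _) hpq.nonneg]
  refine (ENNReal.rpow_le_rpow (h1.trans h2) hpq.nonneg).trans (h3.trans (le_of_eq ?_))
  congr 1
  · rw [lintegral_const, Measure.restrict_apply_univ, Real.volume_Ioo,
      ENNReal.mul_rpow_of_nonneg _ _ (div_nonneg hpq.nonneg hpq.symm.nonneg), ← ENNReal.rpow_mul,
      mul_div_cancel₀ _ hpq.symm.ne_zero, ENNReal.ofReal_rpow_of_nonneg hκ hpq.nonneg,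
      hpq.div_conj_eq_sub_one, ENNReal.ofReal_rpow_of_nonneg hL.le (by linarith),
      ENNReal.ofReal_mul (by positivity)]
  · congr 1; funext t
    rw [ENNReal.ofReal_rpow_of_nonneg (Real.sqrt_nonneg _) hpq.nonneg]

end FibreIntegrals

/-! ### Horizontal shears of the strip -/

section Shear

variable {d : ℕ} {bm bp p : ℝ}

/-- The shear `(x', t) ↦ (x' + χ(t) h, t)`. -/
def shear (h : Hor d) (χ : ℝ → ℝ) (x : Full d) : Full d := (x.1 + χ x.2 • h, x.2)

/-- The shear as a homeomorphism. -/
noncomputable def shearHomeomorph (h : Hor d) {χ : ℝ → ℝ} (hχ : Continuous χ) : Full d ≃ₜ Full d where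
  toFun := shear h χ
  invFun x := (x.1 - χ x.2 • h, x.2)
  left_inv x := by simp [shear]
  right_inv x := by simp [shear]
  continuous_toFun := by unfold shear; fun_prop
  continuous_invFun := by fun_prop

theorem continuous_shear (h : Hor d) {χ : ℝ → ℝ} (hχ : Continuous χ) : Continuous (shear h χ) :=
  (shearHomeomorph h hχ).continuous

theorem measurePreserving_shear_hor (h : Hor d) {χ : ℝ → ℝ} (hχ : Continuous χ) :
    MeasurePreserving (shear h χ) (volume : Measure (Full d)) volume := by
  have h1 : MeasurePreserving (fun z : ℝ × Hor d => (z.1, z.2 + χ z.1 • h))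
      ((volume : Measure ℝ).prod (volume : Measure (Hor d))) (volume.prod volume) := by
    refine (MeasurePreserving.id volume).skew_product (g := fun t y => y + χ t • h) ?_ ?_
    · exact Continuous.measurable (by fun_prop)
    · exact ae_of_all _ fun t => (measurePreserving_add_right volume (χ t • h)).map_eq
  exact (Measure.measurePreserving_swap.comp h1).comp Measure.measurePreserving_swap

theorem LpLoc.comp_shear {p : ℝ≥0∞} {w : Full d → ℝ} (hw : LpLoc p w) (h : Hor d) {χ : ℝ → ℝ}
    (hχ : Continuous χ) : LpLoc p (fun x => w (TraceStrip.shear h χ x)) := by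
  intro K hK
  have hK' : IsCompact (TraceStrip.shear h χ '' K) := hK.image (continuous_shear h hχ)
  have h1 := (memLp_indicator_iff_restrict hK'.measurableSet).2 (hw _ hK')
  refine ((h1.comp_measurePreserving (measurePreserving_shear_hor h hχ)).restrict K).ae_eq ?_
  filter_upwards [ae_restrict_mem hK.measurableSet] with x hx
  exact indicator_of_mem (mem_image_of_mem _ hx) _

theorem LpLoc.indicator_comp_shear {p : ℝ≥0∞} {w : Full d → ℝ}
    (hw : LpLoc p ((strip d bm bp).indicator w)) (h : Hor d) {χ : ℝ → ℝ} (hχ : Continuous χ) :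
    LpLoc p ((strip d bm bp).indicator fun x => w (TraceStrip.shear h χ x)) := by
  have := hw.comp_shear h hχ
  rwa [show (fun x => (strip d bm bp).indicator w (TraceStrip.shear h χ x)) =
    (strip d bm bp).indicator fun x => w (TraceStrip.shear h χ x) from rfl] at this

theorem setIntegral_strip_comp_shear (h : Hor d) {χ : ℝ → ℝ} (hχ : Continuous χ)
    (w : Full d → ℝ) :
    ∫ x in strip d bm bp, w (shear h χ x) = ∫ x in strip d bm bp, w x :=
  (measurePreserving_shear_hor h hχ).setIntegral_preimage_emb
    (shearHomeomorph h hχ).measurableEmbedding w (strip d bm bp)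

/-- The test function `φ(x' - χ(t) h)`. -/
def unshear (h : Hor d) (χ : ℝ → ℝ) (φ : Hor d → ℝ) (x : Full d) : ℝ := φ (x.1 - χ x.2 • h)

theorem unshear_shear (h : Hor d) (χ : ℝ → ℝ) (φ : Hor d → ℝ) (x : Full d) :
    unshear h χ φ (shear h χ x) = φ x.1 := by
  simp [unshear, shear]

theorem contDiff_unshear (h : Hor d) {χ : ℝ → ℝ} (hχ : ContDiff ℝ ∞ χ) {φ : Hor d → ℝ}
    (hφ : ContDiff ℝ ∞ φ) : ContDiff ℝ ∞ (unshear h χ φ) :=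
  hφ.comp (contDiff_fst.sub ((hχ.comp contDiff_snd).smul contDiff_const))

theorem dirDeriv_unshear (h : Hor d) {χ : ℝ → ℝ} (hχ : ContDiff ℝ ∞ χ) {φ : Hor d → ℝ}
    (hφ : ContDiff ℝ ∞ φ) (v x : Full d) :
    dirDeriv v (unshear h χ φ) x =
      fderiv ℝ φ (x.1 - χ x.2 • h) (v.1 - (deriv χ x.2 * v.2) • h) := by
  have h1 : HasFDerivAt (fun x : Full d => χ x.2)
      (deriv χ x.2 • ContinuousLinearMap.snd ℝ (Hor d) ℝ) x :=
    ((hχ.differentiable (by simp)) x.2).hasDerivAt.comp_hasFDerivAt x hasFDerivAt_snd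
  have h2 : HasFDerivAt (fun x : Full d => x.1 - χ x.2 • h) _ x :=
    hasFDerivAt_fst.sub (h1.smul_const h)
  have h3 := ((hφ.differentiable (by simp)) (x.1 - χ x.2 • h)).hasFDerivAt.comp x h2
  have h4 : HasFDerivAt (unshear h χ φ) _ x := h3
  unfold dirDeriv
  rw [h4.fderiv]
  simp

theorem horSupp_unshear (h : Hor d) {χ : ℝ → ℝ} (hχ : ∀ t, χ t ∈ Icc (0 : ℝ) 1) {φ : Hor d → ℝ}
    (hφ : HasCompactSupport φ) : HorSupp (unshear h χ φ) := by
  refine ⟨(fun z : Hor d × ℝ => z.1 + z.2 • h) '' (tsupport φ ×ˢ Icc 0 1),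
    ((IsCompact.prod hφ isCompact_Icc).image (by fun_prop)), fun x hx => ?_⟩
  by_contra hne
  exact hx ⟨(x.1 - χ x.2 • h, χ x.2), ⟨subset_tsupport _ hne, hχ _⟩, by simp⟩

theorem sum_horDir (h : Hor d) : ∑ j, h j • horDir d j = h := by
  ext i
  simp [horDir, Pi.single_apply]

end Shear

/-! ### Differences of traces as path integrals of the gradient -/

section DifferenceIdentity

variable {d : ℕ} {bm bp p : ℝ}

/-- One of the two boundary components of the strip, `τ` being the inner normal direction. -/
def IsSide (bm bp : ℝ) (f : (Hor d → ℝ) × (Hor d → ℝ)) (b τ : ℝ) (F : Hor d → ℝ) : Prop :=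
  (b = bm ∧ τ = 1 ∧ F = f.1) ∨ (b = bp ∧ τ = -1 ∧ F = f.2)

theorem IsStripTrace.integral_side_eq (hb : bm < bp) {v g : Full d → ℝ}
    {f : (Hor d → ℝ) × (Hor d → ℝ)} (h : IsStripTrace bm bp p v f)
    (hg : IsWeakDeriv (fullDir d) (strip d bm bp) (Pi.single (Fin.last d) 1) v g)
    {b τ : ℝ} {F : Hor d → ℝ} (hs : IsSide bm bp f b τ F)
    {ψ : Full d → ℝ} (hψ : ContDiff ℝ 1 ψ) (hψs : HorSupp ψ)
    (h0 : ∀ x', ∀ t ∈ ({bm, bp} : Set ℝ), t ≠ b → ψ (x', t) = 0) :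
    ∫ x', ψ (x', b) * F x' =
      -(τ * ((∫ x in strip d bm bp, v x * dirDeriv (fullDir d (Fin.last d)) ψ x) +
        ∫ x in strip d bm bp, g x * ψ x)) := by
  have := h.integral_normal_eq hb hg hψ hψs
  rcases hs with ⟨rfl, rfl, rfl⟩ | ⟨rfl, rfl, rfl⟩
  · have h1 : ∀ x', ψ (x', bp) = 0 := fun x' => h0 x' bp (by simp) hb.ne'
    simp only [h1, zero_mul, integral_zero] at this
    linarith
  · have h1 : ∀ x', ψ (x', bm) = 0 := fun x' => h0 x' bm (by simp) hb.ne
    simp only [h1, zero_mul, integral_zero] at this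
    linarith

theorem IsSide.memLpLoc {v : Full d → ℝ} {f : (Hor d → ℝ) × (Hor d → ℝ)}
    (h : IsStripTrace bm bp p v f) {b τ : ℝ} {F : Hor d → ℝ} (hs : IsSide bm bp f b τ F) :
    MemLpLoc p F := by
  rcases hs with ⟨rfl, rfl, rfl⟩ | ⟨rfl, rfl, rfl⟩
  exacts [h.memLpLoc_lower, h.memLpLoc_upper]

theorem IsSide.sq_eq {f : (Hor d → ℝ) × (Hor d → ℝ)} {b τ : ℝ} {F : Hor d → ℝ}
    (hs : IsSide bm bp f b τ F) : |τ| = 1 := by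
  rcases hs with ⟨rfl, rfl, rfl⟩ | ⟨rfl, rfl, rfl⟩ <;> simp

/-- The integrand in the representation of differences of traces by integrals of the gradient
along two paths which meet inside of the strip. -/
noncomputable def pathIntegrand (h : Hor d) (χ ζ : ℝ → ℝ) (g : Fin (d + 1) → Full d → ℝ)
    (x : Full d) : ℝ :=
  (∑ j : Fin d, g j.castSucc (shear h χ x) * (ζ x.2 * deriv χ x.2 * h j)) +
    g (Fin.last d) (shear h χ x) * ζ x.2 - g (Fin.last d) (shear h (fun _ => 1) x) * ζ x.2

/-- For smooth `v` one differentiates `ζ(t) (v(x' + χ(t) h, t) - v(x' + h, t))`. The term with `ζ'`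
vanishes because the two paths coincide where `ζ' ≠ 0`; at `b` the function is `v(x', b) - v(x' + h,
b)`, and at the opposite side `ζ = 0`. The proof is the dual computation: the paths are transferred
to the test function, as `φ(x' - χ(t) h)` and `φ(x' - h)`. -/
theorem trace_sub_ae_eq (hb : bm < bp) (hp : 1 < p) {v : Full d → ℝ}
    {f : (Hor d → ℝ) × (Hor d → ℝ)} (hv : IsStripTrace bm bp p v f)
    {g : Fin (d + 1) → Full d → ℝ}
    (hg : ∀ i, IsWeakDeriv (fullDir d) (strip d bm bp) (Pi.single i 1) v (g i))
    (hgL : ∀ i, LpLoc (ENNReal.ofReal p) ((strip d bm bp).indicator (g i)))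
    {b τ : ℝ} {F : Hor d → ℝ} (hs : IsSide bm bp f b τ F) (h : Hor d) {χ ζ : ℝ → ℝ}
    (hχ : ContDiff ℝ ∞ χ) (hζ : ContDiff ℝ ∞ ζ) (hχb : χ b = 0) (hζb : ζ b = 1)
    (hζ0 : ∀ t ∈ ({bm, bp} : Set ℝ), t ≠ b → ζ t = 0) (hχI : ∀ t, χ t ∈ Icc (0 : ℝ) 1)
    (hχζ : ∀ t, deriv ζ t ≠ 0 → χ t = 1) :
    (fun x' => F (x' + h) - F x') =ᵐ[volume] fun x' =>
      ∫ t in Ioo bm bp, τ * pathIntegrand h χ ζ g (x', t) := by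
  have hpq := Real.HolderConjugate.conjExponent hp
  have hp1 : 1 ≤ ENNReal.ofReal p := by simpa using hp.le
  have hχ' : ContDiff ℝ ∞ (deriv χ) := (contDiff_infty_iff_deriv.1 hχ).2
  have hχc := hχ.continuous
  have hζc := hζ.continuous
  have hχc' := hχ'.continuous
  have hFL := hs.memLpLoc hv
  have hFl : LocallyIntegrable F := hFL.locallyIntegrable hp
  have hWL : LpLoc (ENNReal.ofReal p)
      ((strip d bm bp).indicator fun x => τ * pathIntegrand h χ ζ g x) := by
    have t1 : ∀ j : Fin d, LpLoc (ENNReal.ofReal p) fun x =>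
        (strip d bm bp).indicator (fun x => g j.castSucc (shear h χ x)) x *
          (ζ x.2 * deriv χ x.2 * h j) := fun j =>
      ((hgL j.castSucc).indicator_comp_shear h hχc).mul_continuous (by fun_prop)
    have t2 := ((hgL (Fin.last d)).indicator_comp_shear h hχc).mul_continuous
      (f := fun x : Full d => ζ x.2) (hζc.comp continuous_snd)
    have t3 := ((hgL (Fin.last d)).indicator_comp_shear h
      (continuous_const (y := (1 : ℝ)))).mul_continuous (f := fun x : Full d => ζ x.2) (hζc.comp continuous_snd)
    have t4 : LpLoc (ENNReal.ofReal p) fun x => ∑ j : Fin d,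
        (strip d bm bp).indicator (fun x => g j.castSucc (shear h χ x)) x *
          (ζ x.2 * deriv χ x.2 * h j) := fun K hK => memLp_finsetSum _ fun j _ => t1 j K hK
    have t5 := ((t4.add t2).sub t3).mul_continuous (f := fun _ : Full d => τ) continuous_const
    convert t5 using 1
    funext x
    by_cases hx : x ∈ strip d bm bp
    · simp [hx, pathIntegrand, mul_comm τ]
    · simp [hx]
  refine ae_eq_of_integral_contDiff_smul_eq ?_
    ((lpLoc_vertical_integral hpq hWL).locallyIntegrable hp1) fun φ hφ hφc => ?_
  · have : LpLoc (ENNReal.ofReal p) (fun x' => F (x' + h)) := by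
      intro K hK
      have hK' : IsCompact ((fun x => x + h) '' K) := hK.image (by fun_prop)
      have h1 := (memLp_indicator_iff_restrict hK'.measurableSet).2 (hFL _ hK')
      refine ((h1.comp_measurePreserving (measurePreserving_add_right volume h)).restrict K).ae_eq ?_
      filter_upwards [ae_restrict_mem hK.measurableSet] with x hx
      exact indicator_of_mem (mem_image_of_mem (fun x => x + h) hx) _
    exact (this.locallyIntegrable hp1).sub hFl
  simp only [smul_eq_mul]
  have h1I : ∀ t : ℝ, (fun _ : ℝ => (1 : ℝ)) t ∈ Icc (0 : ℝ) 1 := fun t => by simp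
  set Φ := unshear h χ φ with hΦdef
  set Φ₁ := unshear h (fun _ => 1) φ with hΦ₁def
  have cΦ : ContDiff ℝ ∞ Φ := contDiff_unshear h hχ hφ
  have cΦ₁ : ContDiff ℝ ∞ Φ₁ := contDiff_unshear h contDiff_const hφ
  have sΦ : HorSupp Φ := horSupp_unshear h hχI hφc
  have sΦ₁ : HorSupp Φ₁ := horSupp_unshear h h1I hφc
  have dΦ : Differentiable ℝ Φ := cΦ.differentiable (by simp)
  have dΦ₁ : Differentiable ℝ Φ₁ := cΦ₁.differentiable (by simp)
  have cζ : ContDiff ℝ ∞ (fun x : Full d => ζ x.2) := hζ.comp contDiff_snd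
  have cζχ : ContDiff ℝ ∞ (fun t => ζ t * deriv χ t) := hζ.mul hχ'
  have hside := hv.integral_side_eq hb (hg (Fin.last d)) hs (ψ := fun x => (Φ₁ x - Φ x) * ζ x.2)
    (((cΦ₁.sub cΦ).mul cζ).of_le (by simp)) (sΦ₁.sub sΦ).mul_right
    (fun x' t ht htb => by simp [hζ0 t ht htb])
  have hlhs : ∫ x', φ x' * (F (x' + h) - F x') =
      ∫ x', (Φ₁ (x', b) - Φ (x', b)) * ζ b * F x' := by
    have e1 : ∀ x', (Φ₁ (x', b) - Φ (x', b)) * ζ b * F x' = φ (x' - h) * F x' - φ x' * F x' := by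
      intro x'
      simp [hΦ₁def, hΦdef, unshear, hχb, hζb, sub_mul]
    simp_rw [e1, mul_sub]
    have i1 : Integrable fun x' => φ x' * F x' := hFL.integrable_mul hp hφ.continuous hφc
    have i2 : Integrable fun x' => φ (x' - h) * F x' := by
      refine hFL.integrable_mul hp (hφ.continuous.comp (continuous_id.sub continuous_const)) ?_
      exact hφc.comp_homeomorph (Homeomorph.subRight h)
    have i3 : Integrable fun x' => φ x' * F (x' + h) := by
      have := i2.comp_add_right h
      simpa using this
    have e2 : ∫ x', φ x' * F (x' + h) = ∫ x', φ (x' - h) * F x' := by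
      simpa using integral_add_right_eq_self (μ := volume) (fun x' => φ (x' - h) * F x') h
    rw [integral_sub i3 i1, integral_sub i2 i1, e2]
  -- The normal derivative of `φ(x' - χ(t) h)` is `-χ'` times a horizontal derivative, so what
  -- remains of `∂_N` can be integrated by parts tangentially, with no boundary contribution.
  have hdN : ∀ x, dirDeriv (fullDir d (Fin.last d)) (fun x => (Φ₁ x - Φ x) * ζ x.2) x =
      ∑ j : Fin d, h j * dirDeriv (fullDir d j.castSucc) (fun x => Φ x * (ζ x.2 * deriv χ x.2)) x := by
    intro x
    rw [dirDeriv_mul_comp_snd (ψ := fun x => Φ₁ x - Φ x) (dΦ₁.sub dΦ) (hζ.differentiable (by simp)),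
      dirDeriv_sub_apply dΦ₁ dΦ]
    have e1 : (Φ₁ x - Φ x) * (deriv ζ x.2 * (fullDir d (Fin.last d)).2) = 0 := by
      by_cases hz : deriv ζ x.2 = 0
      · simp [hz]
      · simp [hΦ₁def, hΦdef, unshear, hχζ _ hz]
    rw [e1, hΦdef, hΦ₁def, dirDeriv_unshear h hχ hφ, dirDeriv_unshear h contDiff_const hφ]
    have e2 : ∀ j : Fin d,
        dirDeriv (fullDir d j.castSucc) (fun x => unshear h χ φ x * (ζ x.2 * deriv χ x.2)) x =
        fderiv ℝ φ (x.1 - χ x.2 • h) (horDir d j) * (ζ x.2 * deriv χ x.2) := by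
      intro j
      rw [dirDeriv_mul_comp_snd (χ := fun t => ζ t * deriv χ t) dΦ (cζχ.differentiable (by simp)),
        dirDeriv_unshear h hχ hφ]
      simp
    simp_rw [e2]
    have e3 : fderiv ℝ φ (x.1 - χ x.2 • h) h =
        ∑ j : Fin d, h j * fderiv ℝ φ (x.1 - χ x.2 • h) (horDir d j) := by
      have := map_sum (fderiv ℝ φ (x.1 - χ x.2 • h)) (fun j => h j • horDir d j) Finset.univ
      simpa only [sum_horDir, map_smul, smul_eq_mul] using this
    simp only [fullDir_last, mul_one, deriv_const, zero_smul, sub_zero, map_zero, zero_sub, add_zero,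
      map_neg, map_smul, smul_eq_mul, neg_neg, e3, Finset.mul_sum, Finset.sum_mul]
    refine Finset.sum_congr rfl fun j _ => ?_
    ring
  have hloc : ∀ i, LocallyIntegrable ((strip d bm bp).indicator (g i)) := fun i =>
    (hgL i).locallyIntegrable hp1
  have cΨ : ContDiff ℝ 1 (fun x => Φ x * (ζ x.2 * deriv χ x.2)) :=
    (cΦ.mul (cζχ.comp contDiff_snd)).of_le (by simp)
  have htan : ∀ j : Fin d, ∫ x in strip d bm bp,
      v x * dirDeriv (fullDir d j.castSucc) (fun x => Φ x * (ζ x.2 * deriv χ x.2)) x =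
      - ∫ x in strip d bm bp, g j.castSucc x * (Φ x * (ζ x.2 * deriv χ x.2)) := fun j =>
    (hg j.castSucc).integral_strip_eq hv.indicator_locallyIntegrable (hloc _) cΨ sΦ.mul_right
      (fun hc => absurd hc (Fin.castSucc_lt_last j).ne)
  have iv : ∀ j : Fin d, IntegrableOn (fun x => v x *
      dirDeriv (fullDir d j.castSucc) (fun x => Φ x * (ζ x.2 * deriv χ x.2)) x) (strip d bm bp) :=
    fun j => (HorSupp.dirDeriv sΦ.mul_right _).integrableOn_strip hv.indicator_locallyIntegrable
      (ContDiff.continuous_dirDeriv cΨ _)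
  have hsum1 : ∫ x in strip d bm bp,
      v x * dirDeriv (fullDir d (Fin.last d)) (fun x => (Φ₁ x - Φ x) * ζ x.2) x =
      - ∑ j : Fin d, h j * ∫ x in strip d bm bp,
        g j.castSucc x * (Φ x * (ζ x.2 * deriv χ x.2)) := by
    simp_rw [hdN, Finset.mul_sum, mul_left_comm (v _)]
    rw [integral_finsetSum _ fun j _ => (iv j).const_mul (h j)]
    simp_rw [integral_const_mul, htan]
    simp
  -- The shear undoes the displacement in the test function and moves it onto the gradient.
  have cvar : ∀ (i : Fin (d + 1)) (k : ℝ → ℝ), ∫ x in strip d bm bp, g i x * (Φ x * k x.2) =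
      ∫ x in strip d bm bp, g i (shear h χ x) * (φ x.1 * k x.2) := by
    intro i k
    rw [← setIntegral_strip_comp_shear h hχc]
    congr 1; funext x
    rw [hΦdef, unshear_shear]; rfl
  have cvar₁ : ∀ (i : Fin (d + 1)) (k : ℝ → ℝ), ∫ x in strip d bm bp, g i x * (Φ₁ x * k x.2) =
      ∫ x in strip d bm bp, g i (shear h (fun _ => 1) x) * (φ x.1 * k x.2) := by
    intro i k
    rw [← setIntegral_strip_comp_shear h (continuous_const (y := (1 : ℝ)))]
    congr 1; funext x
    rw [hΦ₁def, unshear_shear]; rfl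
  have iφ : ∀ (k : ℝ → ℝ), Continuous k → ∀ (i : Fin (d + 1)) (γ : ℝ → ℝ), Continuous γ →
      IntegrableOn (fun x => g i (shear h γ x) * (φ x.1 * k x.2)) (strip d bm bp) := by
    intro k hk i γ hγ
    exact ((horSupp_comp_fst hφc).mul_right (f := fun x => k x.2)).integrableOn_strip
      (((hgL i).indicator_comp_shear h hγ).locallyIntegrable hp1)
      ((hφ.continuous.comp continuous_fst).mul (hk.comp continuous_snd))
  have hsum2 : ∫ x in strip d bm bp, g (Fin.last d) x * ((Φ₁ x - Φ x) * ζ x.2) =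
      (∫ x in strip d bm bp, g (Fin.last d) (shear h (fun _ => 1) x) * (φ x.1 * ζ x.2)) -
      ∫ x in strip d bm bp, g (Fin.last d) (shear h χ x) * (φ x.1 * ζ x.2) := by
    rw [← cvar, ← cvar₁, ← integral_sub]
    · congr 1; funext x; ring
    · exact (sΦ₁.mul_right (f := fun x => ζ x.2)).integrableOn_strip (hloc _)
        (cΦ₁.continuous.mul cζ.continuous)
    · exact (sΦ.mul_right (f := fun x => ζ x.2)).integrableOn_strip (hloc _)
        (cΦ.continuous.mul cζ.continuous)
  have hrhs : ∫ x', φ x' * ∫ t in Ioo bm bp, τ * pathIntegrand h χ ζ g (x', t) =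
      τ * ((∑ j : Fin d, h j * ∫ x in strip d bm bp,
        g j.castSucc (shear h χ x) * (φ x.1 * (ζ x.2 * deriv χ x.2))) +
        (∫ x in strip d bm bp, g (Fin.last d) (shear h χ x) * (φ x.1 * ζ x.2)) -
        ∫ x in strip d bm bp, g (Fin.last d) (shear h (fun _ => 1) x) * (φ x.1 * ζ x.2)) := by
    have j1 : ∀ j : Fin d, IntegrableOn (fun x => h j *
        (g j.castSucc (shear h χ x) * (φ x.1 * (ζ x.2 * deriv χ x.2)))) (strip d bm bp) := fun j =>
      (iφ _ cζχ.continuous j.castSucc χ hχc).const_mul (h j)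
    have j2 := iφ ζ hζc (Fin.last d) χ hχc
    have j3 := iφ ζ hζc (Fin.last d) (fun _ => 1) continuous_const
    have j1s : IntegrableOn (fun x => ∑ j : Fin d, h j *
        (g j.castSucc (shear h χ x) * (φ x.1 * (ζ x.2 * deriv χ x.2)))) (strip d bm bp) :=
      integrable_finsetSum _ fun j _ => j1 j
    have k1 : ∫ x in strip d bm bp, ∑ j : Fin d, h j *
        (g j.castSucc (shear h χ x) * (φ x.1 * (ζ x.2 * deriv χ x.2))) =
        ∑ j : Fin d, h j * ∫ x in strip d bm bp,
          g j.castSucc (shear h χ x) * (φ x.1 * (ζ x.2 * deriv χ x.2)) := by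
      rw [integral_finsetSum _ fun j _ => j1 j]
      simp_rw [integral_const_mul]
    have k2 := integral_add j1s j2
    have k3 := integral_sub (j1s.add j2) j3
    have k4 := (setIntegral_strip (((j1s.add j2).sub j3).const_mul τ)).symm.trans
      (integral_const_mul τ _)
    simp only [Pi.add_apply, Pi.sub_apply] at k2 k3 k4
    rw [← k1, ← k2, ← k3, ← k4]
    congr 1; funext x'
    rw [← integral_const_mul]
    congr 1; funext t
    simp only [pathIntegrand]
    have : ∀ j : Fin d, h j * (g j.castSucc (shear h χ (x', t)) * (φ x' * (ζ t * deriv χ t))) =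
        φ x' * (g j.castSucc (shear h χ (x', t)) * (ζ t * deriv χ t * h j)) := fun j => by ring
    simp_rw [this]
    rw [← Finset.mul_sum]
    ring
  rw [hlhs, hrhs]
  refine hside.trans ?_
  rw [hsum1, hsum2]
  have cv : ∀ j : Fin d, ∫ x in strip d bm bp, g j.castSucc x * (Φ x * (ζ x.2 * deriv χ x.2)) =
      ∫ x in strip d bm bp, g j.castSucc (shear h χ x) * (φ x.1 * (ζ x.2 * deriv χ x.2)) :=
    fun j => cvar j.castSucc (fun t => ζ t * deriv χ t)
  simp_rw [cv]
  ring

end DifferenceIdentity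

/-! ### Cutoffs for the paths, and two weight integrals -/

section Cutoffs

/-- In terms of the relative depth `τ (t - b) / r`, `χ` rises on `[0, 1/2]` and `ζ` falls on `[1/2,
1]`, so the paths have met before `ζ` changes. Rescaling fixed steps makes `C` independent of `b`,
`τ` and `r`. -/
theorem exists_path_cutoffs : ∃ C : ℝ, 0 ≤ C ∧ ∀ b τ r : ℝ, 0 < r → |τ| = 1 →
    ∃ χ ζ : ℝ → ℝ, ContDiff ℝ ∞ χ ∧ ContDiff ℝ ∞ ζ ∧ χ b = 0 ∧ ζ b = 1 ∧
      (∀ t, r ≤ τ * (t - b) → ζ t = 0) ∧ (∀ t, χ t ∈ Icc (0 : ℝ) 1) ∧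
      (∀ t, deriv ζ t ≠ 0 → χ t = 1) ∧ (∀ t, |deriv χ t| ≤ C / r) ∧ ∀ t, |ζ t| ≤ 1 := by
  obtain ⟨Θ₁, h₁⟩ := exists_isStep (show (0 : ℝ) < 1 / 2 by norm_num)
  obtain ⟨Θ₂, h₂⟩ := exists_isStep (show (1 / 2 : ℝ) < 1 by norm_num)
  obtain ⟨C, hC⟩ := h₁.exists_deriv_bound
  refine ⟨C, (abs_nonneg _).trans (hC 0), fun b τ r hr hτ => ?_⟩
  have hd : ∀ {Θ : ℝ → ℝ}, ContDiff ℝ ∞ Θ → ∀ t,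
      HasDerivAt (fun t => Θ (τ * (t - b) / r)) (deriv Θ (τ * (t - b) / r) * (τ / r)) t := by
    intro Θ hΘ t
    have h1 : HasDerivAt (fun t : ℝ => τ * (t - b) / r) (τ / r) t := by
      simpa using ((((hasDerivAt_id t).sub_const b).const_mul τ).div_const r)
    exact ((hΘ.differentiable (by simp)) _).hasDerivAt.comp t h1
  refine ⟨fun t => Θ₁ (τ * (t - b) / r), fun t => 1 - Θ₂ (τ * (t - b) / r),
    h₁.contDiff.comp (by fun_prop), contDiff_const.sub (h₂.contDiff.comp (by fun_prop)),
    ?_, ?_, ?_, fun t => ⟨h₁.nonneg _, h₁.le_one _⟩, ?_, ?_, ?_⟩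
  · simpa using h₁.eq_zero 0 le_rfl
  · simpa using h₂.eq_zero 0 (by norm_num)
  · intro t ht
    simp [h₂.eq_one _ ((one_le_div hr).2 ht)]
  · intro t ht
    refine h₁.eq_one _ ?_
    by_contra! hc
    refine ht ?_
    rw [((hd h₂.contDiff t).const_sub 1).deriv, h₂.deriv_eq_zero_of_lt hc]
    simp
  · intro t
    rw [(hd h₁.contDiff t).deriv, abs_mul, abs_div, hτ, abs_of_pos hr, mul_one_div]
    exact div_le_div_of_nonneg_right (hC _) hr.le
  · intro t
    have := h₂.nonneg (τ * (t - b) / r)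
    have := h₂.le_one (τ * (t - b) / r)
    rw [abs_le]
    constructor <;> linarith

theorem lintegral_comp_mul_sub {τ : ℝ} (hτ : |τ| = 1) (b : ℝ) (φ : ℝ → ℝ≥0∞) :
    ∫⁻ t, φ (τ * (t - b)) = ∫⁻ t, φ t := by
  rcases eq_or_eq_neg_of_abs_eq hτ with rfl | rfl
  · simpa using lintegral_sub_right_eq_self φ b
  · have : ∀ t, -1 * (t - b) = b - t := fun t => by ring
    simp_rw [this]
    exact lintegral_sub_left_eq_self φ b

theorem lintegral_Ioo_rpow_neg_half {r : ℝ} (hr : 0 < r) :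
    ∫⁻ s in Ioo 0 r, ENNReal.ofReal (s ^ (-(1 / 2) : ℝ)) = ENNReal.ofReal (2 * r ^ (1 / 2 : ℝ)) := by
  have h1 : IntervalIntegrable (fun s : ℝ => s ^ (-(1 / 2) : ℝ)) volume 0 r :=
    intervalIntegral.intervalIntegrable_rpow' (by norm_num)
  rw [intervalIntegrable_iff_integrableOn_Ioo_of_le hr.le] at h1
  rw [← ofReal_integral_eq_lintegral_ofReal h1]
  · congr 1
    rw [← integral_Ioc_eq_integral_Ioo, ← intervalIntegral.integral_of_le hr.le,
      integral_rpow (Or.inl (by norm_num))]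
    norm_num
    ring
  · filter_upwards [ae_restrict_mem measurableSet_Ioo] with s hs
    exact Real.rpow_nonneg hs.1.le _

/-- The dilation `h ↦ s h` reduces to `s = 1`; there `‖h‖ ≥ (1 + ‖h‖) / 2`, and `(1 + ‖h‖)^{-(d +
β)}` is integrable. -/
theorem exists_lintegral_norm_rpow_le (d : ℕ) {β : ℝ} (hβ : 0 < β) : ∃ C : ℝ, 0 ≤ C ∧
    ∀ s : ℝ, 0 < s → ∫⁻ h : Hor d, (Ioi s).indicator (fun r => ENNReal.ofReal (r ^ (-(d + β)))) ‖h‖ ≤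
      ENNReal.ofReal (C * s ^ (-β)) := by
  set Φ : ℝ → Hor d → ℝ≥0∞ := fun s h =>
    (Ioi s).indicator (fun r => ENNReal.ofReal (r ^ (-(d + β)))) ‖h‖ with hΦ
  have hmeas : ∀ s, Measurable (Φ s) := fun s =>
    (Measurable.indicator (by fun_prop) measurableSet_Ioi).comp measurable_norm
  have hfin : ∫⁻ h, Φ 1 h < ⊤ := by
    have h1 := finite_integral_one_add_norm (E := Hor d) (μ := volume) (r := d + β) (by simpa using hβ)
    have h2 : ∫⁻ h : Hor d, ENNReal.ofReal (2 ^ (d + β)) * ENNReal.ofReal ((1 + ‖h‖) ^ (-(d + β))) < ⊤ := by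
      rw [lintegral_const_mul' _ _ ENNReal.ofReal_ne_top]
      exact ENNReal.mul_lt_top ENNReal.ofReal_lt_top h1
    refine (lintegral_mono fun h => ?_).trans_lt h2
    by_cases hh : ‖h‖ ∈ Ioi (1 : ℝ)
    · simp only [hΦ, indicator_of_mem hh]
      rw [← ENNReal.ofReal_mul (by positivity)]
      apply ENNReal.ofReal_le_ofReal
      have h3 : (1 + ‖h‖) / 2 ≤ ‖h‖ := by linarith [mem_Ioi.1 hh]
      have h4 := Real.rpow_le_rpow_of_nonpos (by positivity) h3
        (show -((d : ℝ) + β) ≤ 0 by have : (0 : ℝ) ≤ d := d.cast_nonneg; linarith)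
      refine h4.trans (le_of_eq ?_)
      rw [Real.div_rpow (by positivity) (by norm_num), Real.rpow_neg (by norm_num : (0 : ℝ) ≤ 2),
        div_inv_eq_mul, mul_comm]
    · simp [hΦ, indicator_of_notMem hh]
  refine ⟨(∫⁻ h, Φ 1 h).toReal, ENNReal.toReal_nonneg, fun s hs => le_of_eq ?_⟩
  rw [ENNReal.ofReal_mul ENNReal.toReal_nonneg, ENNReal.ofReal_toReal hfin.ne]
  have hmap := Measure.map_addHaar_smul (volume : Measure (Hor d)) hs.ne'
  have h1 : ∫⁻ h, Φ s h ∂(Measure.map (s • ·) volume) = ∫⁻ h, Φ s (s • h) :=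
    lintegral_map (hmeas s) (measurable_const_smul s)
  have h2 : ∀ h, Φ s (s • h) = ENNReal.ofReal (s ^ (-(d + β))) * Φ 1 h := by
    intro h
    simp only [hΦ, norm_smul, Real.norm_of_nonneg hs.le, indicator_apply, mem_Ioi]
    have : s < s * ‖h‖ ↔ 1 < ‖h‖ := by
      constructor
      · intro hh; nlinarith
      · intro hh; nlinarith
    simp only [this]
    split_ifs
    · rw [Real.mul_rpow hs.le (norm_nonneg _), ENNReal.ofReal_mul (by positivity)]
    · simp
  have hpos : 0 < s ^ d := by positivity
  rw [hmap, lintegral_smul_measure] at h1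
  simp_rw [h2] at h1
  rw [lintegral_const_mul' _ _ ENNReal.ofReal_ne_top] at h1
  simp only [finrank_euclideanSpace, Fintype.card_fin, smul_eq_mul, abs_of_pos (inv_pos.2 hpos)] at h1
  calc ∫⁻ h, Φ s h = ENNReal.ofReal (s ^ d) * (ENNReal.ofReal (s ^ d)⁻¹ * ∫⁻ h, Φ s h) := by
        rw [← mul_assoc, ← ENNReal.ofReal_mul hpos.le, mul_inv_cancel₀ hpos.ne']
        simp
    _ = _ := by
        rw [h1, ← mul_assoc, ← ENNReal.ofReal_mul hpos.le, mul_comm]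
        congr 2
        rw [neg_add, Real.rpow_add hs, Real.rpow_neg hs.le, Real.rpow_natCast, ← mul_assoc,
          mul_inv_cancel₀ hpos.ne', one_mul]

end Cutoffs

/-! ### Pointwise bound for the path integrand -/

section PathBound

variable {d : ℕ}

/-- The slope `C / ‖h‖` of `χ` cancels `|h j| ≤ ‖h‖`: the path covers the distance `‖h‖` while
descending a comparable depth. -/
theorem abs_pathIntegrand_le {h : Hor d} {χ ζ : ℝ → ℝ} {C : ℝ} (hC : 0 ≤ C) (hh : h ≠ 0)
    (hχ : ∀ t, |deriv χ t| ≤ C / ‖h‖) (hζ : ∀ t, |ζ t| ≤ 1) (g : Fin (d + 1) → Full d → ℝ)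
    (x : Full d) : |pathIntegrand h χ ζ g x| ≤
      (C + 1) * (∑ i, |g i (shear h χ x)| + ∑ i, |g i (shear h (fun _ => 1) x)|) := by
  have hr : 0 < ‖h‖ := norm_pos_iff.2 hh
  have h1 : |∑ j : Fin d, g j.castSucc (shear h χ x) * (ζ x.2 * deriv χ x.2 * h j)| ≤
      ∑ j : Fin d, C * |g j.castSucc (shear h χ x)| := by
    refine (Finset.abs_sum_le_sum_abs _ _).trans (Finset.sum_le_sum fun j _ => ?_)
    rw [abs_mul, abs_mul, abs_mul, mul_comm]
    refine mul_le_mul_of_nonneg_right ?_ (abs_nonneg _)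
    have e1 : |h j| ≤ ‖h‖ := by simpa using PiLp.norm_apply_le h j
    calc |ζ x.2| * |deriv χ x.2| * |h j| ≤ 1 * (C / ‖h‖) * ‖h‖ := by
          gcongr
          · exact hζ _
          · exact hχ _
      _ = C := by field_simp
  have h2 : ∀ y, |g (Fin.last d) y * ζ x.2| ≤ |g (Fin.last d) y| := fun y => by
    rw [abs_mul]
    exact mul_le_of_le_one_right (abs_nonneg _) (hζ _)
  have h3 : |pathIntegrand h χ ζ g x| ≤ (∑ j : Fin d, C * |g j.castSucc (shear h χ x)|) +
      |g (Fin.last d) (shear h χ x)| + |g (Fin.last d) (shear h (fun _ => 1) x)| := by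
    unfold pathIntegrand
    refine (abs_sub _ _).trans ?_
    have := abs_add_le (∑ j : Fin d, g j.castSucc (shear h χ x) * (ζ x.2 * deriv χ x.2 * h j))
      (g (Fin.last d) (shear h χ x) * ζ x.2)
    linarith [h2 (shear h χ x), h2 (shear h (fun _ => 1) x)]
  refine h3.trans ?_
  rw [Fin.sum_univ_castSucc, Fin.sum_univ_castSucc, ← Finset.mul_sum]
  have n1 : 0 ≤ ∑ j : Fin d, |g j.castSucc (shear h χ x)| := Finset.sum_nonneg fun _ _ => abs_nonneg _
  have n2 : 0 ≤ ∑ j : Fin d, |g j.castSucc (shear h (fun _ => 1) x)| :=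
    Finset.sum_nonneg fun _ _ => abs_nonneg _
  have n3 := abs_nonneg (g (Fin.last d) (shear h χ x))
  have n4 := abs_nonneg (g (Fin.last d) (shear h (fun _ => 1) x))
  nlinarith [mul_nonneg hC n2, mul_nonneg hC n3, mul_nonneg hC n4]

end PathBound

/-! ### Gagliardo's estimate for the screened seminorm -/

section Gagliardo

variable {d : ℕ} {bm bp p : ℝ}

theorem IsSide.pos {f : (Hor d → ℝ) × (Hor d → ℝ)} {b τ : ℝ} {F : Hor d → ℝ}
    (hs : IsSide bm bp f b τ F) {t : ℝ} (ht : t ∈ Ioo bm bp) : 0 < τ * (t - b) := by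
  rcases hs with ⟨rfl, rfl, rfl⟩ | ⟨rfl, rfl, rfl⟩
  · linarith [ht.1]
  · linarith [ht.2]

theorem IsSide.eq_width (hb : bm < bp) {f : (Hor d → ℝ) × (Hor d → ℝ)} {b τ : ℝ} {F : Hor d → ℝ}
    (hs : IsSide bm bp f b τ F) {t : ℝ} (ht : t ∈ ({bm, bp} : Set ℝ)) (htb : t ≠ b) :
    τ * (t - b) = bp - bm := by
  rcases hs with ⟨rfl, rfl, rfl⟩ | ⟨rfl, rfl, rfl⟩ <;>
  · rcases ht with rfl | rfl
    · first | exact absurd rfl htb | ring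
    · first | exact absurd rfl htb | ring

/-- An estimate of a weighted integral by Hölder's inequality with a singular weight. -/
theorem rpow_setLIntegral_le (hp : 1 < p) {τ b r : ℝ} (hτ : |τ| = 1) (hr : 0 < r) {I : Set ℝ}
    (hI : MeasurableSet I) (hIr : ∀ t ∈ I, τ * (t - b) ∈ Ioo 0 r) {Q : ℝ → ℝ≥0∞}
    (hQ : Measurable Q) :
    (∫⁻ t in I, Q t) ^ p ≤ ENNReal.ofReal (2 ^ (p - 1) * r ^ ((p - 1) / 2)) *
      ∫⁻ t in I, ENNReal.ofReal ((τ * (t - b)) ^ ((p - 1) / 2)) * Q t ^ p := by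
  have hpq := Real.HolderConjugate.conjExponent hp
  set q := p.conjExponent
  have hq0 := hpq.symm.pos
  -- Any `0 < a < 1 / q` keeps the weight `s^{-aq}` integrable at `0`. This choice makes it
  -- `s^{-1/2}`, with integral `2 r^{1/2}` over `(0, r)`, and leaves `s^{(p-1)/2}` on the other
  -- factor.
  set a := 1 / (2 * q) with ha
  have haq : a * q = 1 / 2 := by rw [ha]; field_simp
  have hap : a * p = (p - 1) / 2 := by
    rw [← hpq.div_conj_eq_sub_one, ha]; field_simp
  have h1 : ∫⁻ t in I, Q t = ∫⁻ t in I, ENNReal.ofReal ((τ * (t - b)) ^ (-a)) *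
      (ENNReal.ofReal ((τ * (t - b)) ^ a) * Q t) := by
    refine setLIntegral_congr_fun hI fun t ht => ?_
    have h0 := (hIr t ht).1
    show Q t = _
    rw [← mul_assoc, ← ENNReal.ofReal_mul (by positivity), ← Real.rpow_add h0]
    simp
  rw [h1]
  refine (lintegral_mul_rpow_le hpq (by fun_prop) (by fun_prop)).trans ?_
  refine mul_le_mul' ?_ ?_
  · have h2 : ∫⁻ t in I, ENNReal.ofReal ((τ * (t - b)) ^ (-a)) ^ q ≤
        ENNReal.ofReal (2 * r ^ (1 / 2 : ℝ)) := by
      rw [← lintegral_Ioo_rpow_neg_half hr, ← lintegral_indicator measurableSet_Ioo,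
        ← lintegral_comp_mul_sub hτ b, ← lintegral_indicator hI]
      refine lintegral_mono fun t => ?_
      by_cases ht : t ∈ I
      · have h0 := (hIr t ht).1
        rw [indicator_of_mem ht, indicator_of_mem (hIr t ht),
          ENNReal.ofReal_rpow_of_nonneg (by positivity) hq0.le, ← Real.rpow_mul h0.le, neg_mul, haq]
      · simp [indicator_of_notMem ht]
    refine (ENNReal.rpow_le_rpow h2 (div_nonneg hpq.nonneg hq0.le)).trans (le_of_eq ?_)
    rw [hpq.div_conj_eq_sub_one, ENNReal.ofReal_rpow_of_nonneg (by positivity) (by linarith),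
      Real.mul_rpow (by norm_num) (by positivity), ← Real.rpow_mul hr.le]
    congr 3
    ring
  · refine le_of_eq (setLIntegral_congr_fun hI fun t ht => ?_)
    have h0 := (hIr t ht).1
    show (_ * _) ^ p = _
    rw [ENNReal.mul_rpow_of_nonneg _ _ hpq.nonneg,
      ENNReal.ofReal_rpow_of_nonneg (by positivity) hpq.nonneg, ← Real.rpow_mul h0.le, hap]

/-- Path representation, weighted Hölder in the depth, then integration in `x'`. The weight at small
depth is retained because it makes the later integration in `h` converge. -/
theorem exists_lintegral_trace_sub_rpow_le (hp : 1 < p) : ∃ C : ℝ, 0 ≤ C ∧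
    ∀ (bm bp : ℝ), bm < bp → ∀ (v : Full d → ℝ) (f : (Hor d → ℝ) × (Hor d → ℝ)),
    IsStripTrace bm bp p v f → ∀ g : Fin (d + 1) → Full d → ℝ,
    (∀ i, IsWeakDeriv (fullDir d) (strip d bm bp) (Pi.single i 1) v (g i)) →
    (∀ i, LpLoc (ENNReal.ofReal p) ((strip d bm bp).indicator (g i))) →
    (∀ i, Measurable (g i)) → ∀ (b τ : ℝ) (F : Hor d → ℝ), IsSide bm bp f b τ F →
    ∀ h : Hor d, h ≠ 0 → ‖h‖ < bp - bm →
    ∫⁻ x', ‖F (x' + h) - F x'‖ₑ ^ p ≤ ENNReal.ofReal (C * ‖h‖ ^ ((p - 1) / 2)) *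
      ∫⁻ t in Ioo bm bp, (Iio ‖h‖).indicator (fun s => ENNReal.ofReal (s ^ ((p - 1) / 2)))
        (τ * (t - b)) * ∫⁻ x' : Hor d, (∑ i, ‖g i (x', t)‖ₑ) ^ p := by
  obtain ⟨C, hC, hcut⟩ := exists_path_cutoffs
  -- The factors come from the weighted Hölder inequality, the path bound, convexity of the `p`-th
  -- power, and the two paths.
  refine ⟨2 ^ (p - 1) * ((C + 1) ^ p * (2 ^ (p - 1) * 2)), by positivity, ?_⟩
  intro bm bp hb v f hv g hg hgL hgm b τ F hs h hh hhL
  have hp0 : 0 < p := by linarith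
  have hr : 0 < ‖h‖ := norm_pos_iff.2 hh
  obtain ⟨χ, ζ, hχ, hζ, hχb, hζb, hζr, hχI, hχζ, hχC, hζ1⟩ := hcut b τ ‖h‖ hr hs.sq_eq
  have hχc := hχ.continuous
  set I : Set ℝ := Ioo bm bp ∩ {t | τ * (t - b) < ‖h‖} with hIdef
  have hI : MeasurableSet I := measurableSet_Ioo.inter
    (measurableSet_lt (by fun_prop) measurable_const)
  set A : (ℝ → ℝ) → Full d → ℝ≥0∞ := fun γ x => ∑ i, ‖g i (shear h γ x)‖ₑ with hA
  have hAm : ∀ γ, Continuous γ → Measurable (A γ) := fun γ hγ =>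
    Finset.measurable_fun_sum _ fun i _ =>
      ((hgm i).comp (continuous_shear h hγ).measurable).enorm
  set Q : Full d → ℝ≥0∞ := fun x => ENNReal.ofReal (C + 1) * (A χ x + A (fun _ => 1) x) with hQ
  have hQm : Measurable Q := ((hAm χ hχc).add (hAm _ continuous_const)).const_mul _
  have hrep := trace_sub_ae_eq hb hp hv hg hgL hs h hχ hζ hχb hζb
    (fun t ht htb => hζr t (by rw [hs.eq_width hb ht htb]; exact hhL.le)) hχI hχζ
  have hpt : ∀ x' t, t ∈ Ioo bm bp → ‖τ * pathIntegrand h χ ζ g (x', t)‖ₑ ≤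
      I.indicator (fun t => Q (x', t)) t := by
    intro x' t ht
    rw [enorm_mul, Real.enorm_eq_ofReal_abs τ, hs.sq_eq, ENNReal.ofReal_one, one_mul]
    by_cases htr : τ * (t - b) < ‖h‖
    · rw [indicator_of_mem (show t ∈ I from ⟨ht, htr⟩), Real.enorm_eq_ofReal_abs]
      refine (ENNReal.ofReal_le_ofReal (abs_pathIntegrand_le hC hh hχC hζ1 g (x', t))).trans
        (le_of_eq ?_)
      rw [ENNReal.ofReal_mul (by positivity), ENNReal.ofReal_add
        (Finset.sum_nonneg fun _ _ => abs_nonneg _) (Finset.sum_nonneg fun _ _ => abs_nonneg _),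
        ENNReal.ofReal_sum_of_nonneg fun _ _ => abs_nonneg _,
        ENNReal.ofReal_sum_of_nonneg fun _ _ => abs_nonneg _]
      simp only [hQ, hA, Real.enorm_eq_ofReal_abs]
    · simp [pathIntegrand, hζr t (not_lt.1 htr)]
  have hle : ∀ᵐ x' : Hor d, ‖F (x' + h) - F x'‖ₑ ^ p ≤
      ENNReal.ofReal (2 ^ (p - 1) * ‖h‖ ^ ((p - 1) / 2)) *
        ∫⁻ t in I, ENNReal.ofReal ((τ * (t - b)) ^ ((p - 1) / 2)) * Q (x', t) ^ p := by
    filter_upwards [hrep] with x' hx'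
    rw [hx']
    have h1 : ‖∫ t in Ioo bm bp, τ * pathIntegrand h χ ζ g (x', t)‖ₑ ≤ ∫⁻ t in I, Q (x', t) := by
      refine (enorm_integral_le_lintegral_enorm _).trans ?_
      refine (setLIntegral_mono' measurableSet_Ioo fun t ht => hpt x' t ht).trans (le_of_eq ?_)
      rw [lintegral_indicator hI, Measure.restrict_restrict hI, inter_eq_left.2 inter_subset_left]
    refine (ENNReal.rpow_le_rpow h1 hp0.le).trans ?_
    exact rpow_setLIntegral_le hp hs.sq_eq hr hI (fun t ht => ⟨hs.pos ht.1, ht.2⟩)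
      (hQm.comp measurable_prodMk_left)
  refine (lintegral_mono_ae hle).trans ?_
  rw [lintegral_const_mul' _ _ ENNReal.ofReal_ne_top, lintegral_lintegral_swap
    (by apply Measurable.aemeasurable; unfold Function.uncurry; fun_prop)]
  -- At fixed depth a shear is a translation in `x'`, so it disappears from the integral.
  have hΓ : ∀ γ t, ∫⁻ x' : Hor d, A γ (x', t) ^ p = ∫⁻ x' : Hor d, (∑ i, ‖g i (x', t)‖ₑ) ^ p :=
    fun γ t => lintegral_add_right_eq_self (fun x' : Hor d => (∑ i, ‖g i (x', t)‖ₑ) ^ p) (γ t • h)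
  have hin : ∀ t, ∫⁻ x' : Hor d, ENNReal.ofReal ((τ * (t - b)) ^ ((p - 1) / 2)) * Q (x', t) ^ p ≤
      ENNReal.ofReal ((C + 1) ^ p * (2 ^ (p - 1) * 2)) *
        (ENNReal.ofReal ((τ * (t - b)) ^ ((p - 1) / 2)) *
          ∫⁻ x' : Hor d, (∑ i, ‖g i (x', t)‖ₑ) ^ p) := by
    intro t
    rw [lintegral_const_mul' _ _ ENNReal.ofReal_ne_top, mul_left_comm]
    gcongr
    calc ∫⁻ x' : Hor d, Q (x', t) ^ p ≤ ∫⁻ x' : Hor d, ENNReal.ofReal ((C + 1) ^ p) *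
          (ENNReal.ofReal (2 ^ (p - 1)) * (A χ (x', t) ^ p + A (fun _ => 1) (x', t) ^ p)) := by
          refine lintegral_mono fun x' => ?_
          simp only [hQ]
          rw [ENNReal.mul_rpow_of_nonneg _ _ hp0.le,
            ENNReal.ofReal_rpow_of_nonneg (by positivity) hp0.le]
          gcongr
          refine (ENNReal.rpow_add_le_mul_rpow_add_rpow _ _ hp.le).trans (le_of_eq ?_)
          rw [← ENNReal.ofReal_rpow_of_nonneg (by norm_num) (by linarith)]
          simp
      _ = _ := by
          rw [lintegral_const_mul' _ _ ENNReal.ofReal_ne_top,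
            lintegral_const_mul' _ _ ENNReal.ofReal_ne_top, lintegral_add_left, hΓ, hΓ, ← two_mul,
            ENNReal.ofReal_mul (by positivity), ENNReal.ofReal_mul (by positivity)]
          · simp [mul_assoc]
          · exact ((hAm χ hχc).comp measurable_prodMk_right).pow_const p
  refine (mul_le_mul_right (lintegral_mono hin) _).trans ?_
  rw [lintegral_const_mul' _ _ ENNReal.ofReal_ne_top, ← mul_assoc,
    ← ENNReal.ofReal_mul (by positivity)]
  refine le_of_eq ?_
  congr 1
  · congr 1; ring
  · rw [hIdef, inter_comm, ← Measure.restrict_restrict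
      (measurableSet_lt (by fun_prop) measurable_const),
      ← lintegral_indicator (measurableSet_lt (by fun_prop) measurable_const)]
    congr 1; funext t
    by_cases ht : τ * (t - b) < ‖h‖
    · rw [indicator_of_mem (show t ∈ {t | τ * (t - b) < ‖h‖} from ht), indicator_of_mem (mem_Iio.2 ht)]
    · rw [indicator_of_notMem (show t ∉ {t | τ * (t - b) < ‖h‖} from ht),
        indicator_of_notMem (by simpa using ht), zero_mul]

theorem aemeasurable_differenceQuotient {F : Hor d → ℝ} (hF : AEMeasurable F) :
    AEMeasurable (fun z : Hor d × Hor d =>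
      ENNReal.ofReal (|F (z.1 + z.2) - F z.1| ^ p / ‖z.2‖ ^ (p + d - 1)))
      ((volume : Measure (Hor d)).prod volume) := by
  have h1 : AEMeasurable (fun z : Hor d × Hor d => F (z.1 + z.2))
      ((volume : Measure (Hor d)).prod volume) :=
    hF.comp_quasiMeasurePreserving
      (Measure.quasiMeasurePreserving_snd.comp
        (measurePreserving_prod_add (volume : Measure (Hor d)) volume).quasiMeasurePreserving)
  have h2 : AEMeasurable (fun z : Hor d × Hor d => F z.1)
      ((volume : Measure (Hor d)).prod volume) :=
    hF.comp_quasiMeasurePreserving Measure.quasiMeasurePreserving_fst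
  exact (((h1.sub h2).norm.pow_const p).div (by fun_prop)).ennreal_ofReal

/-- Tonelli puts the `h`-integral innermost. With `s` the depth and `β = (p - 1) / 2`, the integral
of `‖h‖^{-(d + β)}` over `‖h‖ > s` is at most a constant times `s^{-β}`, which cancels the weight
`s^β`. -/
theorem exists_screenedSeminormScalar_le_of_measurable (hp : 1 < p) : ∃ C : ℝ, 0 ≤ C ∧
    ∀ (bm bp : ℝ), bm < bp → ∀ (v : Full d → ℝ) (f : (Hor d → ℝ) × (Hor d → ℝ)),
    IsStripTrace bm bp p v f → ∀ g : Fin (d + 1) → Full d → ℝ,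
    (∀ i, IsWeakDeriv (fullDir d) (strip d bm bp) (Pi.single i 1) v (g i)) →
    (∀ i, LpLoc (ENNReal.ofReal p) ((strip d bm bp).indicator (g i))) →
    (∀ i, Measurable (g i)) → ∀ (b τ : ℝ) (F : Hor d → ℝ), IsSide bm bp f b τ F →
    screenedSeminormScalar (bp - bm) p F ≤
      ENNReal.ofReal C * ∫⁻ x in strip d bm bp, (∑ i, ‖g i x‖ₑ) ^ p := by
  obtain ⟨C, hC, hCle⟩ := exists_lintegral_trace_sub_rpow_le (d := d) hp
  have hβ : 0 < (p - 1) / 2 := by linarith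
  have hp0 : 0 < p := by linarith
  obtain ⟨K, hK, hKle⟩ := exists_lintegral_norm_rpow_le d hβ
  refine ⟨C * K, by positivity, ?_⟩
  intro bm bp hb v f hv g hg hgL hgm b τ F hs
  set β := (p - 1) / 2 with hβdef
  set Γ : ℝ → ℝ≥0∞ := fun t => ∫⁻ x' : Hor d, (∑ i, ‖g i (x', t)‖ₑ) ^ p with hΓ
  have hgm' : Measurable fun x => (∑ i, ‖g i x‖ₑ) ^ p :=
    (Finset.measurable_fun_sum _ fun i _ => (hgm i).enorm).pow_const p
  have hΓm : Measurable Γ := by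
    have : Measurable (Function.uncurry fun (t : ℝ) (x' : Hor d) => (∑ i, ‖g i (x', t)‖ₑ) ^ p) :=
      hgm'.comp measurable_swap
    exact this.lintegral_prod_right
  have hFm : AEMeasurable F := (hs.memLpLoc hv).locallyIntegrable hp |>.aestronglyMeasurable.aemeasurable
  have hker : ∀ (h : Hor d) (y : ℝ), ENNReal.ofReal (|y| ^ p / ‖h‖ ^ (p + d - 1)) =
      ENNReal.ofReal ((‖h‖ ^ (p + d - 1))⁻¹) * ‖y‖ₑ ^ p := fun h y => by
    rw [Real.enorm_eq_ofReal_abs, ENNReal.ofReal_rpow_of_nonneg (abs_nonneg _) hp0.le,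
      ← ENNReal.ofReal_mul (by positivity), div_eq_inv_mul]
  have hinner : ∀ h ∈ Metric.ball (0 : Hor d) (bp - bm),
      ∫⁻ x', ENNReal.ofReal (|F (x' + h) - F x'| ^ p / ‖h‖ ^ (p + d - 1)) ≤
      ENNReal.ofReal C * ∫⁻ t in Ioo bm bp, ENNReal.ofReal ((τ * (t - b)) ^ β) * Γ t *
        (Ioi (τ * (t - b))).indicator (fun r => ENNReal.ofReal (r ^ (-(d + β)))) ‖h‖ := by
    intro h hh
    have hhL : ‖h‖ < bp - bm := by simpa using hh
    rcases eq_or_ne h 0 with rfl | h0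
    · simp [Real.zero_rpow hp0.ne']
    have hr : 0 < ‖h‖ := norm_pos_iff.2 h0
    simp_rw [hker]
    rw [lintegral_const_mul' _ _ ENNReal.ofReal_ne_top]
    refine (mul_le_mul_right (hCle bm bp hb v f hv g hg hgL hgm b τ F hs h h0 hhL) _).trans ?_
    rw [← mul_assoc, ← ENNReal.ofReal_mul (by positivity)]
    -- The exponents combine since `p - 1 = 2 β`.
    have e1 : (‖h‖ ^ (p + d - 1))⁻¹ * (C * ‖h‖ ^ β) = C * ‖h‖ ^ (-(d + β)) := by
      rw [← Real.rpow_neg hr.le, mul_left_comm, ← Real.rpow_add hr]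
      congr 2
      rw [hβdef]; ring
    rw [e1, ENNReal.ofReal_mul hC, mul_assoc, ← lintegral_const_mul' _ _ ENNReal.ofReal_ne_top]
    refine mul_le_mul_right (lintegral_mono fun t => ?_) _
    dsimp only
    by_cases ht : τ * (t - b) < ‖h‖
    · rw [indicator_of_mem (mem_Iio.2 ht), indicator_of_mem (mem_Ioi.2 ht)]
      exact le_of_eq (by ring)
    · rw [indicator_of_notMem (by simpa using ht)]
      simp
  unfold screenedSeminormScalar
  rw [lintegral_lintegral_swap]
  · refine (setLIntegral_mono' Metric.isOpen_ball.measurableSet hinner).trans ?_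
    rw [lintegral_const_mul' _ _ ENNReal.ofReal_ne_top, ENNReal.ofReal_mul hC, mul_assoc]
    refine mul_le_mul_right ?_ _
    have hwm : Measurable (fun z : Hor d × ℝ => (Ioi (τ * (z.2 - b))).indicator
        (fun r => ENNReal.ofReal (r ^ (-(d + β)))) ‖z.1‖) := by
      have hset : MeasurableSet {z : Hor d × ℝ | τ * (z.2 - b) < ‖z.1‖} :=
        measurableSet_lt (by fun_prop) (by fun_prop)
      have : Measurable fun z : Hor d × ℝ => ENNReal.ofReal (‖z.1‖ ^ (-(d + β))) := by fun_prop
      exact this.indicator hset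
    rw [lintegral_lintegral_swap]
    · calc _ ≤ ∫⁻ t in Ioo bm bp, ENNReal.ofReal K * Γ t := by
            refine setLIntegral_mono' measurableSet_Ioo fun t ht => ?_
            have h0 := hs.pos ht
            rw [lintegral_const_mul (f := fun h : Hor d => (Ioi (τ * (t - b))).indicator
              (fun r => ENNReal.ofReal (r ^ (-(d + β)))) ‖h‖) _ (hwm.comp measurable_prodMk_right)]
            refine (mul_le_mul_right ((setLIntegral_le_lintegral _ _).trans (hKle _ h0)) _).trans
              (le_of_eq ?_)
            rw [mul_right_comm, ← ENNReal.ofReal_mul (by positivity)]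
            congr 2
            rw [mul_left_comm, ← Real.rpow_add h0]
            simp
        _ = ENNReal.ofReal K * ∫⁻ x in strip d bm bp, (∑ i, ‖g i x‖ₑ) ^ p := by
            rw [lintegral_const_mul _ hΓm, volume_restrict_strip, lintegral_prod_symm _ hgm'.aemeasurable]
    · apply Measurable.aemeasurable
      exact ((by fun_prop : Measurable fun z : Hor d × ℝ =>
        ENNReal.ofReal ((τ * (z.2 - b)) ^ β) * Γ z.2)).mul hwm
  · exact (aemeasurable_differenceQuotient hFm).mono_measure
      (Measure.prod_mono le_rfl Measure.restrict_le_self)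

/-- The trace of a function with gradient in `L^p` has finite screened seminorm. -/
theorem exists_screenedSeminormScalar_le (hp : 1 < p) : ∃ C : ℝ, 0 ≤ C ∧
    ∀ (bm bp : ℝ), bm < bp → ∀ (v : Full d → ℝ) (f : (Hor d → ℝ) × (Hor d → ℝ)),
    IsStripTrace bm bp p v f → ∀ g : Fin (d + 1) → Full d → ℝ,
    (∀ i, IsWeakDeriv (fullDir d) (strip d bm bp) (Pi.single i 1) v (g i)) →
    (∀ i, LpLoc (ENNReal.ofReal p) ((strip d bm bp).indicator (g i))) →
    ∀ (b τ : ℝ) (F : Hor d → ℝ), IsSide bm bp f b τ F →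
    screenedSeminormScalar (bp - bm) p F ≤
      ENNReal.ofReal C * ∫⁻ x in strip d bm bp, (∑ i, ‖g i x‖ₑ) ^ p := by
  obtain ⟨C, hC, hCle⟩ := exists_screenedSeminormScalar_le_of_measurable (d := d) hp
  refine ⟨C, hC, ?_⟩
  intro bm bp hb v f hv g hg hgL b τ F hs
  have hp1 : 1 ≤ ENNReal.ofReal p := by simpa using hp.le
  -- Measurable representatives of the zero extensions replace the `g i`; all hypotheses are
  -- insensitive to null sets.
  have hm : ∀ i, AEStronglyMeasurable ((strip d bm bp).indicator (g i)) volume := fun i =>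
    ((hgL i).locallyIntegrable hp1).aestronglyMeasurable
  have hae : ∀ i, g i =ᵐ[volume.restrict (strip d bm bp)] (hm i).mk _ := fun i => by
    filter_upwards [ae_restrict_of_ae (hm i).ae_eq_mk, ae_restrict_mem measurableSet_strip]
      with x hx hxs
    rw [← hx, indicator_of_mem hxs]
  refine (hCle bm bp hb v f hv (fun i => (hm i).mk _) (fun i => (hg i).congr .rfl (hae i))
    (fun i K hK => (hgL i K hK).ae_eq ?_) (fun i => (hm i).stronglyMeasurable_mk.measurable)
    b τ F hs).trans (le_of_eq ?_)
  · refine ae_restrict_of_ae ?_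
    filter_upwards [(hm i).ae_eq_mk] with x hx
    by_cases hxs : x ∈ strip d bm bp
    · rw [hx, indicator_of_mem hxs]
    · simp [indicator_of_notMem hxs]
  · congr 1
    refine lintegral_congr_ae ?_
    filter_upwards [ae_all_iff.2 hae] with x hx
    simp_rw [hx]

end Gagliardo

/-! ### Multi-indices and norms of derivative vectors -/

section MultiIndices

variable {d : ℕ}

theorem multi_castSucc (β : Fin d → ℕ) (k : ℕ) (j : Fin d) : multi β k j.castSucc = β j := by
  simp [multi]

theorem multi_last (β : Fin d → ℕ) (k : ℕ) : multi β k (Fin.last d) = k := by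
  simp [multi]

theorem multi_add_single (β : Fin d → ℕ) (k : ℕ) (j : Fin d) :
    multi (β + Pi.single j 1) k = multi β k + Pi.single j.castSucc 1 := by
  ext i
  refine Fin.lastCases ?_ (fun l => ?_) i
  · simp [multi_last, (Fin.castSucc_lt_last j).ne']
  · simp [multi_castSucc, Pi.single_apply]

theorem multi_succ (β : Fin d → ℕ) (k : ℕ) :
    multi β (k + 1) = multi β k + Pi.single (Fin.last d) 1 := by
  ext i
  refine Fin.lastCases ?_ (fun l => ?_) i
  · simp [multi_last]
  · simp [multi_castSucc, (Fin.castSucc_lt_last l).ne]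

theorem sum_multi (β : Fin d → ℕ) (k : ℕ) : ∑ i, multi β k i = ∑ j, β j + k := by
  simp [Fin.sum_univ_castSucc, multi_castSucc, multi_last]

theorem multi_left_injective (k : ℕ) : Function.Injective fun β : Fin d → ℕ => multi β k := by
  intro β γ h
  ext j
  simpa [multi_castSucc] using congrFun h j.castSucc

theorem abs_le_multiNorm {n k : ℕ} (F : (Fin n → ℕ) → ℝ) {α : Fin n → ℕ} (hα : ∑ i, α i = k) :
    |F α| ≤ multiNorm k F := by
  rw [multiNorm, ← Real.sqrt_sq_eq_abs]
  apply Real.sqrt_le_sqrt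
  exact Finset.single_le_sum (f := fun α => F α ^ 2) (fun _ _ => sq_nonneg _)
    (by simpa [Finset.mem_piAntidiag] using hα)

/-- The left-hand vector consists of some components of the right-hand one, each occurring once, as
`β ↦ multi β (m - i)` is injective. -/
theorem multiNorm_multi_le {i m : ℕ} (hi : i ≤ m) (F : (Fin (d + 1) → ℕ) → ℝ) :
    multiNorm i (fun β : Fin d → ℕ => F (multi β (m - i))) ≤ multiNorm m F := by
  apply Real.sqrt_le_sqrt
  rw [← Finset.sum_image (f := fun α => F α ^ 2) (g := fun β : Fin d → ℕ => multi β (m - i))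
    (multi_left_injective _).injOn]
  refine Finset.sum_le_sum_of_subset_of_nonneg ?_ fun _ _ _ => sq_nonneg _
  intro α hα
  obtain ⟨β, hβ, rfl⟩ := Finset.mem_image.1 hα
  have hβ' : ∑ j, β j = i := by simpa [Finset.mem_piAntidiag] using hβ
  simp only [Finset.mem_piAntidiag, sum_multi, hβ', Finset.mem_univ, implies_true, and_true]
  omega

theorem multiNorm_rpow_le {n k : ℕ} {p : ℝ} (hp : 1 ≤ p) (F : (Fin n → ℕ) → ℝ) :
    multiNorm k F ^ p ≤
      ((Finset.piAntidiag (Finset.univ : Finset (Fin n)) k).card : ℝ) ^ (p - 1) *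
        ∑ α ∈ Finset.piAntidiag (Finset.univ : Finset (Fin n)) k, |F α| ^ p := by
  refine le_trans (Real.rpow_le_rpow (Real.sqrt_nonneg _) ?_ (by linarith))
    (Real.rpow_sum_le_const_mul_sum_rpow _ F hp)
  refine Real.sqrt_le_iff.2 ⟨Finset.sum_nonneg fun _ _ => abs_nonneg _, ?_⟩
  simp_rw [← sq_abs (F _)]
  exact Finset.sum_sq_le_sq_sum_of_nonneg fun _ _ => abs_nonneg _

end MultiIndices

/-! ### Traces of the derivatives of `u` -/

section TracesOfDerivatives

variable {d m : ℕ} {bm bp p : ℝ} {u : Full d → ℝ}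

theorem LpLoc.indicator_congr {q : ℝ≥0∞} {v w : Full d → ℝ}
    (hv : LpLoc q ((strip d bm bp).indicator v)) (h : v =ᵐ[volume.restrict (strip d bm bp)] w) :
    LpLoc q ((strip d bm bp).indicator w) := fun K hK =>
  (hv K hK).ae_eq
    (ae_restrict_of_ae ((ae_eq_restrict_iff_indicator_ae_eq measurableSet_strip).1 h))

theorem isWeakDeriv_stripDeriv_add_single (hb : bm < bp) (hp : 1 < p)
    (hu : MemHomSobolev (fullDir d) (strip d bm bp) m p u) {α : Fin (d + 1) → ℕ}
    (hα : ∑ i, α i + 1 ≤ m) (i : Fin (d + 1)) :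
    IsWeakDeriv (fullDir d) (strip d bm bp) (Pi.single i 1) (stripDeriv bm bp α u)
      (stripDeriv bm bp (α + Pi.single i 1) u) :=
  (isWeakDeriv_stripDeriv hb hp hu α (by omega)).1.of_add_single
    (isWeakDeriv_stripDeriv hb hp hu _ (by rwa [sum_add_single])).1

theorem isStripTrace_stripDeriv (hb : bm < bp) (hp : 1 < p)
    (hu : MemHomSobolev (fullDir d) (strip d bm bp) m p u) {α : Fin (d + 1) → ℕ}
    (hα : ∑ i, α i + 1 ≤ m) :
    IsStripTrace bm bp p (stripDeriv bm bp α u) (trace bm bp p (stripDeriv bm bp α u)) := by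
  have h1 := isWeakDeriv_stripDeriv_add_single hb hp hu hα
  exact exists_isStripTrace hb hp (fun i => (h1 i).weakDeriv)
    (isWeakDeriv_stripDeriv hb hp hu α (by omega)).2 fun i =>
    (isWeakDeriv_stripDeriv hb hp hu _ (by rwa [sum_add_single])).2.indicator_congr
      ((h1 i).weakDeriv_ae_eq isOpen_strip).symm

/-- Separate from the case `α = 0` of `isStripTrace_stripDeriv`, since `stripDeriv bm bp 0 u` is a
chosen representative that agrees with `u` only almost everywhere. -/
theorem isStripTrace_of_memHomSobolev (hb : bm < bp) (hp : 1 < p) (hm : 1 ≤ m)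
    (hu : MemHomSobolev (fullDir d) (strip d bm bp) m p u) :
    IsStripTrace bm bp p u (trace bm bp p u) := by
  have h1 : ∀ i : Fin (d + 1), ∑ j, (Pi.single i 1 : Fin (d + 1) → ℕ) j ≤ m := fun i => by
    simpa using hm
  refine exists_isStripTrace hb hp (fun i => (isWeakDeriv_stripDeriv hb hp hu _ (h1 i)).1) ?_
    fun i => (isWeakDeriv_stripDeriv hb hp hu _ (h1 i)).2
  exact (isWeakDeriv_stripDeriv hb hp hu 0 (by simp)).2.indicator_congr
    ((isWeakDeriv_zero hu.1).weakDeriv_ae_eq isOpen_strip)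

/-- Induction on the tangential order, one horizontal direction at a time. The step uses mixed
derivatives of order `n + k + 2`, which is at most `m` exactly when the new trace has order at most
`m - 1`. -/
theorem isWeakDeriv_trace_multi (hb : bm < bp) (hp : 1 < p)
    (hu : MemHomSobolev (fullDir d) (strip d bm bp) m p u) (n : ℕ) :
    ∀ (α' : Fin d → ℕ) (k : ℕ), ∑ j, α' j = n → n + k + 1 ≤ m →
      IsWeakDeriv (horDir d) univ α' (trUpper bm bp p (stripDeriv bm bp (multi 0 k) u))
        (trUpper bm bp p (stripDeriv bm bp (multi α' k) u)) ∧
      IsWeakDeriv (horDir d) univ α' (trLower bm bp p (stripDeriv bm bp (multi 0 k) u))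
        (trLower bm bp p (stripDeriv bm bp (multi α' k) u)) := by
  induction n with
  | zero =>
    intro α' k hα hk
    obtain rfl : α' = 0 := by
      ext j
      exact (Finset.sum_eq_zero_iff.1 hα) j (Finset.mem_univ j)
    have := isStripTrace_stripDeriv hb hp hu (α := multi 0 k) (by rw [sum_multi]; omega)
    exact ⟨isWeakDeriv_zero ((this.memLpLoc_upper.locallyIntegrable hp).locallyIntegrableOn _),
      isWeakDeriv_zero ((this.memLpLoc_lower.locallyIntegrable hp).locallyIntegrableOn _)⟩
  | succ n ih =>
    intro α' k hα hk
    obtain ⟨β, j, rfl, hβ⟩ := exists_eq_add_single hα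
    have s0 : ∑ i, multi β k i = n + k := by rw [sum_multi, hβ]
    have sj : ∑ i, multi (β + Pi.single j 1) k i = n + 1 + k := by rw [sum_multi, hα]
    have sN : ∑ i, multi β (k + 1) i = n + (k + 1) := by rw [sum_multi, hβ]
    have h0 := isStripTrace_stripDeriv hb hp hu (α := multi β k) (by omega)
    have hj := isStripTrace_stripDeriv hb hp hu (α := multi (β + Pi.single j 1) k) (by omega)
    have d1 := isWeakDeriv_stripDeriv_add_single hb hp hu (α := multi β k) (by omega) j.castSucc
    have d2 := isWeakDeriv_stripDeriv_add_single hb hp hu (α := multi β k) (by omega) (Fin.last d)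
    have d3 := isWeakDeriv_stripDeriv_add_single hb hp hu (α := multi β (k + 1)) (by omega)
      j.castSucc
    have d4 := isWeakDeriv_stripDeriv_add_single hb hp hu (α := multi (β + Pi.single j 1) k)
      (by omega) (Fin.last d)
    rw [← multi_add_single] at d1 d3
    rw [← multi_succ] at d2 d4
    have key := h0.isWeakDeriv_tangential hb hp j hj d1 d2 d3 d4
    exact ⟨(ih β k hβ (by omega)).1.add_single key.1, (ih β k hβ (by omega)).2.add_single key.2⟩

end TracesOfDerivatives

/-! ### The jump estimates and the screened seminorm estimates -/

section Estimates

variable {d m : ℕ} {bm bp p : ℝ} {u : Full d → ℝ}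

theorem abs_taylorKer_le (hb : bm < bp) (k : ℕ) {t : ℝ} (ht : t ∈ Ioo bm bp) :
    |taylorKer ((bm + bp) / 2) k t| ≤ (bp - bm) ^ k := by
  have h1 : |(bm + bp) / 2 - t| ≤ bp - bm := by
    rw [abs_le]
    constructor <;> linarith [ht.1, ht.2]
  have h2 : (1 : ℝ) ≤ k.factorial := by exact_mod_cast k.factorial_pos
  rw [taylorKer, abs_div, abs_pow, Nat.abs_cast]
  exact (div_le_self (by positivity) h2).trans (pow_le_pow_left₀ (abs_nonneg _) h1 k)

/-- Almost everywhere the tangential derivatives pass inside the traces; the sum is then `jumpSum`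
for the chain `k ↦ ∂^{(α', k + l)} u`. -/
theorem jump_ae_eq (hb : bm < bp) (hp : 1 < p)
    (hu : MemHomSobolev (fullDir d) (strip d bm bp) m p u) {M l : ℕ} {α' : Fin d → ℕ}
    (hα : ∑ j, α' j + l + (M + 1) ≤ m) :
    jump bm bp p u (M + 1) l α' =ᵐ[volume] fun x' =>
      ∫ t in Ioo bm bp, taylorKer ((bm + bp) / 2) M t *
        stripDeriv bm bp (multi α' (M + 1 + l)) u (x', t) := by
  have hsum : ∀ k, ∑ i, multi α' (k + l) i = ∑ j, α' j + (k + l) := fun k => sum_multi _ _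
  refine Filter.EventuallyEq.trans ?_ (jumpSum_ae_eq hb hp (p := p)
    (f := fun k => stripDeriv bm bp (multi α' (k + l)) u)
    (F := fun k => trace bm bp p (stripDeriv bm bp (multi α' (k + l)) u)) M
    (fun k hk => isStripTrace_stripDeriv hb hp hu (by rw [hsum]; omega)) (fun k hk => ?_)
    (isWeakDeriv_stripDeriv hb hp hu _ (by rw [hsum]; omega)).2)
  · have h1 : ∀ k ∈ Finset.range (M + 1),
        (horDeriv α' (trUpper bm bp p (stripDeriv bm bp (multi 0 (k + l)) u)) =ᵐ[volume]
          trUpper bm bp p (stripDeriv bm bp (multi α' (k + l)) u)) ∧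
        (horDeriv α' (trLower bm bp p (stripDeriv bm bp (multi 0 (k + l)) u)) =ᵐ[volume]
          trLower bm bp p (stripDeriv bm bp (multi α' (k + l)) u)) := by
      intro k hk
      have := isWeakDeriv_trace_multi hb hp hu _ α' (k + l) rfl
        (by have := Finset.mem_range.1 hk; omega)
      constructor
      · simpa [horDeriv] using this.1.weakDeriv_ae_eq isOpen_univ
      · simpa [horDeriv] using this.2.weakDeriv_ae_eq isOpen_univ
    have h2 : ∀ᵐ x' : Hor d, ∀ k ∈ Finset.range (M + 1),
        horDeriv α' (trUpper bm bp p (stripDeriv bm bp (multi 0 (k + l)) u)) x' =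
          trUpper bm bp p (stripDeriv bm bp (multi α' (k + l)) u) x' ∧
        horDeriv α' (trLower bm bp p (stripDeriv bm bp (multi 0 (k + l)) u)) x' =
          trLower bm bp p (stripDeriv bm bp (multi α' (k + l)) u) x' := by
      rw [Filter.eventually_all_finset]
      exact fun k hk => (h1 k hk).1.and (h1 k hk).2
    filter_upwards [h2] with x' hx'
    refine Finset.sum_congr rfl fun k hk => ?_
    rw [(hx' k hk).1, (hx' k hk).2]
    rfl
  · have := isWeakDeriv_stripDeriv_add_single hb hp hu (α := multi α' (k + l))
      (by rw [hsum]; omega) (Fin.last d)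
    rw [← multi_succ, show k + l + 1 = k + 1 + l by omega] at this
    exact this

theorem lintegral_multiNorm_jump_le (hb : bm < bp) (hp : 1 < p)
    (hu : MemHomSobolev (fullDir d) (strip d bm bp) m p u) {i l : ℕ} (hil : i + l + 1 ≤ m) :
    ∫⁻ x' : Hor d, ENNReal.ofReal
        (multiNorm i (fun α' => jump bm bp p u (m - l - i) l α' x') ^ p) ≤
      ENNReal.ofReal ((bp - bm) ^ (((m : ℝ) - i - l) * p - 1)) * energy bm bp m p u := by
  obtain ⟨M, rfl⟩ : ∃ M, m = i + l + 1 + M := ⟨m - (i + l + 1), by omega⟩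
  have hL : 0 < bp - bm := sub_pos.2 hb
  rw [show i + l + 1 + M - l - i = M + 1 by omega]
  have hmem : ∀ α' ∈ Finset.piAntidiag (Finset.univ : Finset (Fin d)) i, ∑ j, α' j = i :=
    fun α' hα => by simpa [Finset.mem_piAntidiag] using hα
  have hae : ∀ᵐ x' : Hor d, ∀ α' ∈ Finset.piAntidiag (Finset.univ : Finset (Fin d)) i,
      jump bm bp p u (M + 1) l α' x' = ∫ t in Ioo bm bp, taylorKer ((bm + bp) / 2) M t *
        stripDeriv bm bp (multi α' (M + 1 + l)) u (x', t) := by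
    rw [Filter.eventually_all_finset]
    exact fun α' hα => jump_ae_eq hb hp hu (by rw [hmem α' hα]; omega)
  have h1 : ∫⁻ x' : Hor d, ENNReal.ofReal
      (multiNorm i (fun α' => jump bm bp p u (M + 1) l α' x') ^ p) =
      ∫⁻ x' : Hor d, ENNReal.ofReal
        (√(∑ α' ∈ Finset.piAntidiag (Finset.univ : Finset (Fin d)) i,
          (∫ t in Ioo bm bp, taylorKer ((bm + bp) / 2) M t *
            stripDeriv bm bp (multi α' (M + 1 + l)) u (x', t)) ^ 2) ^ p) := by
    refine lintegral_congr_ae ?_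
    filter_upwards [hae] with x' hx'
    rw [multiNorm, Finset.sum_congr rfl fun α' hα => by rw [hx' α' hα]]
  rw [h1]
  refine (lintegral_sqrt_sum_integral_rpow_le hb hp _
    (G := fun α' => stripDeriv bm bp (multi α' (M + 1 + l)) u) (fun α' hα => ?_)
    (contDiff_taylorKer _ M).continuous (pow_nonneg hL.le M)
    fun t ht => abs_taylorKer_le hb M ht).trans ?_
  · exact (isWeakDeriv_stripDeriv hb hp hu _ (by rw [sum_multi, hmem α' hα]; omega)).1.2
      |>.aestronglyMeasurable
  · refine mul_le_mul' (le_of_eq ?_) (lintegral_mono fun x => ENNReal.ofReal_le_ofReal ?_)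
    -- The kernel gives `L^{Mp}` and Hölder `L^{p-1}`; here `M + 1 = m - i - l`.
    · rw [← Real.rpow_natCast, ← Real.rpow_mul hL.le, ← Real.rpow_add hL]
      congr 2
      push_cast
      ring
    · refine Real.rpow_le_rpow (Real.sqrt_nonneg _) ?_ (by linarith)
      have := multiNorm_multi_le (d := d) (i := i) (m := i + l + 1 + M) (by omega)
        (fun α => stripDeriv bm bp α u x)
      rwa [show i + l + 1 + M - i = M + 1 + l by omega] at this

theorem lintegral_abs_jumpSum_le (hb : bm < bp) (hp : 1 < p) {f : ℕ → Full d → ℝ}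
    {F : ℕ → (Hor d → ℝ) × (Hor d → ℝ)} (M : ℕ)
    (hF : ∀ k ≤ M, IsStripTrace bm bp p (f k) (F k))
    (hf : ∀ k ≤ M, IsWeakDeriv (fullDir d) (strip d bm bp) (Pi.single (Fin.last d) 1) (f k)
      (f (k + 1))) (hL : LpLoc (ENNReal.ofReal p) ((strip d bm bp).indicator (f (M + 1)))) :
    ∫⁻ x', ENNReal.ofReal (|jumpSum bm bp F (M + 1) x'| ^ p) ≤
      ENNReal.ofReal ((bp - bm) ^ ((M + 1) * p - 1)) *
        ∫⁻ x in strip d bm bp, ENNReal.ofReal (|f (M + 1) x| ^ p) := by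
  have hL0 : 0 < bp - bm := sub_pos.2 hb
  have h := lintegral_sqrt_sum_integral_rpow_le hb hp ({M + 1} : Finset ℕ) (G := f)
    (fun a ha => by
      obtain rfl := Finset.mem_singleton.1 ha
      exact (hf M le_rfl).2.aestronglyMeasurable)
    (contDiff_taylorKer ((bm + bp) / 2) M).continuous (pow_nonneg hL0.le M)
    fun t ht => abs_taylorKer_le hb M ht
  simp only [Finset.sum_singleton, Real.sqrt_sq_eq_abs] at h
  refine (le_of_eq ?_).trans (h.trans (le_of_eq ?_))
  · refine lintegral_congr_ae ?_
    filter_upwards [jumpSum_ae_eq hb hp M hF hf hL] with x' hx'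
    rw [hx']
  · congr 2
    rw [← Real.rpow_natCast, ← Real.rpow_mul hL0.le, ← Real.rpow_add hL0]
    congr 1
    ring

/-- The Taylor identity with `M = 0` applied to `∂_i u`; only the single derivative `∂_i ∂_N u`
enters. -/
theorem lintegral_abs_trace_sub_le (hb : bm < bp) (hp : 1 < p)
    (hu : MemHomSobolev (fullDir d) (strip d bm bp) 2 p u) (i : Fin (d + 1)) :
    ∫⁻ x', ENNReal.ofReal (|trUpper bm bp p (stripDeriv bm bp (Pi.single i 1) u) x' -
        trLower bm bp p (stripDeriv bm bp (Pi.single i 1) u) x'| ^ p) ≤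
      ENNReal.ofReal ((bp - bm) ^ (p - 1)) * ∫⁻ x in strip d bm bp, ENNReal.ofReal
        (|stripDeriv bm bp (Pi.single i 1 + Pi.single (Fin.last d) 1) u x| ^ p) := by
  have h1 : ∑ j, (Pi.single i 1 : Fin (d + 1) → ℕ) j + 1 ≤ 2 := by simp
  have hz : (Pi.single i 1 + Pi.single (Fin.last d) 0 : Fin (d + 1) → ℕ) = Pi.single i 1 := by simp
  have h := lintegral_abs_jumpSum_le hb hp
    (f := fun k => stripDeriv bm bp (Pi.single i 1 + Pi.single (Fin.last d) k) u)
    (F := fun _ => trace bm bp p (stripDeriv bm bp (Pi.single i 1) u)) 0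
    (fun k hk => by
      obtain rfl := Nat.le_zero.1 hk
      simp only [hz]
      exact isStripTrace_stripDeriv hb hp hu h1)
    (fun k hk => by
      obtain rfl := Nat.le_zero.1 hk
      simp only [hz]
      exact isWeakDeriv_stripDeriv_add_single hb hp hu h1 _)
    (isWeakDeriv_stripDeriv hb hp hu _ (by rw [sum_add_single]; exact h1)).2
  simpa [jumpSum, ← sub_eq_add_neg, trUpper, trLower] using h

theorem lintegral_abs_trace_sub_sub_le (hb : bm < bp) (hp : 1 < p)
    (hu : MemHomSobolev (fullDir d) (strip d bm bp) 2 p u) :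
    ∫⁻ x', ENNReal.ofReal (|trUpper bm bp p u x' - trLower bm bp p u x' -
        (trUpper bm bp p (stripDeriv bm bp (Pi.single (Fin.last d) 1) u) x' +
          trLower bm bp p (stripDeriv bm bp (Pi.single (Fin.last d) 1) u) x') *
          ((bp - bm) / 2)| ^ p) ≤
      ENNReal.ofReal ((bp - bm) ^ (2 * p - 1)) * ∫⁻ x in strip d bm bp, ENNReal.ofReal
        (|stripDeriv bm bp (Pi.single (Fin.last d) 2) u x| ^ p) := by
  have h1 : ∑ j, (Pi.single (Fin.last d) 1 : Fin (d + 1) → ℕ) j + 1 ≤ 2 := by simp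
  -- The chain starts at `u` itself, because the estimate concerns the trace of `u` and not of a
  -- representative of `∂^0 u`.
  set f : ℕ → Full d → ℝ := fun k =>
    if k = 0 then u else stripDeriv bm bp (Pi.single (Fin.last d) k) u with hf
  have h2 : (Pi.single (Fin.last d) 2 : Fin (d + 1) → ℕ) =
      Pi.single (Fin.last d) 1 + Pi.single (Fin.last d) 1 := by
    rw [← Pi.single_add]
  have h := lintegral_abs_jumpSum_le hb hp (f := f) (F := fun k => trace bm bp p (f k)) 1
    (fun k hk => by
      interval_cases k
      · exact isStripTrace_of_memHomSobolev hb hp (by norm_num) hu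
      · exact isStripTrace_stripDeriv hb hp hu h1)
    (fun k hk => by
      interval_cases k
      · exact (isWeakDeriv_stripDeriv hb hp hu _ (by simp)).1
      · have := isWeakDeriv_stripDeriv_add_single hb hp hu h1 (Fin.last d)
        rw [← h2] at this
        exact this)
    (isWeakDeriv_stripDeriv hb hp hu _ (by simp)).2
  have e1 : ((1 : ℕ) : ℝ) + 1 = 2 := by norm_num
  rw [e1] at h
  refine (le_of_eq ?_).trans h
  refine lintegral_congr fun x' => ?_
  congr 3
  simp [jumpSum, Finset.sum_range_succ, hf, trUpper, trLower]
  ring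

theorem exists_screenedSeminorm_trace_le (d m : ℕ) (hp : 1 < p) : ∃ C : ℝ, 0 ≤ C ∧
    ∀ (bm bp : ℝ), bm < bp → ∀ u : Full d → ℝ,
    MemHomSobolev (fullDir d) (strip d bm bp) m p u →
    ∀ α : Fin (d + 1) → ℕ, ∑ i, α i + 1 = m → ∀ (b τ : ℝ) (F : Hor d → ℝ),
    IsSide bm bp (trace bm bp p (stripDeriv bm bp α u)) b τ F →
    screenedSeminormScalar (bp - bm) p F ≤ ENNReal.ofReal C * energy bm bp m p u := by
  obtain ⟨C, hC, hCle⟩ := exists_screenedSeminormScalar_le (d := d) hp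
  -- Each of the `d + 1` first derivatives of `∂^α u` is a component of `∇^m u`, so their absolute
  -- values sum to at most `d + 1` times its norm.
  refine ⟨C * (d + 1) ^ p, by positivity, ?_⟩
  intro bm bp hb u hu α hα b τ F hs
  have hp0 : 0 ≤ p := by linarith
  refine (hCle bm bp hb _ _ (isStripTrace_stripDeriv hb hp hu hα.le) _
    (fun i => isWeakDeriv_stripDeriv_add_single hb hp hu hα.le i)
    (fun i => (isWeakDeriv_stripDeriv hb hp hu _ (by rw [sum_add_single]; exact hα.le)).2)
    b τ F hs).trans ?_
  rw [ENNReal.ofReal_mul hC, mul_assoc]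
  refine mul_le_mul_right ?_ _
  rw [energy, ← lintegral_const_mul' _ _ ENNReal.ofReal_ne_top]
  refine lintegral_mono fun x => ?_
  have hN : 0 ≤ multiNorm m fun α => stripDeriv bm bp α u x := Real.sqrt_nonneg _
  rw [← ENNReal.ofReal_mul (by positivity), ← Real.mul_rpow (by positivity) hN,
    ← ENNReal.ofReal_rpow_of_nonneg (mul_nonneg (by positivity) hN) hp0]
  refine ENNReal.rpow_le_rpow ?_ hp0
  simp_rw [Real.enorm_eq_ofReal_abs]
  rw [← ENNReal.ofReal_sum_of_nonneg fun _ _ => abs_nonneg _]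
  apply ENNReal.ofReal_le_ofReal
  refine (Finset.sum_le_card_nsmul _ _ _ fun i _ => abs_le_multiNorm (k := m)
    (fun α => stripDeriv bm bp α u x) ?_).trans (le_of_eq ?_)
  · rw [sum_add_single, hα]
  · simp

theorem screenedSeminorm_le_sum {n k : ℕ} (hp : 1 ≤ p) (a : ℝ) {F : (Fin n → ℕ) → Hor d → ℝ}
    (hF : ∀ α, ∑ i, α i = k → AEMeasurable (F α)) :
    screenedSeminorm a p k F ≤
      ENNReal.ofReal (((Finset.piAntidiag (Finset.univ : Finset (Fin n)) k).card : ℝ) ^ (p - 1)) *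
        ∑ α ∈ Finset.piAntidiag (Finset.univ : Finset (Fin n)) k,
          screenedSeminormScalar a p (F α) := by
  set A := Finset.piAntidiag (Finset.univ : Finset (Fin n)) k with hA
  set S : (Fin n → ℕ) → Hor d × Hor d → ℝ≥0∞ := fun α z =>
    ENNReal.ofReal (|F α (z.1 + z.2) - F α z.1| ^ p / ‖z.2‖ ^ (p + d - 1)) with hS
  have hSm : ∀ α ∈ A, AEMeasurable (S α)
      ((volume : Measure (Hor d)).prod (volume.restrict (Metric.ball 0 a))) := fun α hα =>
    (aemeasurable_differenceQuotient (hF α (by simpa [hA, Finset.mem_piAntidiag] using hα))).mono_measure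
      (Measure.prod_mono le_rfl Measure.restrict_le_self)
  have hscal : ∀ α ∈ A, screenedSeminormScalar a p (F α) =
      ∫⁻ z, S α z ∂((volume : Measure (Hor d)).prod (volume.restrict (Metric.ball 0 a))) :=
    fun α hα => (lintegral_prod _ (hSm α hα)).symm
  rw [Finset.sum_congr rfl hscal, ← lintegral_finsetSum' _ hSm,
    ← lintegral_const_mul' _ _ ENNReal.ofReal_ne_top, lintegral_prod _
      ((Finset.aemeasurable_fun_sum _ hSm).const_mul _)]
  refine lintegral_mono fun x' => lintegral_mono fun h' => ?_
  simp only [hS]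
  rw [← ENNReal.ofReal_sum_of_nonneg fun _ _ => by positivity, ← ENNReal.ofReal_mul (by positivity)]
  apply ENNReal.ofReal_le_ofReal
  rw [← Finset.sum_div, ← mul_div_assoc]
  exact div_le_div_of_nonneg_right (multiNorm_rpow_le hp _) (by positivity)

end Estimates

end TraceStrip

theorem theorem3p11 (d m : ℕ) (p : ℝ) (hd : 1 ≤ d) (hm : 2 ≤ m) (hp : 1 < p) :
    ∃ c : ℝ, 0 < c ∧ ∀ (bm bp : ℝ), bm < bp → ∀ u : TraceStrip.Full d → ℝ,
      TraceStrip.MemHomSobolev (TraceStrip.fullDir d) (TraceStrip.strip d bm bp) m p u →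
      -- the weak derivatives of `u` of order at most `m` exist
      (∀ α : Fin (d + 1) → ℕ, ∑ i, α i ≤ m →
        TraceStrip.IsWeakDeriv (TraceStrip.fullDir d) (TraceStrip.strip d bm bp) α u
          (TraceStrip.stripDeriv bm bp α u)) ∧
      -- `u` and its weak derivatives of order at most `m - 1` have traces
      TraceStrip.IsStripTrace bm bp p u (TraceStrip.trace bm bp p u) ∧
      (∀ α : Fin (d + 1) → ℕ, ∑ i, α i ≤ m - 1 →
        TraceStrip.IsStripTrace bm bp p (TraceStrip.stripDeriv bm bp α u)
          (TraceStrip.trace bm bp p (TraceStrip.stripDeriv bm bp α u))) ∧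
      -- the weak tangential derivatives `∂^{α'} Tr(∂_N^k u)` exist, and are `Tr(∂^{(α', k)} u)`
      (∀ (α' : Fin d → ℕ) (k : ℕ), ∑ j, α' j + k ≤ m - 1 →
        TraceStrip.IsWeakDeriv (TraceStrip.horDir d) Set.univ α'
          (TraceStrip.trUpper bm bp p (TraceStrip.stripDeriv bm bp (TraceStrip.multi 0 k) u))
          (TraceStrip.trUpper bm bp p (TraceStrip.stripDeriv bm bp (TraceStrip.multi α' k) u)) ∧
        TraceStrip.IsWeakDeriv (TraceStrip.horDir d) Set.univ α'
          (TraceStrip.trLower bm bp p (TraceStrip.stripDeriv bm bp (TraceStrip.multi 0 k) u))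
          (TraceStrip.trLower bm bp p (TraceStrip.stripDeriv bm bp (TraceStrip.multi α' k) u))) ∧
      -- the estimate for the combinations of traces of normal derivatives
      (∀ i l : ℕ, i + l ≤ m - 1 →
        ∫⁻ x' : TraceStrip.Hor d, ENNReal.ofReal
            (TraceStrip.multiNorm i
              (fun α' => TraceStrip.jump bm bp p u (m - l - i) l α' x') ^ p) ≤
          ENNReal.ofReal ((bp - bm) ^ (((m : ℝ) - i - l) * p - 1)) *
            TraceStrip.energy bm bp m p u) ∧
      -- the screened seminorm of the traces of `∇^{m-1} u`
      TraceStrip.screenedSeminorm (bp - bm) p (m - 1)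
          (fun α => TraceStrip.trUpper bm bp p (TraceStrip.stripDeriv bm bp α u)) ≤
        ENNReal.ofReal c * TraceStrip.energy bm bp m p u ∧
      TraceStrip.screenedSeminorm (bp - bm) p (m - 1)
          (fun α => TraceStrip.trLower bm bp p (TraceStrip.stripDeriv bm bp α u)) ≤
        ENNReal.ofReal c * TraceStrip.energy bm bp m p u ∧
      -- the sharper form in the case `m = 2`
      (m = 2 →
        (∀ i : Fin (d + 1),
          ∫⁻ x' : TraceStrip.Hor d, ENNReal.ofReal
              (|TraceStrip.trUpper bm bp p (TraceStrip.stripDeriv bm bp (Pi.single i 1) u) x' -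
                TraceStrip.trLower bm bp p (TraceStrip.stripDeriv bm bp (Pi.single i 1) u) x'| ^ p) ≤
            ENNReal.ofReal ((bp - bm) ^ (p - 1)) *
              ∫⁻ x in TraceStrip.strip d bm bp, ENNReal.ofReal
                (|TraceStrip.stripDeriv bm bp (Pi.single i 1 + Pi.single (Fin.last d) 1) u x| ^ p)) ∧
        (∫⁻ x' : TraceStrip.Hor d, ENNReal.ofReal
            (|TraceStrip.trUpper bm bp p u x' - TraceStrip.trLower bm bp p u x' -
              (TraceStrip.trUpper bm bp p
                  (TraceStrip.stripDeriv bm bp (Pi.single (Fin.last d) 1) u) x' +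
                TraceStrip.trLower bm bp p
                  (TraceStrip.stripDeriv bm bp (Pi.single (Fin.last d) 1) u) x') *
                ((bp - bm) / 2)| ^ p) ≤
          ENNReal.ofReal ((bp - bm) ^ (2 * p - 1)) *
            ∫⁻ x in TraceStrip.strip d bm bp, ENNReal.ofReal
              (|TraceStrip.stripDeriv bm bp (Pi.single (Fin.last d) 2) u x| ^ p)) ∧
        (∀ i : Fin (d + 1),
          TraceStrip.screenedSeminormScalar (bp - bm) p
              (TraceStrip.trUpper bm bp p (TraceStrip.stripDeriv bm bp (Pi.single i 1) u)) ≤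
            ENNReal.ofReal c * TraceStrip.energy bm bp m p u ∧
          TraceStrip.screenedSeminormScalar (bp - bm) p
              (TraceStrip.trLower bm bp p (TraceStrip.stripDeriv bm bp (Pi.single i 1) u)) ≤
            ENNReal.ofReal c * TraceStrip.energy bm bp m p u)) := by
  obtain ⟨C, hC, hCle⟩ := TraceStrip.exists_screenedSeminorm_trace_le d m hp
  set n : ℝ := ((Finset.piAntidiag (Finset.univ : Finset (Fin (d + 1))) (m - 1)).card : ℝ) with hn
  have hn0 : 0 ≤ n := Nat.cast_nonneg _
  -- With `n` components, `n ^ (p - 1) * n * C` serves the vector estimates, the extra `C` the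
  -- scalar ones for `m = 2`, and `+ 1` ensures positivity.
  refine ⟨(n ^ (p - 1) * n + 1) * C + 1, by positivity, ?_⟩
  intro bm bp hb u hu
  have hCc : ENNReal.ofReal C ≤ ENNReal.ofReal ((n ^ (p - 1) * n + 1) * C + 1) := by
    apply ENNReal.ofReal_le_ofReal
    have : 0 ≤ n ^ (p - 1) * n * C := by positivity
    linarith
  have hvec : ∀ (b τ : ℝ) (F : (Fin (d + 1) → ℕ) → TraceStrip.Hor d → ℝ),
      (∀ α, TraceStrip.IsSide bm bp
        (TraceStrip.trace bm bp p (TraceStrip.stripDeriv bm bp α u)) b τ (F α)) →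
      TraceStrip.screenedSeminorm (bp - bm) p (m - 1) F ≤
        ENNReal.ofReal ((n ^ (p - 1) * n + 1) * C + 1) * TraceStrip.energy bm bp m p u := by
    intro b τ F hs
    refine (TraceStrip.screenedSeminorm_le_sum hp.le _ fun α hα =>
      (((hs α).memLpLoc (TraceStrip.isStripTrace_stripDeriv hb hp hu
        (by omega))).locallyIntegrable hp).aestronglyMeasurable.aemeasurable).trans ?_
    refine (mul_le_mul_right (Finset.sum_le_card_nsmul _ _ _ fun α hα =>
      hCle bm bp hb u hu α ?_ b τ (F α) (hs α)) _).trans ?_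
    · have : ∑ i, α i = m - 1 := by simpa [Finset.mem_piAntidiag] using hα
      omega
    · rw [nsmul_eq_mul, ← ENNReal.ofReal_natCast, ← hn, ← mul_assoc, ← mul_assoc,
        ← ENNReal.ofReal_mul (by positivity), ← ENNReal.ofReal_mul (by positivity)]
      refine mul_le_mul_left (ENNReal.ofReal_le_ofReal ?_) _
      linarith
  refine ⟨fun α hα => (TraceStrip.isWeakDeriv_stripDeriv hb hp hu α hα).1,
    TraceStrip.isStripTrace_of_memHomSobolev hb hp (by omega) hu,
    fun α hα => TraceStrip.isStripTrace_stripDeriv hb hp hu (by omega),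
    fun α' k hk => TraceStrip.isWeakDeriv_trace_multi hb hp hu _ α' k rfl (by omega),
    fun i l hil => TraceStrip.lintegral_multiNorm_jump_le hb hp hu (by omega),
    hvec bp (-1) _ fun α => Or.inr ⟨rfl, rfl, rfl⟩,
    hvec bm 1 _ fun α => Or.inl ⟨rfl, rfl, rfl⟩, ?_⟩
  rintro rfl
  refine ⟨TraceStrip.lintegral_abs_trace_sub_le hb hp hu,
    TraceStrip.lintegral_abs_trace_sub_sub_le hb hp hu, fun i => ?_⟩
  have hi : ∑ j, (Pi.single i 1 : Fin (d + 1) → ℕ) j + 1 = 2 := by simp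
  exact ⟨(hCle bm bp hb u hu _ hi bp (-1) _ (Or.inr ⟨rfl, rfl, rfl⟩)).trans
      (mul_le_mul_left hCc _),
    (hCle bm bp hb u hu _ hi bm 1 _ (Or.inl ⟨rfl, rfl, rfl⟩)).trans (mul_le_mul_left hCc _)⟩
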